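/- Let $\varphi:\mathbb R^d\to\mathbb R$ be $K$-Lipschitz and $\lambda$-concave for some $\lambda\ge 0$, i.e. $y\mapsto\varphi(y)-\frac\lambda2|y|^2$ is concave. Write $\mathcal L$ (also $|\cdot|$) for Lebesgue measure, $f^*(x)=\sup_y\,(x\cdot y-f(y))$ for the Legendre transform, and $\partial f(x)=\{q: f(z)\ge f(x)+q\cdot(z-x)\ \forall z\}$ for the subgradient. For $\varepsilon,t>0$ let $$u^\varepsilon_t(x)=-\varepsilon\log\Big[(2\pi\varepsilon t)^{-d/2}\int_{\mathbb R^d}\exp\Big(-\frac{|x-y|^2}{2\varepsilon t}-\frac{\varphi(y)}{\varepsilon}\Big)\,dy\Big]$$ be the Cole–Hopf solution of $\partial_tu+\frac12|\nabla u|^2=\frac\varepsilon2\Delta u$, $u|_{t=0}=\varphi$, and let $X^\varepsilon$ be its Lagrangian flow: $X^\varepsilon(y,0)=y$, $\partial_tX^\varepsilon(y,t)=\nabla u^\varepsilon_t(X^\varepsilon(y,t))$ for $t>0$, with $t\mapsto X^\varepsilon(y,t)$ continuous on $[0,\infty)$. Then the limit $X_t(y)=\lim_{\varepsilon\to0^+}X^\varepsilon(y,t)$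 exists for all $y\in\mathbb R^d$, $t\ge0$. For $t\ge0$ put $\psi_t(y)=\frac12|y|^2+t\varphi(y)$, $w_t=\psi_t^*$ and $T_t=\nabla\psi_t^{**}$. For $t>0$ let $\Sigma_t$ be the set of $y$ at which $\psi_t^{**}$ is strictly convex, i.e. for which there is $x\in\partial\psi_t^{**}(y)$ such that $z\mapsto\psi_t^{**}(z)-x\cdot z$ has a strict minimum at $y$. Let $\rho_t=(X_t)_\sharp\mathcal L$, and let $\mu_t$ be the Monge–Ampère measure of $w_t$: $\mu_t(B)=|\partial w_t(B)|$ for Borel $B\subset\mathbb R^d$. Let $t>0$. Then $\psi_t^{**}$ is differentiable everywhere, $X_t$ is Borel measurable, $w_t$ is strictly convex, and $\mu_t$ is a Borel measure. Moreover: 1. For a.e. $x\in\mathbb R^d$ there is $y\in\Sigma_t$ such that $X_t^{-1}(x)=T_t^{-1}(x)=\{y\}$, $\varphi$ is differentiable at $y$, and $$X_s(y)=T_s(y)=y+s\nabla\varphi(y)\qquad\text{for } 0\le s\le t.$$ 2. $\rho_t$ and $\mu_t$ have Lebesgue decompositions with respect to $\mathcal L$, and their absolutely continuous parts agree: $\rho_t^{\rm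 ac}=\mu_t^{\rm ac}$. 3. The density of $\rho_t^{\rm ac}=\mu_t^{\rm ac}$ equals $\det\nabla^2w_t$ Lebesgue-a.e. Here $\nabla^2w_t$ is the Hessian in the sense of Alexandrov, which exists a.e.: $w_t$ is differentiable at $x$, $\nabla^2w_t(x)$ is a symmetric matrix, and $$w_t(x+h)=w_t(x)+\nabla w_t(x)\cdot h+\tfrac12h\cdot\nabla^2w_t(x)h+o(|h|^2)\qquad\text{as } h\to0.$$ -/

import Mathlib

open MeasureTheory Filter Topology Set
open scoped NNReal ENNReal Gradient RealInnerProductSpace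

noncomputable section

namespace Adhesion

/-- `φ` is `lam`-concave: `y ↦ φ y - (lam/2)|y|²` is concave. -/
def IsLambdaConcave {d : ℕ} (lam : ℝ) (φ : EuclideanSpace ℝ (Fin d) → ℝ) : Prop :=
  ConcaveOn ℝ univ (fun y => φ y - lam / 2 * ‖y‖ ^ 2)

/-! ### Convex analysis -/

/-- Legendre transform `f^*(x) = sup_y (x·y - f y)`. It is used only where the supremum is finite:
for `f = ψ_t` with `φ` Lipschitz and `t ≥ 0`, and for `f = ψ_t^*`. -/
def legendre {d : ℕ} (f : EuclideanSpace ℝ (Fin d) → ℝ) (x : EuclideanSpace ℝ (Fin d)) : ℝ :=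
  ⨆ y : EuclideanSpace ℝ (Fin d), (⟪x, y⟫ - f y)

/-- The subgradient `∂f(x)` of `f` at `x`. -/
def subgradient {d : ℕ} (f : EuclideanSpace ℝ (Fin d) → ℝ) (x : EuclideanSpace ℝ (Fin d)) :
    Set (EuclideanSpace ℝ (Fin d)) :=
  {q | ∀ z, f x + ⟪q, z - x⟫ ≤ f z}

/-- `g` is strictly convex at `y`: for some `x ∈ ∂g(y)`, the function `z ↦ g z - x·z` has a strict
minimum at `y`. -/
def StrictlyConvexAt {d : ℕ} (g : EuclideanSpace ℝ (Fin d) → ℝ)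
    (y : EuclideanSpace ℝ (Fin d)) : Prop :=
  ∃ x ∈ subgradient g y, ∀ z, z ≠ y → g y - ⟪x, y⟫ < g z - ⟪x, z⟫

/-- `H` is the Hessian of `f` at `x` in the sense of Alexandrov: `H` is symmetric, `f` is
differentiable at `x`, and `f` has the second-order expansion given by `∇f(x)` and `H`. -/
def HasAlexandrovHessianAt {d : ℕ} (f : EuclideanSpace ℝ (Fin d) → ℝ)
    (H : Matrix (Fin d) (Fin d) ℝ) (x : EuclideanSpace ℝ (Fin d)) : Prop :=
  H.IsSymm ∧ DifferentiableAt ℝ f x ∧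
    (fun h : EuclideanSpace ℝ (Fin d) =>
      f (x + h) - f x - ⟪∇ f x, h⟫ - 1 / 2 * ⟪h, Matrix.toEuclideanLin H h⟫)
      =o[𝓝 0] (fun h => ‖h‖ ^ 2)

/-- `μ` is the Monge–Ampère measure of `w`: `μ(B) = |∂w(B)|` for every Borel set `B`. This
determines `μ`. -/
def IsMongeAmpereMeasure {d : ℕ} (w : EuclideanSpace ℝ (Fin d) → ℝ)
    (μ : Measure (EuclideanSpace ℝ (Fin d))) : Prop :=
  ∀ B, MeasurableSet B → μ B = volume (⋃ x ∈ B, subgradient w x)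

/-! ### Convexified transport -/

/-- The free streaming potential `ψ_t(y) = |y|²/2 + t φ(y)`. -/
def psi {d : ℕ} (φ : EuclideanSpace ℝ (Fin d) → ℝ) (t : ℝ) (y : EuclideanSpace ℝ (Fin d)) : ℝ :=
  1 / 2 * ‖y‖ ^ 2 + t * φ y

/-- `w_t = ψ_t^*`. -/
def w {d : ℕ} (φ : EuclideanSpace ℝ (Fin d) → ℝ) (t : ℝ) : EuclideanSpace ℝ (Fin d) → ℝ :=
  legendre (psi φ t)

/-- The convexified potential `ψ_t^{**} = w_t^*`. -/
def psiConv {d : ℕ} (φ : EuclideanSpace ℝ (Fin d) → ℝ) (t : ℝ) : EuclideanSpace ℝ (Fin d) → ℝ :=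
  legendre (w φ t)

/-- The convexified transport map `T_t = ∇ψ_t^{**}`. -/
def T {d : ℕ} (φ : EuclideanSpace ℝ (Fin d) → ℝ) (t : ℝ) :
    EuclideanSpace ℝ (Fin d) → EuclideanSpace ℝ (Fin d) :=
  ∇ (psiConv φ t)

/-- `Σ_t`, the set of points at which `ψ_t^{**}` is strictly convex. -/
def Sigma {d : ℕ} (φ : EuclideanSpace ℝ (Fin d) → ℝ) (t : ℝ) : Set (EuclideanSpace ℝ (Fin d)) :=
  {y | StrictlyConvexAt (psiConv φ t) y}

/-! ### Lagrangian flow of the adhesion model -/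

/-- The Cole–Hopf solution `u^ε_t` (`ε, t > 0`) of
`∂_t u + |∇u|²/2 = (ε/2) Δu`, `u(·, 0) = φ`. -/
def viscousPotential {d : ℕ} (φ : EuclideanSpace ℝ (Fin d) → ℝ) (ε t : ℝ)
    (x : EuclideanSpace ℝ (Fin d)) : ℝ :=
  -ε * Real.log ((2 * Real.pi * ε * t) ^ (-(d : ℝ) / 2) *
    ∫ y : EuclideanSpace ℝ (Fin d), Real.exp (-‖x - y‖ ^ 2 / (2 * ε * t) - φ y / ε))

/-- `Z t y = X^ε(y, t)` is the Lagrangian flow of the velocity field `v^ε = ∇u^ε`: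
`X^ε(y, 0) = y` and `∂_t X^ε(y, t) = v^ε(X^ε(y, t), t)` for `t > 0`, with `t ↦ X^ε(y, t)` continuous
at the initial time. -/
def IsViscousFlow {d : ℕ} (φ : EuclideanSpace ℝ (Fin d) → ℝ) (ε : ℝ)
    (Z : ℝ → EuclideanSpace ℝ (Fin d) → EuclideanSpace ℝ (Fin d)) : Prop :=
  ∀ y, Z 0 y = y ∧ ContinuousWithinAt (fun t => Z t y) (Ici 0) 0 ∧
    ∀ t, 0 < t → HasDerivAt (fun s => Z s y) (∇ (viscousPotential φ ε t) (Z t y)) t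

/-- `X t y = X_t(y)` is the zero-viscosity limit `lim_{ε → 0+} X^ε(y, t)`, for all `y` and
all `t ≥ 0`. -/
def IsAdhesionFlow {d : ℕ} (φ : EuclideanSpace ℝ (Fin d) → ℝ)
    (X : ℝ → EuclideanSpace ℝ (Fin d) → EuclideanSpace ℝ (Fin d)) : Prop :=
  ∃ Xe : ℝ → ℝ → EuclideanSpace ℝ (Fin d) → EuclideanSpace ℝ (Fin d),
    (∀ ε, 0 < ε → IsViscousFlow φ ε (Xe ε)) ∧
    ∀ t, 0 ≤ t → ∀ y, Tendsto (fun ε => Xe ε t y) (𝓝[>] 0) (𝓝 (X t y))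

/-! ### Measures -/

/-- The mass measure `ρ_t = (X_t)_♯ 𝓛`. -/
def massMeasure {d : ℕ} (X : ℝ → EuclideanSpace ℝ (Fin d) → EuclideanSpace ℝ (Fin d)) (t : ℝ) :
    Measure (EuclideanSpace ℝ (Fin d)) :=
  Measure.map (X t) volume

/-- The absolutely continuous part of `μ` with respect to Lebesgue measure, for `μ` having a
Lebesgue decomposition. -/
def acPart {d : ℕ} (μ : Measure (EuclideanSpace ℝ (Fin d))) :
    Measure (EuclideanSpace ℝ (Fin d)) :=
  volume.withDensity (μ.rnDeriv volume)

end Adhesion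

end

namespace Adhesion

variable {d : ℕ}

/-! ### Semiconcave functions -/

/-! The convex side. Since `ψ_t` is `(1 + tλ)`-concave, its conjugate `w_t` is strongly convex with
modulus `1/(1 + tλ)`, even where `ψ_t` itself is not convex. Hence `ψ_t^{**} = w_t^*` is
differentiable with Lipschitz gradient `T_t`, and `T_t y = x` exactly when `y ∈ ∂w_t(x)`
(`T_eq_iff`). So `∂w_t(B)` is the preimage of `B` under `T_t`, and the Monge–Ampère measure is the
push-forward of Lebesgue measure by `T_t`.

The dynamic side. The Cole–Hopf solutions keep the Lipschitz constant and the `λ`-concavity of `φ`,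
and they converge uniformly to the Hopf–Lax solution `(|x|²/2 - w_t(x))/t`. Curves that follow
supergradients of two uniformly close `λ`-concave potentials stay close, by a Grönwall argument
(`norm_sub_sq_le_of_supergradient`). This one estimate gives the limit `X_t`, its Lipschitz bound
`exp(λt)`, and free motion of every `y` that maximizes `⟪x, ·⟫ - ψ_t`: the straight ray from `y` to
`x` follows supergradients of the Hopf–Lax solution.

Where the two meet. By Rademacher, `w_t` is differentiable at a.e. `x`; there `y = ∇w_t(x)` is the
only maximizer and the only point of the fiber of `T_t`, and `X_t y = x`. That a.e. fiber of `X_t`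
has no other point needs topology. Two points of one fiber lie in connected sets on which `X_t` is
arbitrarily close to `x`, because the viscous flow can be run backwards to small positive times. So
a fiber with two points meets a hyperplane `{q_i = c}` with `c` rational, and the Lipschitz images
of these countably many hyperplanes are null (`IsAdhesionFlow.ae_fiber_subsingleton`).

The densities. The absolutely continuous part of a push-forward depends only on a.e. fiber
(`rnDeriv_map_congr`), so those of `ρ_t` and `μ_t` agree. The area formula for the Lipschitz map
`T_t` gives the density `1/|det DT_t(∇w_t(x))|`. Inverting the first-order expansion of `T_t` at a
nondegenerate point yields the second-order expansion of `w_t`, with Hessian `DT_t⁻¹`; Alexandrov's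
theorem thus comes from Rademacher's theorem for `T_t`. -/

theorem isLambdaConcave_iff {c : ℝ} {f : EuclideanSpace ℝ (Fin d) → ℝ} :
    IsLambdaConcave c f ↔ ∀ x y, ∀ a b : ℝ, 0 ≤ a → 0 ≤ b → a + b = 1 →
      a * f x + b * f y ≤ f (a • x + b • y) + c / 2 * (a * b) * ‖x - y‖ ^ 2 := by
  have h : IsLambdaConcave c f ↔ StrongConcaveOn univ (-c) f := by
    rw [strongConcaveOn_iff_convex, IsLambdaConcave]
    have : (fun y => f y - c / 2 * ‖y‖ ^ 2) = fun y => f y + -c / 2 * ‖y‖ ^ 2 := by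
      ext y; ring
    rw [this]
  rw [h, StrongConcaveOn, UniformConcaveOn]
  constructor
  · rintro ⟨-, h⟩ x y a b ha hb hab
    have := h (mem_univ x) (mem_univ y) ha hb hab
    simp only [smul_eq_mul] at this
    linarith
  · intro h
    refine ⟨convex_univ, fun x _ y _ a b ha hb hab => ?_⟩
    have := h x y a b ha hb hab
    simp only [smul_eq_mul]
    linarith

/-- A first order upper bound with linear part `p` for a semiconcave function is global. -/
theorem IsLambdaConcave.le_of_isLittleO {c : ℝ} {f : EuclideanSpace ℝ (Fin d) → ℝ}
    (hf : IsLambdaConcave c f) {x p : EuclideanSpace ℝ (Fin d)}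
    {e : EuclideanSpace ℝ (Fin d) → ℝ} (he : e =o[𝓝 0] fun h => ‖h‖)
    (hp : ∀ h, f (x + h) ≤ f x + ⟪p, h⟫ + e h) (z : EuclideanSpace ℝ (Fin d)) :
    f z ≤ f x + ⟪p, z - x⟫ + c / 2 * ‖z - x‖ ^ 2 := by
  rw [isLambdaConcave_iff] at hf
  -- Semiconcavity on the segment from `x` to `z`, with weight `a` at `z`, divided by `a`; then `a →
  -- 0` removes the error `e`.
  have key : ∀ a : ℝ, 0 < a → a ≤ 1 →
      f z ≤ f x + ⟪p, z - x⟫ + e (a • (z - x)) / a + c / 2 * (1 - a) * ‖z - x‖ ^ 2 := by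
    intro a ha ha1
    have h1 := hf z x a (1 - a) ha.le (by linarith) (by ring)
    have h2 : a • z + (1 - a) • x = x + a • (z - x) := by module
    rw [h2] at h1
    have h3 := hp (a • (z - x))
    rw [inner_smul_right] at h3
    have h5 : a * e (a • (z - x)) / a = e (a • (z - x)) := by field_simp
    have h4 : a * f z ≤ a * (f x + ⟪p, z - x⟫ + e (a • (z - x)) / a
        + c / 2 * (1 - a) * ‖z - x‖ ^ 2) := by
      rw [mul_add, mul_add, ← mul_div_assoc, h5]
      nlinarith
    exact le_of_mul_le_mul_left h4 ha
  have hlim : Tendsto (fun a : ℝ => e (a • (z - x)) / a) (𝓝[>] 0) (𝓝 0) := by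
    have h0 : Tendsto (fun a : ℝ => a • (z - x)) (𝓝[>] 0) (𝓝 0) := by
      have : Tendsto (fun a : ℝ => a • (z - x)) (𝓝 0) (𝓝 ((0 : ℝ) • (z - x))) :=
        (continuous_id.smul continuous_const).tendsto 0
      rw [zero_smul] at this
      exact this.mono_left nhdsWithin_le_nhds
    have h1 := he.comp_tendsto h0
    have h2 : (fun a : ℝ => e (a • (z - x))) =o[𝓝[>] 0] fun a : ℝ => a := by
      refine h1.trans_isBigO ?_
      refine Asymptotics.IsBigO.of_bound ‖z - x‖ (Eventually.of_forall fun a => ?_)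
      simp [norm_smul, mul_comm]
    exact h2.tendsto_div_nhds_zero
  have hlim2 : Tendsto (fun a : ℝ => f x + ⟪p, z - x⟫ + e (a • (z - x)) / a
      + c / 2 * (1 - a) * ‖z - x‖ ^ 2) (𝓝[>] 0)
      (𝓝 (f x + ⟪p, z - x⟫ + 0 + c / 2 * (1 - 0) * ‖z - x‖ ^ 2)) := by
    refine (tendsto_const_nhds.add hlim).add ?_
    have : Continuous fun a : ℝ => c / 2 * (1 - a) * ‖z - x‖ ^ 2 := by fun_prop
    exact (this.tendsto 0).mono_left nhdsWithin_le_nhds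
  have := ge_of_tendsto hlim2 (b := f z) (by
    filter_upwards [Ioc_mem_nhdsGT (zero_lt_one' ℝ)] with a ha
    exact key a ha.1 ha.2)
  simpa using this

/-- A semiconcave function bounded below by an affine function touching it at `y` is differentiable
at `y`. -/
theorem IsLambdaConcave.le_add_sq_of_le {c : ℝ} {f : EuclideanSpace ℝ (Fin d) → ℝ}
    (hf : IsLambdaConcave c f) {x y : EuclideanSpace ℝ (Fin d)}
    (h : ∀ z, f y + ⟪x, z - y⟫ ≤ f z) (z : EuclideanSpace ℝ (Fin d)) :
    f z ≤ f y + ⟪x, z - y⟫ + c * ‖z - y‖ ^ 2 := by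
  rw [isLambdaConcave_iff] at hf
  -- `y` is the midpoint of `z` and its reflection `2y - z`, so the affine lower bound at the
  -- reflected point turns into an upper bound at `z`.
  have h1 := hf z ((2 : ℝ) • y - z) (1 / 2) (1 / 2) (by norm_num) (by norm_num) (by norm_num)
  have h2 : (1 / 2 : ℝ) • z + (1 / 2 : ℝ) • ((2 : ℝ) • y - z) = y := by module
  have h3 : z - ((2 : ℝ) • y - z) = (2 : ℝ) • (z - y) := by module
  have h4 := h ((2 : ℝ) • y - z)
  have h5 : (2 : ℝ) • y - z - y = -(z - y) := by module
  rw [h2, h3, norm_smul] at h1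
  rw [h5, inner_neg_right] at h4
  have h6 : (‖(2 : ℝ)‖ * ‖z - y‖) ^ 2 = 4 * ‖z - y‖ ^ 2 := by
    rw [Real.norm_ofNat]; ring
  rw [h6] at h1
  nlinarith

theorem hasGradientAt_of_abs_le {c : ℝ} {f : EuclideanSpace ℝ (Fin d) → ℝ}
    {x y : EuclideanSpace ℝ (Fin d)}
    (h : ∀ z, |f z - f y - ⟪x, z - y⟫| ≤ c * ‖z - y‖ ^ 2) : HasGradientAt f x y := by
  rw [hasGradientAt_iff_isLittleO]
  have h1 : (fun z => f z - f y - ⟪x, z - y⟫) =O[𝓝 y] fun z => ‖z - y‖ ^ 2 :=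
    Asymptotics.IsBigO.of_bound c (Eventually.of_forall fun z => by
      simpa using h z)
  refine h1.trans_isLittleO ?_
  have h2 : (fun z : EuclideanSpace ℝ (Fin d) => ‖z - y‖ ^ 2) =o[𝓝 y] fun z => ‖z - y‖ := by
    have := (Asymptotics.isLittleO_pow_id (𝕜 := ℝ) (n := 2) (by norm_num)).comp_tendsto
      (show Tendsto (fun z : EuclideanSpace ℝ (Fin d) => ‖z - y‖) (𝓝 y) (𝓝 0) by
        have : Continuous fun z : EuclideanSpace ℝ (Fin d) => ‖z - y‖ := by fun_prop
        simpa using this.tendsto y)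
    exact this
  exact h2.trans_isBigO (Asymptotics.isBigO_norm_left.2 (Asymptotics.isBigO_refl _ _))

/-! ### Legendre transforms that are attained -/

/-- The supremum that defines the Legendre transform of `f` is attained at every point. -/
def LegendreAttained (f : EuclideanSpace ℝ (Fin d) → ℝ) : Prop :=
  ∀ x, ∃ y, ∀ z, ⟪x, z⟫ - f z ≤ ⟪x, y⟫ - f y

section Legendre

variable {f : EuclideanSpace ℝ (Fin d) → ℝ} {x y z : EuclideanSpace ℝ (Fin d)} {c : ℝ}

theorem legendre_eq_of_forall_le (h : ∀ z, ⟪x, z⟫ - f z ≤ ⟪x, y⟫ - f y) :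
    legendre f x = ⟪x, y⟫ - f y :=
  le_antisymm (ciSup_le h)
    (le_ciSup (f := fun z => ⟪x, z⟫ - f z) ⟨_, by rintro _ ⟨z, rfl⟩; exact h z⟩ y)

theorem LegendreAttained.exists_eq (hf : LegendreAttained f) (x : EuclideanSpace ℝ (Fin d)) :
    ∃ y, legendre f x = ⟪x, y⟫ - f y :=
  (hf x).imp fun _ => legendre_eq_of_forall_le

theorem LegendreAttained.inner_sub_le (hf : LegendreAttained f) (x y : EuclideanSpace ℝ (Fin d)) :
    ⟪x, y⟫ - f y ≤ legendre f x := by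
  obtain ⟨z, hz⟩ := hf x
  rw [legendre_eq_of_forall_le hz]
  exact hz y

theorem LegendreAttained.mem_subgradient (hf : LegendreAttained f)
    (h : legendre f x = ⟪x, y⟫ - f y) : y ∈ subgradient (legendre f) x := by
  intro z
  have := hf.inner_sub_le z y
  rw [h, inner_sub_right, real_inner_comm z y, real_inner_comm x y]
  linarith

theorem LegendreAttained.mem_subgradient_iff (hf : LegendreAttained f) :
    y ∈ subgradient f x ↔ legendre f y = ⟪y, x⟫ - f x := by
  constructor
  · intro h
    refine legendre_eq_of_forall_le fun z => ?_
    have := h z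
    rw [inner_sub_right] at this
    linarith
  · intro h z
    have := hf.inner_sub_le y z
    rw [inner_sub_right]
    linarith

/-- An upper curvature bound on `f` becomes a lower curvature bound on its conjugate. Convexity of
`f` plays no role. -/
theorem LegendreAttained.legendre_strong (hf : LegendreAttained f) (hc : 0 < c)
    (hconc : IsLambdaConcave c f) (x₀ x₁ : EuclideanSpace ℝ (Fin d)) {a b : ℝ} (ha : 0 ≤ a)
    (hb : 0 ≤ b) (hab : a + b = 1) :
    legendre f (a • x₀ + b • x₁) + a * b * (1 / (2 * c) * ‖x₀ - x₁‖ ^ 2) ≤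
      a * legendre f x₀ + b * legendre f x₁ := by
  obtain ⟨y, hy⟩ := hf.exists_eq (a • x₀ + b • x₁)
  obtain ⟨v, hv⟩ : ∃ v, v = x₀ - x₁ := ⟨_, rfl⟩
  rw [← hv]
  -- The weighted mean of the two test points is the maximizer `y`. A displacement `s • v` between
  -- them gains `ab s ‖v‖²` in the linear terms and costs `ab c s² ‖v‖²/2`; the best choice is `s =
  -- 1/c`.
  have h0 := hf.inner_sub_le x₀ (y + (b / c) • v)
  have h1 := hf.inner_sub_le x₁ (y - (a / c) • v)
  have h2 := isLambdaConcave_iff.1 hconc (y + (b / c) • v) (y - (a / c) • v) a b ha hb hab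
  have e1 : a • (y + (b / c) • v) + b • (y - (a / c) • v) = y := by
    have : a • (y + (b / c) • v) + b • (y - (a / c) • v) = (a + b) • y := by
      rw [smul_add, smul_sub, smul_smul, smul_smul, add_smul,
        show a * (b / c) = b * (a / c) by ring]
      abel
    rw [this, hab, one_smul]
  have e2 : y + (b / c) • v - (y - (a / c) • v) = (1 / c) • v := by
    rw [← hab, add_div, add_smul]; abel
  rw [e1, e2, norm_smul, Real.norm_of_nonneg (by positivity)] at h2
  rw [inner_add_right, inner_smul_right] at h0
  rw [inner_sub_right, inner_smul_right] at h1
  have e3 : ⟪x₀, v⟫ - ⟪x₁, v⟫ = ‖v‖ ^ 2 := by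
    rw [← inner_sub_left, ← hv, real_inner_self_eq_norm_sq]
  rw [hy, inner_add_left, inner_smul_left, inner_smul_left]
  simp only [conj_trivial]
  have h0' := mul_le_mul_of_nonneg_left h0 ha
  have h1' := mul_le_mul_of_nonneg_left h1 hb
  have e4 : c / 2 * (a * b) * (1 / c * ‖v‖) ^ 2 = a * b * (1 / (2 * c) * ‖v‖ ^ 2) := by
    field_simp
  have e5 : a * (b / c * ⟪x₀, v⟫) - b * (a / c * ⟪x₁, v⟫) = 2 * (a * b * (1 / (2 * c) * ‖v‖ ^ 2)) := by
    rw [← e3]; field_simp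
  nlinarith

/-- The subgradient inequality improved by strong convexity. -/
theorem subgradient_strong {w : EuclideanSpace ℝ (Fin d) → ℝ} {m : ℝ}
    (hw : ∀ x₀ x₁, ∀ a b : ℝ, 0 ≤ a → 0 ≤ b → a + b = 1 →
      w (a • x₀ + b • x₁) + a * b * (m * ‖x₀ - x₁‖ ^ 2) ≤ a * w x₀ + b * w x₁)
    (hy : y ∈ subgradient w x) (z : EuclideanSpace ℝ (Fin d)) :
    w x + ⟪y, z - x⟫ + m * ‖z - x‖ ^ 2 ≤ w z := by
  have key : ∀ a : ℝ, 0 < a → a ≤ 1 →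
      w x + ⟪y, z - x⟫ + (1 - a) * (m * ‖z - x‖ ^ 2) ≤ w z := by
    intro a ha ha1
    have h1 := hw z x a (1 - a) ha.le (by linarith) (by ring)
    have h2 := hy (a • z + (1 - a) • x)
    have h3 : a • z + (1 - a) • x - x = a • (z - x) := by module
    rw [h3, inner_smul_right] at h2
    refine le_of_mul_le_mul_left ?_ ha
    nlinarith
  have hlim : Tendsto (fun a : ℝ => w x + ⟪y, z - x⟫ + (1 - a) * (m * ‖z - x‖ ^ 2)) (𝓝[>] 0)
      (𝓝 (w x + ⟪y, z - x⟫ + (1 - 0) * (m * ‖z - x‖ ^ 2))) := by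
    have : Continuous fun a : ℝ => w x + ⟪y, z - x⟫ + (1 - a) * (m * ‖z - x‖ ^ 2) := by fun_prop
    exact (this.tendsto 0).mono_left nhdsWithin_le_nhds
  have := le_of_tendsto hlim (b := w z) (by
    filter_upwards [Ioc_mem_nhdsGT (zero_lt_one' ℝ)] with a ha
    exact key a ha.1 ha.2)
  simpa using this

end Legendre

/-! ### The potentials `ψ_t`, `w_t`, `ψ_t^{**}` and the Hopf–Lax solution -/

section Potentials

variable {φ : EuclideanSpace ℝ (Fin d) → ℝ} {K : ℝ≥0} {lam t : ℝ}
  {x y z : EuclideanSpace ℝ (Fin d)}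

theorem apply_le_add_of_lipschitzWith (hK : LipschitzWith K φ) (x y : EuclideanSpace ℝ (Fin d)) :
    φ x ≤ φ y + K * ‖x - y‖ := by
  have := hK.le_add_mul x y
  rwa [dist_eq_norm] at this

theorem isLambdaConcave_psi (ht : 0 ≤ t) (hconc : IsLambdaConcave lam φ) :
    IsLambdaConcave (1 + t * lam) (psi φ t) := by
  have h : ConcaveOn ℝ univ (t • fun y => φ y - lam / 2 * ‖y‖ ^ 2) := ConcaveOn.smul ht hconc
  have e : (fun y => psi φ t y - (1 + t * lam) / 2 * ‖y‖ ^ 2)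
      = t • fun y => φ y - lam / 2 * ‖y‖ ^ 2 := by
    ext y
    simp only [psi, Pi.smul_apply, smul_eq_mul]
    ring
  rw [IsLambdaConcave, e]
  exact h

theorem legendreAttained_psi (ht : 0 ≤ t) (hK : LipschitzWith K φ) :
    LegendreAttained (psi φ t) := by
  intro x
  have hc : Continuous fun z => ⟪x, z⟫ - psi φ t z := by
    have := hK.continuous
    unfold psi
    fun_prop
  obtain ⟨y, hy⟩ := hc.exists_forall_ge' 0 (by
    filter_upwards [(tendsto_norm_cocompact_atTop
      (E := EuclideanSpace ℝ (Fin d))).eventually_ge_atTop (2 * (‖x‖ + t * K))] with z hz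
    have h1 := apply_le_add_of_lipschitzWith hK 0 z
    have h2 := real_inner_le_norm x z
    rw [zero_sub, norm_neg] at h1
    have h3 := mul_le_mul_of_nonneg_left h1 ht
    have h4 := mul_le_mul_of_nonneg_left hz (norm_nonneg z)
    simp only [psi, inner_zero_right, norm_zero]
    nlinarith)
  exact ⟨y, hy⟩

theorem inner_sub_psi_le_w (ht : 0 ≤ t) (hK : LipschitzWith K φ)
    (x y : EuclideanSpace ℝ (Fin d)) : ⟪x, y⟫ - psi φ t y ≤ w φ t x :=
  (legendreAttained_psi ht hK).inner_sub_le x y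

theorem exists_w_eq (ht : 0 ≤ t) (hK : LipschitzWith K φ) (x : EuclideanSpace ℝ (Fin d)) :
    ∃ y, w φ t x = ⟪x, y⟫ - psi φ t y :=
  (legendreAttained_psi ht hK).exists_eq x

/-- The Hopf–Lax solution `u_t(x) = inf_y (|x - y|²/(2t) + φ y)`, written as
`(|x|²/2 - w_t(x))/t`. -/
noncomputable def hopfLax (φ : EuclideanSpace ℝ (Fin d) → ℝ) (t : ℝ)
    (x : EuclideanSpace ℝ (Fin d)) : ℝ :=
  (1 / 2 * ‖x‖ ^ 2 - w φ t x) / t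

theorem half_norm_sq_sub (x y : EuclideanSpace ℝ (Fin d)) :
    1 / 2 * ‖x‖ ^ 2 - (⟪x, y⟫ - psi φ t y) = 1 / 2 * ‖x - y‖ ^ 2 + t * φ y := by
  rw [norm_sub_sq_real, psi]; ring

theorem hopfLax_le (ht : 0 < t) (hK : LipschitzWith K φ) (x y : EuclideanSpace ℝ (Fin d)) :
    hopfLax φ t x ≤ ‖x - y‖ ^ 2 / (2 * t) + φ y := by
  have h := inner_sub_psi_le_w ht.le hK x y
  have e := half_norm_sq_sub (φ := φ) (t := t) x y
  rw [hopfLax, div_le_iff₀ ht]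
  have : (‖x - y‖ ^ 2 / (2 * t) + φ y) * t = 1 / 2 * ‖x - y‖ ^ 2 + t * φ y := by
    field_simp
  linarith

theorem hopfLax_eq_iff (ht : 0 < t) :
    hopfLax φ t x = ‖x - y‖ ^ 2 / (2 * t) + φ y ↔ w φ t x = ⟪x, y⟫ - psi φ t y := by
  have e := half_norm_sq_sub (φ := φ) (t := t) x y
  have : (‖x - y‖ ^ 2 / (2 * t) + φ y) * t = 1 / 2 * ‖x - y‖ ^ 2 + t * φ y := by
    field_simp
  rw [hopfLax, div_eq_iff ht.ne']
  constructor <;> intro h <;> linarith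

theorem exists_hopfLax_eq (ht : 0 < t) (hK : LipschitzWith K φ)
    (x : EuclideanSpace ℝ (Fin d)) :
    ∃ y, hopfLax φ t x = ‖x - y‖ ^ 2 / (2 * t) + φ y :=
  (exists_w_eq ht.le hK x).imp fun _ => (hopfLax_eq_iff ht).2

theorem lipschitzWith_hopfLax (ht : 0 < t) (hK : LipschitzWith K φ) :
    LipschitzWith K (hopfLax φ t) := by
  refine LipschitzWith.of_le_add_mul K fun x x' => ?_
  obtain ⟨y, hy⟩ := exists_hopfLax_eq ht hK x'
  have h1 := hopfLax_le ht hK x (y + (x - x'))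
  have h2 := apply_le_add_of_lipschitzWith hK (y + (x - x')) y
  rw [show x - (y + (x - x')) = x' - y by abel] at h1
  rw [add_sub_cancel_left] at h2
  rw [dist_eq_norm]
  linarith

/-- In terms of the displacement `v`, the Hopf–Lax solution is the infimum of `|v|²/(2t) + φ(x -
v)`, that is, of translates of `φ` plus constants; each translate is `λ`-concave. -/
theorem isLambdaConcave_hopfLax (ht : 0 < t) (hK : LipschitzWith K φ)
    (hconc : IsLambdaConcave lam φ) : IsLambdaConcave lam (hopfLax φ t) := by
  rw [isLambdaConcave_iff] at hconc ⊢
  intro x₀ x₁ a b ha hb hab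
  obtain ⟨y, hy⟩ := exists_hopfLax_eq ht hK (a • x₀ + b • x₁)
  obtain ⟨v, hv⟩ : ∃ v, v = a • x₀ + b • x₁ - y := ⟨_, rfl⟩
  have h0 := hopfLax_le ht hK x₀ (x₀ - v)
  have h1 := hopfLax_le ht hK x₁ (x₁ - v)
  have h2 := hconc (x₀ - v) (x₁ - v) a b ha hb hab
  have e1 : a • (x₀ - v) + b • (x₁ - v) = y := by
    have : a • (x₀ - v) + b • (x₁ - v) = a • x₀ + b • x₁ - (a + b) • v := by module
    rw [this, hab, one_smul, hv]; abel
  rw [sub_sub_cancel] at h0 h1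
  rw [e1, sub_sub_sub_cancel_right] at h2
  rw [hy, ← hv]
  have h3 := mul_le_mul_of_nonneg_left h0 ha
  have h4 := mul_le_mul_of_nonneg_left h1 hb
  have h5 : a * (‖v‖ ^ 2 / (2 * t)) + b * (‖v‖ ^ 2 / (2 * t)) = ‖v‖ ^ 2 / (2 * t) := by
    rw [← add_mul, hab, one_mul]
  linarith

theorem w_zero (φ : EuclideanSpace ℝ (Fin d) → ℝ) (x : EuclideanSpace ℝ (Fin d)) :
    w φ 0 x = 1 / 2 * ‖x‖ ^ 2 := by
  have h : w φ 0 x = ⟪x, x⟫ - psi φ 0 x := by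
    refine legendre_eq_of_forall_le fun z => ?_
    have h1 := half_norm_sq_sub (φ := φ) (t := 0) x z
    have h2 := half_norm_sq_sub (φ := φ) (t := 0) x x
    rw [sub_self, norm_zero] at h2
    nlinarith [sq_nonneg ‖x - z‖]
  rw [h, real_inner_self_eq_norm_sq, psi]
  ring

/-- `w_t` is itself of the form `ψ_t`, for a potential with the same Lipschitz constant. -/
theorem exists_w_eq_psi (ht : 0 ≤ t) (hK : LipschitzWith K φ) :
    ∃ g : EuclideanSpace ℝ (Fin d) → ℝ, LipschitzWith K g ∧ w φ t = psi g t := by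
  rcases ht.eq_or_lt with rfl | ht
  · refine ⟨φ, hK, ?_⟩
    ext x
    rw [w_zero, psi, zero_mul, add_zero]
  · refine ⟨fun x => -hopfLax φ t x, (lipschitzWith_hopfLax ht hK).neg, ?_⟩
    ext x
    rw [psi, hopfLax]
    field_simp
    ring

theorem legendreAttained_w (ht : 0 ≤ t) (hK : LipschitzWith K φ) : LegendreAttained (w φ t) := by
  obtain ⟨g, hg, e⟩ := exists_w_eq_psi ht hK
  rw [e]
  exact legendreAttained_psi ht hg

theorem one_add_mul_pos (ht : 0 ≤ t) (hlam : 0 ≤ lam) : 0 < 1 + t * lam := by positivity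

theorem w_strong (ht : 0 ≤ t) (hK : LipschitzWith K φ) (hlam : 0 ≤ lam)
    (hconc : IsLambdaConcave lam φ) (x₀ x₁ : EuclideanSpace ℝ (Fin d)) (a b : ℝ) (ha : 0 ≤ a)
    (hb : 0 ≤ b) (hab : a + b = 1) :
    w φ t (a • x₀ + b • x₁) + a * b * (1 / (2 * (1 + t * lam)) * ‖x₀ - x₁‖ ^ 2) ≤
      a * w φ t x₀ + b * w φ t x₁ :=
  (legendreAttained_psi ht hK).legendre_strong (one_add_mul_pos ht hlam)
    (isLambdaConcave_psi ht hconc) x₀ x₁ ha hb hab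

theorem strictConvexOn_w (ht : 0 ≤ t) (hK : LipschitzWith K φ) (hlam : 0 ≤ lam)
    (hconc : IsLambdaConcave lam φ) : StrictConvexOn ℝ univ (w φ t) := by
  refine ⟨convex_univ, fun x₀ _ x₁ _ hne a b ha hb hab => ?_⟩
  have h := w_strong ht hK hlam hconc x₀ x₁ a b ha.le hb.le hab
  have h1 := one_add_mul_pos ht hlam
  have h2 : 0 < ‖x₀ - x₁‖ := norm_pos_iff.2 (sub_ne_zero.2 hne)
  have h3 : 0 < a * b * (1 / (2 * (1 + t * lam)) * ‖x₀ - x₁‖ ^ 2) := by positivity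
  simp only [smul_eq_mul]
  linarith

theorem subgradient_w_strong (ht : 0 ≤ t) (hK : LipschitzWith K φ) (hlam : 0 ≤ lam)
    (hconc : IsLambdaConcave lam φ) (hy : y ∈ subgradient (w φ t) x)
    (z : EuclideanSpace ℝ (Fin d)) :
    w φ t x + ⟪y, z - x⟫ + 1 / (2 * (1 + t * lam)) * ‖z - x‖ ^ 2 ≤ w φ t z :=
  subgradient_strong (w_strong ht hK hlam hconc) hy z

theorem psiConv_eq_of_mem (ht : 0 ≤ t) (hK : LipschitzWith K φ)
    (hy : y ∈ subgradient (w φ t) x) : psiConv φ t y = ⟪y, x⟫ - w φ t x :=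
  (legendreAttained_w ht hK).mem_subgradient_iff.1 hy

theorem inner_sub_w_le_psiConv (ht : 0 ≤ t) (hK : LipschitzWith K φ)
    (x y : EuclideanSpace ℝ (Fin d)) : ⟪y, x⟫ - w φ t x ≤ psiConv φ t y :=
  (legendreAttained_w ht hK).inner_sub_le y x

/-- The lower bound is the definition of the conjugate. For the upper bound, strong convexity of
`w_t` at `x` and Young's inequality bound the conjugate by a paraboloid touching at `y`. -/
theorem hasGradientAt_psiConv (ht : 0 ≤ t) (hK : LipschitzWith K φ) (hlam : 0 ≤ lam)
    (hconc : IsLambdaConcave lam φ) (hy : y ∈ subgradient (w φ t) x) :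
    HasGradientAt (psiConv φ t) x y := by
  have hc := one_add_mul_pos ht hlam
  refine hasGradientAt_of_abs_le (c := (1 + t * lam) / 2) fun z => ?_
  have h0 := psiConv_eq_of_mem ht hK hy
  rw [abs_of_nonneg]
  · obtain ⟨x', hx'⟩ := (legendreAttained_w ht hK).exists_eq z
    have h1 := subgradient_w_strong ht hK hlam hconc hy x'
    change psiConv φ t z = _ at hx'
    rw [h0, hx']
    have h2 : ⟪x' - x, z - y⟫ ≤ ‖x' - x‖ * ‖z - y‖ := real_inner_le_norm _ _
    have h3 : ‖x' - x‖ * ‖z - y‖ ≤ 1 / (2 * (1 + t * lam)) * ‖x' - x‖ ^ 2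
        + (1 + t * lam) / 2 * ‖z - y‖ ^ 2 := by
      have h4 : 0 ≤ (‖x' - x‖ - (1 + t * lam) * ‖z - y‖) ^ 2 / (2 * (1 + t * lam)) := by positivity
      have h5 : (‖x' - x‖ - (1 + t * lam) * ‖z - y‖) ^ 2 / (2 * (1 + t * lam))
        = 1 / (2 * (1 + t * lam)) * ‖x' - x‖ ^ 2
        + (1 + t * lam) / 2 * ‖z - y‖ ^ 2 - ‖x' - x‖ * ‖z - y‖ := by
        field_simp; ring
      linarith
    have e1 : ⟪x, z - y⟫ = ⟪z, x⟫ - ⟪y, x⟫ := by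
      rw [inner_sub_right, real_inner_comm z x, real_inner_comm y x]
    have e2 : ⟪x' - x, z - y⟫ = ⟪z, x'⟫ - ⟪y, x'⟫ - ⟪z, x⟫ + ⟪y, x⟫ := by
      rw [real_inner_comm, inner_sub_left, inner_sub_right, inner_sub_right]; ring
    rw [inner_sub_right] at h1
    linarith
  · have h1 := inner_sub_w_le_psiConv ht hK x z
    have e1 : ⟪x, z - y⟫ = ⟪z, x⟫ - ⟪y, x⟫ := by
      rw [inner_sub_right, real_inner_comm z x, real_inner_comm y x]
    linarith

theorem exists_mem_subgradient_w (ht : 0 ≤ t) (hK : LipschitzWith K φ)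
    (y : EuclideanSpace ℝ (Fin d)) : ∃ x, y ∈ subgradient (w φ t) x :=
  ((legendreAttained_w ht hK).exists_eq y).imp fun _ h =>
    (legendreAttained_w ht hK).mem_subgradient_iff.2 h

/-- The fiber of `T_t` over `x` is `∂w_t(x)`: every `y` belongs to some `∂w_t(x')`, and the gradient
of the conjugate at `y` is then `x'`. Later arguments use `T_t` through this equivalence. -/
theorem T_eq_iff (ht : 0 ≤ t) (hK : LipschitzWith K φ) (hlam : 0 ≤ lam)
    (hconc : IsLambdaConcave lam φ) : T φ t y = x ↔ y ∈ subgradient (w φ t) x := by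
  obtain ⟨x', hx'⟩ := exists_mem_subgradient_w ht hK y
  have h' := (hasGradientAt_psiConv ht hK hlam hconc hx').gradient
  constructor
  · rintro rfl
    rw [T, h']
    exact hx'
  · intro h
    exact (hasGradientAt_psiConv ht hK hlam hconc h).gradient

theorem mem_subgradient_T (ht : 0 ≤ t) (hK : LipschitzWith K φ) (hlam : 0 ≤ lam)
    (hconc : IsLambdaConcave lam φ) (y : EuclideanSpace ℝ (Fin d)) :
    y ∈ subgradient (w φ t) (T φ t y) :=
  (T_eq_iff ht hK hlam hconc).1 rfl

theorem hasGradientAt_psiConv_T (ht : 0 ≤ t) (hK : LipschitzWith K φ) (hlam : 0 ≤ lam)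
    (hconc : IsLambdaConcave lam φ) (y : EuclideanSpace ℝ (Fin d)) :
    HasGradientAt (psiConv φ t) (T φ t y) y :=
  hasGradientAt_psiConv ht hK hlam hconc (mem_subgradient_T ht hK hlam hconc y)

theorem differentiable_psiConv (ht : 0 ≤ t) (hK : LipschitzWith K φ) (hlam : 0 ≤ lam)
    (hconc : IsLambdaConcave lam φ) : Differentiable ℝ (psiConv φ t) := fun y =>
  (hasGradientAt_psiConv_T ht hK hlam hconc y).differentiableAt

/-- Cocoercivity, by adding the two strong subgradient inequalities. It yields both the Lipschitz
bound on `T_t` and the positivity of its derivative. -/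
theorem norm_sub_sq_le_inner_T (ht : 0 ≤ t) (hK : LipschitzWith K φ) (hlam : 0 ≤ lam)
    (hconc : IsLambdaConcave lam φ) (y z : EuclideanSpace ℝ (Fin d)) :
    ‖T φ t y - T φ t z‖ ^ 2 ≤ (1 + t * lam) * ⟪y - z, T φ t y - T φ t z⟫ := by
  have hc := one_add_mul_pos ht hlam
  have h1 := subgradient_w_strong ht hK hlam hconc (mem_subgradient_T ht hK hlam hconc y) (T φ t z)
  have h2 := subgradient_w_strong ht hK hlam hconc (mem_subgradient_T ht hK hlam hconc z) (T φ t y)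
  have e : ⟪y - z, T φ t y - T φ t z⟫ = -⟪y, T φ t z - T φ t y⟫ - ⟪z, T φ t y - T φ t z⟫ := by
    rw [inner_sub_left, ← inner_neg_right, neg_sub]
  rw [norm_sub_rev] at h1
  have h3 : 1 / (1 + t * lam) * ‖T φ t y - T φ t z‖ ^ 2 ≤ ⟪y - z, T φ t y - T φ t z⟫ := by
    have : 1 / (1 + t * lam) * ‖T φ t y - T φ t z‖ ^ 2
      = 2 * (1 / (2 * (1 + t * lam)) * ‖T φ t y - T φ t z‖ ^ 2) := by field_simp
    linarith
  have h4 := mul_le_mul_of_nonneg_left h3 hc.le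
  have h5 : (1 + t * lam) * (1 / (1 + t * lam) * ‖T φ t y - T φ t z‖ ^ 2)
    = ‖T φ t y - T φ t z‖ ^ 2 := by field_simp
  linarith

theorem lipschitzWith_T (ht : 0 ≤ t) (hK : LipschitzWith K φ) (hlam : 0 ≤ lam)
    (hconc : IsLambdaConcave lam φ) : LipschitzWith (1 + t * lam).toNNReal (T φ t) := by
  have hc := one_add_mul_pos ht hlam
  refine LipschitzWith.of_dist_le_mul fun y z => ?_
  rw [dist_eq_norm, dist_eq_norm, Real.coe_toNNReal _ hc.le]
  have h1 := norm_sub_sq_le_inner_T ht hK hlam hconc y z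
  have h2 := real_inner_le_norm (y - z) (T φ t y - T φ t z)
  rcases (norm_nonneg (T φ t y - T φ t z)).eq_or_lt with h | h
  · rw [← h]; positivity
  · refine le_of_mul_le_mul_left ?_ h
    nlinarith

theorem norm_T_sub_le (ht : 0 ≤ t) (hK : LipschitzWith K φ) (hlam : 0 ≤ lam)
    (hconc : IsLambdaConcave lam φ) (y : EuclideanSpace ℝ (Fin d)) :
    ‖T φ t y - y‖ ≤ 2 * t * K := by
  obtain ⟨g, hg, e⟩ := exists_w_eq_psi ht hK
  -- With `w_t = |·|²/2 + t g` and `x = T_t y`, the subgradient inequality tested at `y` itself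
  -- reads `|x - y|²/2 ≤ t (g y - g x)`, whence the factor 2.
  have h1 := mem_subgradient_T ht hK hlam hconc y y
  have h2 := apply_le_add_of_lipschitzWith hg y (T φ t y)
  obtain ⟨x, hx⟩ : ∃ x, x = T φ t y := ⟨_, rfl⟩
  rw [← hx] at h1 h2 ⊢
  rw [e, psi, psi, inner_sub_right, real_inner_self_eq_norm_sq] at h1
  have h3 := mul_le_mul_of_nonneg_left h2 ht
  have h4 := norm_sub_sq_real x y
  rw [norm_sub_rev] at h3
  rw [real_inner_comm] at h4
  rcases (norm_nonneg (x - y)).eq_or_lt with h | h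
  · rw [← h]; positivity
  · refine le_of_mul_le_mul_left ?_ h
    nlinarith

/-! ### Free streaming -/

theorem mem_subgradient_w_of_eq (ht : 0 ≤ t) (hK : LipschitzWith K φ)
    (h : w φ t x = ⟪x, y⟫ - psi φ t y) : y ∈ subgradient (w φ t) x :=
  (legendreAttained_psi ht hK).mem_subgradient h

theorem subgradient_eq_singleton {f : EuclideanSpace ℝ (Fin d) → ℝ} (hf : DifferentiableAt ℝ f x)
    (hy : y ∈ subgradient f x) : y = ∇ f x := by
  have h1 : IsLocalMin (fun z => f z - ⟪y, z⟫) x := Eventually.of_forall fun z => by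
    have := hy z
    rw [inner_sub_right] at this
    change f x - ⟪y, x⟫ ≤ f z - ⟪y, z⟫
    linarith
  have h2 : HasFDerivAt (fun z => f z - ⟪y, z⟫) (fderiv ℝ f x - innerSL ℝ y) x :=
    hf.hasFDerivAt.sub (innerSL ℝ y).hasFDerivAt
  have h3 := h1.hasFDerivAt_eq_zero h2
  rw [sub_eq_zero] at h3
  rw [gradient, h3]
  refine (InnerProductSpace.toDual ℝ _).injective ?_
  rw [LinearIsometryEquiv.apply_symm_apply]
  ext z
  simp

/-- Maximizers of `⟪x, ·⟫ - ψ_t` are points of differentiability of `φ`. -/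
theorem hasGradientAt_of_w_eq (ht : 0 < t) (hK : LipschitzWith K φ)
    (hconc : IsLambdaConcave lam φ) (h : w φ t x = ⟪x, y⟫ - psi φ t y) :
    HasGradientAt φ (t⁻¹ • (x - y)) y := by
  have h1 : ∀ z, psi φ t y + ⟪x, z - y⟫ ≤ psi φ t z := fun z => by
    have := inner_sub_psi_le_w ht.le hK x z
    rw [inner_sub_right]
    linarith
  have h2 := (isLambdaConcave_psi ht.le hconc).le_add_sq_of_le h1
  refine hasGradientAt_of_abs_le (c := (|1 + t * lam| + 1 / 2) / t) fun z => ?_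
  have e : φ z - φ y - ⟪t⁻¹ • (x - y), z - y⟫
      = (psi φ t z - psi φ t y - ⟪x, z - y⟫ - 1 / 2 * ‖z - y‖ ^ 2) / t := by
    rw [inner_smul_left, psi, psi, norm_sub_sq_real, inner_sub_left, inner_sub_right y z y,
      real_inner_self_eq_norm_sq, real_inner_comm y z]
    simp only [conj_trivial]
    field_simp
    ring
  rw [e, abs_div, abs_of_pos ht, div_mul_eq_mul_div (_ + _)]
  refine div_le_div_of_nonneg_right ?_ ht.le
  have h3 := h1 z
  have h4 := h2 z
  have h5 := mul_le_mul_of_nonneg_right (le_abs_self (1 + t * lam)) (sq_nonneg ‖z - y‖)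
  have h6 := mul_nonneg (abs_nonneg (1 + t * lam)) (sq_nonneg ‖z - y‖)
  rw [abs_le]
  constructor <;> nlinarith [sq_nonneg ‖z - y‖]

/-- A maximizer at time `t` is a maximizer at all earlier times, along a straight line. -/
theorem w_eq_of_le (ht : 0 < t) (hK : LipschitzWith K φ)
    (h : w φ t x = ⟪x, y⟫ - psi φ t y) {s : ℝ} (hs : 0 ≤ s) (hst : s ≤ t) :
    w φ s (y + s • t⁻¹ • (x - y)) = ⟪y + s • t⁻¹ • (x - y), y⟫ - psi φ s y := by
  refine legendre_eq_of_forall_le fun z => ?_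
  have h1 := inner_sub_psi_le_w ht.le hK x z
  rw [h] at h1
  have hr : 0 ≤ s / t := by positivity
  have hr1 : s / t ≤ 1 := (div_le_one ht).2 hst
  -- The objective at time `s` is a convex combination of the objective at time `t` and of `⟪y, ·⟫ -
  -- |·|²/2`, and `y` maximizes both.
  have e : ∀ z, ⟪y + s • t⁻¹ • (x - y), z⟫ - psi φ s z
      = s / t * (⟪x, z⟫ - psi φ t z) + (1 - s / t) * (⟪y, z⟫ - 1 / 2 * ‖z‖ ^ 2) := by
    intro z
    rw [inner_add_left, inner_smul_left, inner_smul_left, inner_sub_left, psi, psi]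
    simp only [conj_trivial]
    field_simp
    ring
  rw [e z, e y]
  have h2 : ⟪y, z⟫ - 1 / 2 * ‖z‖ ^ 2 ≤ ⟪y, y⟫ - 1 / 2 * ‖y‖ ^ 2 := by
    have h3 := norm_sub_sq_real y z
    rw [real_inner_self_eq_norm_sq]
    nlinarith [sq_nonneg ‖y - z‖]
  have h4 := mul_le_mul_of_nonneg_left h1 hr
  have h5 := mul_le_mul_of_nonneg_left h2 (sub_nonneg.2 hr1)
  linarith

/-- Rademacher applied to the Lipschitz Hopf–Lax solution, from which `w_t` differs by a smooth term
and a factor. -/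
theorem ae_differentiableAt_w (ht : 0 < t) (hK : LipschitzWith K φ) :
    ∀ᵐ x : EuclideanSpace ℝ (Fin d), DifferentiableAt ℝ (w φ t) x := by
  filter_upwards [(lipschitzWith_hopfLax ht hK).ae_differentiableAt] with x hx
  have e : w φ t = fun x => 1 / 2 * ‖x‖ ^ 2 - t * hopfLax φ t x := by
    ext x
    rw [hopfLax]
    field_simp
    ring
  rw [e]
  have h1 : DifferentiableAt ℝ (fun x : EuclideanSpace ℝ (Fin d) => ‖x‖ ^ 2) x :=
    (differentiable_id.norm_sq ℝ) x
  exact (h1.const_mul _).sub (hx.const_mul _)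

/-- At a point of differentiability of `w_t`, the gradient is the only maximizer. -/
theorem w_eq_of_differentiableAt (ht : 0 ≤ t) (hK : LipschitzWith K φ)
    (hx : DifferentiableAt ℝ (w φ t) x) :
    w φ t x = ⟪x, ∇ (w φ t) x⟫ - psi φ t (∇ (w φ t) x) := by
  obtain ⟨y, hy⟩ := exists_w_eq ht hK x
  rwa [← subgradient_eq_singleton hx (mem_subgradient_w_of_eq ht hK hy)]

theorem T_preimage_of_differentiableAt (ht : 0 ≤ t) (hK : LipschitzWith K φ) (hlam : 0 ≤ lam)
    (hconc : IsLambdaConcave lam φ) (hx : DifferentiableAt ℝ (w φ t) x) :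
    T φ t ⁻¹' {x} = {∇ (w φ t) x} := by
  ext y
  rw [mem_preimage, mem_singleton_iff, mem_singleton_iff, T_eq_iff ht hK hlam hconc]
  refine ⟨subgradient_eq_singleton hx, ?_⟩
  rintro rfl
  exact mem_subgradient_w_of_eq ht hK (w_eq_of_differentiableAt ht hK hx)

theorem gradient_w_mem_Sigma (ht : 0 ≤ t) (hK : LipschitzWith K φ)
    (hx : DifferentiableAt ℝ (w φ t) x) : ∇ (w φ t) x ∈ Sigma φ t := by
  have hy := mem_subgradient_w_of_eq ht hK (w_eq_of_differentiableAt ht hK hx)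
  have h0 := psiConv_eq_of_mem ht hK hy
  refine ⟨x, (legendreAttained_w ht hK).mem_subgradient h0, fun z hz => ?_⟩
  have h1 := inner_sub_w_le_psiConv ht hK x z
  rw [h0, real_inner_comm z x, real_inner_comm (∇ (w φ t) x) x]
  -- A tie at `z` would put `z` into `∂w_t(x)`, which is a single point because `w_t` is
  -- differentiable at `x`.
  refine lt_of_le_of_ne (by linarith) fun h => hz ?_
  refine subgradient_eq_singleton hx ((legendreAttained_w ht hK).mem_subgradient_iff.2 ?_)
  change psiConv φ t z = _
  linarith

end Potentials

/-! ### Trajectories of gradients of semiconcave functions -/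

section Flow

variable {E : Type*} [NormedAddCommGroup E] [InnerProductSpace ℝ E]

/-- Stability of curves moving along supergradients of nearby semiconcave potentials. -/
theorem norm_sub_sq_le_of_supergradient {γ₁ γ₂ p₁ p₂ : ℝ → E} {U₁ U₂ : ℝ → E → ℝ}
    {lam η a b : ℝ} (hab : a ≤ b)
    (hc₁ : ContinuousOn γ₁ (Icc a b)) (hc₂ : ContinuousOn γ₂ (Icc a b))
    (hd₁ : ∀ s ∈ Ioo a b, HasDerivAt γ₁ (p₁ s) s) (hd₂ : ∀ s ∈ Ioo a b, HasDerivAt γ₂ (p₂ s) s)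
    (hU₁ : ∀ s ∈ Ioo a b, ∀ z,
      U₁ s z ≤ U₁ s (γ₁ s) + ⟪p₁ s, z - γ₁ s⟫ + lam / 2 * ‖z - γ₁ s‖ ^ 2)
    (hU₂ : ∀ s ∈ Ioo a b, ∀ z,
      U₂ s z ≤ U₂ s (γ₂ s) + ⟪p₂ s, z - γ₂ s⟫ + lam / 2 * ‖z - γ₂ s‖ ^ 2)
    (hη : ∀ s ∈ Ioo a b, ∀ z, |U₁ s z - U₂ s z| ≤ η) (hlam : 0 ≤ lam) (hη0 : 0 ≤ η) :
    ‖γ₁ b - γ₂ b‖ ^ 2 ≤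
      Real.exp (2 * lam * (b - a)) * (‖γ₁ a - γ₂ a‖ ^ 2 + 4 * η * (b - a)) := by
  -- Grönwall in monotone form: `F` is nonincreasing. Derivatives are needed only in the open
  -- interval, so `a = 0` is allowed although the velocity is not controlled there.
  let F : ℝ → ℝ := fun s =>
    Real.exp (-(2 * lam * (s - a))) * ‖γ₁ s - γ₂ s‖ ^ 2 - 4 * η * (s - a)
  have hFd : ∀ s ∈ Ioo a b, HasDerivAt F
      (Real.exp (-(2 * lam * (s - a))) * (-(2 * lam)) * ‖γ₁ s - γ₂ s‖ ^ 2
        + Real.exp (-(2 * lam * (s - a))) * (2 * ⟪γ₁ s - γ₂ s, p₁ s - p₂ s⟫) - 4 * η) s := by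
    intro s hs
    have h1 : HasDerivAt (fun s => Real.exp (-(2 * lam * (s - a))))
        (Real.exp (-(2 * lam * (s - a))) * (-(2 * lam))) s := by
      have : HasDerivAt (fun s => -(2 * lam * (s - a))) (-(2 * lam)) s := by
        simpa using (((hasDerivAt_id' s).sub_const a).const_mul (2 * lam)).fun_neg
      exact this.exp
    have h2 := ((hd₁ s hs).sub (hd₂ s hs)).norm_sq
    have h3 : HasDerivAt (fun s => 4 * η * (s - a)) (4 * η) s := by
      simpa using ((hasDerivAt_id s).sub_const a).const_mul (4 * η)
    exact (h1.mul h2).sub h3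
  have hFc : ContinuousOn F (Icc a b) := by
    have := (hc₁.sub hc₂).norm
    refine ContinuousOn.sub (ContinuousOn.mul ?_ (this.pow 2)) ?_
    · exact Continuous.continuousOn (by fun_prop)
    · exact Continuous.continuousOn (by fun_prop)
  have hanti : AntitoneOn F (Icc a b) := by
    refine antitoneOn_of_deriv_nonpos (convex_Icc a b) hFc ?_ ?_
    · rw [interior_Icc]
      exact fun s hs => (hFd s hs).differentiableAt.differentiableWithinAt
    · rw [interior_Icc]
      intro s hs
      rw [(hFd s hs).deriv]
      -- Each supergradient inequality is tested at the other curve. In the sum the potentials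
      -- cancel up to `η` at each of the two points.
      have h1 := hU₁ s hs (γ₂ s)
      have h2 := hU₂ s hs (γ₁ s)
      have h3 := abs_le.1 (hη s hs (γ₁ s))
      have h4 := abs_le.1 (hη s hs (γ₂ s))
      rw [norm_sub_rev, ← neg_sub (γ₁ s) (γ₂ s), inner_neg_right] at h1
      have e : ⟪γ₁ s - γ₂ s, p₁ s - p₂ s⟫ = ⟪p₁ s, γ₁ s - γ₂ s⟫ - ⟪p₂ s, γ₁ s - γ₂ s⟫ := by
        rw [real_inner_comm, inner_sub_left]
      have h5 : ⟪γ₁ s - γ₂ s, p₁ s - p₂ s⟫ ≤ 2 * η + lam * ‖γ₁ s - γ₂ s‖ ^ 2 := by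
        rw [e]; linarith
      have hexp : Real.exp (-(2 * lam * (s - a))) ≤ 1 := by
        rw [Real.exp_le_one_iff, neg_nonpos]
        have := sub_nonneg.2 hs.1.le
        positivity
      have hexp0 := Real.exp_pos (-(2 * lam * (s - a)))
      have h6 := mul_le_mul_of_nonneg_left h5 hexp0.le
      have h7 := mul_le_mul_of_nonneg_right hexp hη0
      nlinarith
  have hle := hanti (left_mem_Icc.2 hab) (right_mem_Icc.2 hab) hab
  simp only [F, sub_self, mul_zero, neg_zero, Real.exp_zero, one_mul, sub_zero] at hle
  have h1 : Real.exp (2 * lam * (b - a)) * (Real.exp (-(2 * lam * (b - a))) * ‖γ₁ b - γ₂ b‖ ^ 2)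
      = ‖γ₁ b - γ₂ b‖ ^ 2 := by
    rw [← mul_assoc, ← Real.exp_add, add_neg_cancel, Real.exp_zero, one_mul]
  rw [← h1]
  refine mul_le_mul_of_nonneg_left ?_ (Real.exp_pos _).le
  linarith

/-- A bounded velocity field `v`, Lipschitz on bounded sets for times away from `0`, which consists
of supergradients of the semiconcave functions `U t`. -/
structure SemiconcaveField (K : ℝ≥0) (lam : ℝ) (U : ℝ → E → ℝ) (v : ℝ → E → E) : Prop where
  norm_le : ∀ t, 0 < t → ∀ x, ‖v t x‖ ≤ K
  lipschitz : ∀ a b R : ℝ, 0 < a → ∃ L : ℝ≥0, ∀ t ∈ Icc a b,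
    LipschitzOnWith L (v t) (Metric.closedBall 0 R)
  continuousOn : ∀ x, ContinuousOn (fun t => v t x) (Ioi 0)
  le : ∀ t, 0 < t → ∀ x z, U t z ≤ U t x + ⟪v t x, z - x⟫ + lam / 2 * ‖z - x‖ ^ 2
  lam_nonneg : 0 ≤ lam

/-- `γ` is a trajectory of `v` on `[0, ∞)` which starts at `y`. -/
def IsTrajectory (v : ℝ → E → E) (y : E) (γ : ℝ → E) : Prop :=
  γ 0 = y ∧ ContinuousWithinAt γ (Ici 0) 0 ∧ ∀ t, 0 < t → HasDerivAt γ (v t (γ t)) t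

variable {K : ℝ≥0} {lam : ℝ} {U : ℝ → E → ℝ} {v : ℝ → E → E} {a b t : ℝ} {x y : E} {γ : ℝ → E}

theorem IsTrajectory.continuousOn (h : IsTrajectory v y γ) (b : ℝ) :
    ContinuousOn γ (Icc 0 b) := by
  intro s hs
  rcases hs.1.eq_or_lt with h0 | h0
  · rw [← h0]
    exact h.2.1.mono Icc_subset_Ici_self
  · exact (h.2.2 s h0).continuousAt.continuousWithinAt

theorem IsTrajectory.isIntegralCurveOn (h : IsTrajectory v y γ) (ha : 0 < a) (b : ℝ) :
    IsIntegralCurveOn γ v (Icc a b) := fun s hs =>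
  (h.2.2 s (ha.trans_le hs.1)).hasDerivWithinAt

namespace SemiconcaveField

theorem norm_sub_le_of_isIntegralCurveOn (h : SemiconcaveField K lam U v) (ha : 0 < a)
    (hγ : IsIntegralCurveOn γ v (Icc a b)) {s t : ℝ} (hs : s ∈ Icc a b) (ht : t ∈ Icc a b) :
    ‖γ t - γ s‖ ≤ K * |t - s| :=
  (convex_Icc a b).norm_image_sub_le_of_norm_hasDerivWithin_le hγ
    (fun r hr => h.norm_le r (ha.trans_le hr.1) _) hs ht

theorem norm_sub_le_of_isTrajectory (h : SemiconcaveField K lam U v) (hγ : IsTrajectory v y γ)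
    (ht : 0 ≤ t) : ‖γ t - y‖ ≤ K * t := by
  rcases ht.eq_or_lt with rfl | ht
  · rw [hγ.1]; simp
  have h1 : Tendsto (fun s => ‖γ t - γ s‖) (𝓝[>] 0) (𝓝 ‖γ t - y‖) := by
    have : Tendsto γ (𝓝[>] 0) (𝓝 y) := by
      have := hγ.2.1.tendsto
      rw [hγ.1] at this
      exact this.mono_left (nhdsWithin_mono _ Ioi_subset_Ici_self)
    exact (tendsto_const_nhds.sub this).norm
  refine le_of_tendsto h1 ?_
  filter_upwards [Ioc_mem_nhdsGT ht] with s hs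
  have h2 := h.norm_sub_le_of_isIntegralCurveOn hs.1 (hγ.isIntegralCurveOn hs.1 t)
    (left_mem_Icc.2 hs.2) (right_mem_Icc.2 hs.2)
  rw [abs_of_nonneg (sub_nonneg.2 hs.2)] at h2
  refine h2.trans ?_
  have : (0 : ℝ) ≤ K := K.2
  have := hs.1
  gcongr
  linarith

/-- Trajectories of `v` separate at most exponentially. -/
theorem norm_sub_le_exp_mul (h : SemiconcaveField K lam U v) {γ₁ γ₂ : ℝ → E} (ha : 0 ≤ a)
    (hab : a ≤ b) (hc₁ : ContinuousOn γ₁ (Icc a b)) (hc₂ : ContinuousOn γ₂ (Icc a b))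
    (hd₁ : ∀ s ∈ Ioo a b, HasDerivAt γ₁ (v s (γ₁ s)) s)
    (hd₂ : ∀ s ∈ Ioo a b, HasDerivAt γ₂ (v s (γ₂ s)) s) :
    ‖γ₁ b - γ₂ b‖ ≤ Real.exp (lam * b) * ‖γ₁ a - γ₂ a‖ := by
  have h1 := norm_sub_sq_le_of_supergradient (η := 0) hab hc₁ hc₂ hd₁ hd₂
    (fun s hs => h.le s (ha.trans_lt hs.1) _) (fun s hs => h.le s (ha.trans_lt hs.1) _)
    (fun s _ z => by simp) h.lam_nonneg le_rfl
  have h2 : Real.exp (2 * lam * (b - a)) ≤ Real.exp (lam * b) ^ 2 := by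
    rw [← Real.exp_nat_mul]
    have := mul_nonneg h.lam_nonneg ha
    refine Real.exp_le_exp.2 ?_
    push_cast
    linarith
  refine abs_le_of_sq_le_sq' (a := ‖γ₁ b - γ₂ b‖) ?_ (by positivity) |>.2
  rw [mul_pow]
  refine h1.trans ?_
  simp only [mul_zero, zero_mul, add_zero]
  gcongr

theorem norm_sub_le_of_isIntegralCurveOn₂ (h : SemiconcaveField K lam U v) {γ₁ γ₂ : ℝ → E}
    (ha : 0 ≤ a) (hab : a ≤ b) (h₁ : IsIntegralCurveOn γ₁ v (Icc a b))
    (h₂ : IsIntegralCurveOn γ₂ v (Icc a b)) :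
    ‖γ₁ b - γ₂ b‖ ≤ Real.exp (lam * b) * ‖γ₁ a - γ₂ a‖ :=
  h.norm_sub_le_exp_mul ha hab (fun s hs => (h₁ s hs).continuousWithinAt)
    (fun s hs => (h₂ s hs).continuousWithinAt)
    (fun s hs => (h₁ s (Ioo_subset_Icc_self hs)).hasDerivAt (Icc_mem_nhds hs.1 hs.2))
    (fun s hs => (h₂ s (Ioo_subset_Icc_self hs)).hasDerivAt (Icc_mem_nhds hs.1 hs.2))

theorem norm_sub_le_of_isTrajectory₂ (h : SemiconcaveField K lam U v) {γ₁ γ₂ : ℝ → E} {y₁ y₂ : E}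
    (h₁ : IsTrajectory v y₁ γ₁) (h₂ : IsTrajectory v y₂ γ₂) (ht : 0 ≤ t) :
    ‖γ₁ t - γ₂ t‖ ≤ Real.exp (lam * t) * ‖y₁ - y₂‖ := by
  have := h.norm_sub_le_exp_mul le_rfl ht (h₁.continuousOn t) (h₂.continuousOn t)
    (fun s hs => h₁.2.2 s hs.1) (fun s hs => h₂.2.2 s hs.1)
  rwa [h₁.1, h₂.1] at this

/-- The global speed bound `K` confines curves started in the ball of radius `r` to the ball of
radius `r + K(b - a)`, so a solution exists on the whole interval, from any base time. -/
theorem isPicardLindelof (h : SemiconcaveField K lam U v) (ha : 0 < a) (t₀ : Icc a b) (x : E)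
    (r : ℝ≥0) : ∃ R L : ℝ≥0, IsPicardLindelof v t₀ x R r K L := by
  obtain ⟨L, hL⟩ := h.lipschitz a b (‖x‖ + (r + K * (b - a).toNNReal : ℝ≥0)) ha
  refine ⟨r + K * (b - a).toNNReal, L, fun t ht => (hL t ht).mono ?_, fun z _ => ?_,
    fun t ht z _ => h.norm_le t (ha.trans_le ht.1) z, ?_⟩
  · intro z hz
    rw [mem_closedBall_iff_norm] at hz
    rw [mem_closedBall_zero_iff]
    have : ‖z‖ ≤ ‖x‖ + ‖z - x‖ := by simpa using norm_add_le x (z - x)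
    linarith
  · exact (h.continuousOn z).mono fun s hs => ha.trans_le hs.1
  · push_cast
    rw [add_sub_cancel_left]
    gcongr
    have h1 := t₀.2.1
    have h2 := t₀.2.2
    rw [Real.coe_toNNReal _ (by linarith)]
    exact max_le (by linarith) (by linarith)

variable [CompleteSpace E]

theorem exists_isIntegralCurveOn (h : SemiconcaveField K lam U v) (ha : 0 < a) {t₀ : ℝ}
    (ht₀ : t₀ ∈ Icc a b) (y : E) : ∃ γ : ℝ → E, γ t₀ = y ∧ IsIntegralCurveOn γ v (Icc a b) := by
  obtain ⟨R, L, hPL⟩ := h.isPicardLindelof ha ⟨t₀, ht₀⟩ y 0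
  exact hPL.exists_eq_forall_mem_Icc_hasDerivWithinAt₀

/-- No Lipschitz bound is available near time `0`, so the curves `A n` start from `y` at time `1/(n
+ 1)`. By then `A n` for later `n` has moved by at most `K/(m + 1)` at time `1/(m + 1)`, and
exponential stability makes the sequence Cauchy. -/
theorem exists_isTrajectory (h : SemiconcaveField K lam U v) (y : E) :
    ∃ γ, IsTrajectory v y γ := by
  have hδ : ∀ n : ℕ, 0 < 1 / ((n : ℝ) + 1) := fun n => Nat.one_div_pos_of_nat
  have hδ1 : ∀ n : ℕ, 1 / ((n : ℝ) + 1) ≤ n + 1 := fun n => by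
    have : (0 : ℝ) ≤ n := n.cast_nonneg
    rw [div_le_iff₀ (by positivity)]
    nlinarith
  choose A hA0 hA using fun n : ℕ =>
    h.exists_isIntegralCurveOn (hδ n) (left_mem_Icc.2 (hδ1 n)) y
  have hbound : ∀ n : ℕ, ∀ s ∈ Icc (1 / ((n : ℝ) + 1)) (n + 1), ‖A n s - y‖ ≤ K * s := by
    intro n s hs
    have h1 := h.norm_sub_le_of_isIntegralCurveOn (hδ n) (hA n) (left_mem_Icc.2 (hδ1 n)) hs
    rw [hA0, abs_of_nonneg (sub_nonneg.2 hs.1)] at h1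
    refine h1.trans ?_
    have : (0 : ℝ) ≤ K := K.2
    have := hδ n
    gcongr
    linarith
  have hmem : ∀ s, 0 < s → ∀ᶠ n : ℕ in atTop, s ∈ Icc (1 / ((n : ℝ) + 1)) (n + 1) := by
    intro s hs
    filter_upwards [(tendsto_one_div_add_atTop_nhds_zero_nat (𝕜 := ℝ)).eventually_le_const hs,
      tendsto_natCast_atTop_atTop.eventually_ge_atTop s] with n h1 h2
    exact ⟨h1, by linarith⟩
  have hdiff : ∀ m n : ℕ, m ≤ n → ∀ s ∈ Icc (1 / ((m : ℝ) + 1)) (m + 1),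
      ‖A n s - A m s‖ ≤ Real.exp (lam * s) * (K * (1 / ((m : ℝ) + 1))) := by
    intro m n hmn s hs
    have hsub : Icc (1 / ((m : ℝ) + 1)) s ⊆ Icc (1 / ((n : ℝ) + 1)) (n + 1) := by
      refine Icc_subset_Icc (Nat.one_div_le_one_div hmn) (hs.2.trans ?_)
      gcongr
    have h1 := h.norm_sub_le_of_isIntegralCurveOn₂ (hδ m).le hs.1
      (IsIntegralCurveOn.mono (hA n) hsub)
      (IsIntegralCurveOn.mono (hA m) (Icc_subset_Icc le_rfl hs.2))
    refine h1.trans ?_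
    rw [hA0]
    gcongr
    exact hbound n _ (hsub (left_mem_Icc.2 hs.1))
  have hlim : ∀ s, 0 < s → ∃ z, Tendsto (fun n => A n s) atTop (𝓝 z) := by
    intro s hs
    refine cauchySeq_tendsto_of_complete (Metric.cauchySeq_iff'.2 fun ε hε => ?_)
    have h1 : Tendsto (fun m : ℕ => Real.exp (lam * s) * (K * (1 / ((m : ℝ) + 1)))) atTop
        (𝓝 (Real.exp (lam * s) * (K * 0))) :=
      (tendsto_one_div_add_atTop_nhds_zero_nat.const_mul _).const_mul _
    rw [mul_zero, mul_zero] at h1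
    obtain ⟨N, hN, hN'⟩ := ((h1.eventually_lt_const hε).and (hmem s hs)).exists
    refine ⟨N, fun n hn => ?_⟩
    rw [dist_eq_norm]
    exact (hdiff N n hn s hN').trans_lt hN
  choose! α hα using hlim
  have hder : ∀ t, 0 < t → HasDerivAt α (v t (α t)) t := by
    intro t ht
    -- On an interval away from `0` the limit is identified with the genuine solution `β` through `α
    -- (t / 2)`, by stability; this supplies the derivative.
    obtain ⟨β, hβ0, hβ⟩ := h.exists_isIntegralCurveOn (a := t / 2) (b := 2 * t) (by positivity)
      (left_mem_Icc.2 (by linarith)) (α (t / 2))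
    have heq : ∀ s ∈ Icc (t / 2) (2 * t), α s = β s := by
      intro s hs
      have hs0 : 0 < s := lt_of_lt_of_le (by positivity) hs.1
      have h1 : Tendsto (fun n => A n s - β s) atTop (𝓝 0) := by
        have h2 : Tendsto (fun n => Real.exp (lam * s) * ‖A n (t / 2) - α (t / 2)‖) atTop
            (𝓝 (Real.exp (lam * s) * ‖α (t / 2) - α (t / 2)‖)) :=
          (((hα (t / 2) (by positivity)).sub_const _).norm).const_mul _
        rw [sub_self, norm_zero, mul_zero] at h2
        refine squeeze_zero_norm' ?_ h2
        filter_upwards [hmem (t / 2) (by positivity), hmem s hs0] with n hn hn'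
        rw [← hβ0]
        exact h.norm_sub_le_of_isIntegralCurveOn₂ (by positivity) hs.1
          (IsIntegralCurveOn.mono (hA n) (Icc_subset_Icc hn.1 hn'.2))
          (IsIntegralCurveOn.mono hβ (Icc_subset_Icc le_rfl hs.2))
      have h3 := ((hα s hs0).sub_const (β s))
      exact sub_eq_zero.1 (tendsto_nhds_unique h3 h1)
    have hnhds : Icc (t / 2) (2 * t) ∈ 𝓝 t := Icc_mem_nhds (by linarith) (by linarith)
    have h1 : α =ᶠ[𝓝 t] β := Filter.mem_of_superset hnhds heq
    have h2 := (hβ t (mem_of_mem_nhds hnhds)).hasDerivAt hnhds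
    rw [heq t (mem_of_mem_nhds hnhds)]
    exact h2.congr_of_eventuallyEq h1
  refine ⟨fun t => if 0 < t then α t else y, by simp, ?_, fun t ht => ?_⟩
  · have hle : ∀ s ∈ Ici (0 : ℝ), ‖(if 0 < s then α s else y) - y‖ ≤ K * s := by
      intro s hs
      split_ifs with h0
      · refine le_of_tendsto ((hα s h0).sub_const y).norm ?_
        filter_upwards [hmem s h0] with n hn
        exact hbound n s hn
      · rw [sub_self, norm_zero]
        exact mul_nonneg K.2 hs
    have h1 : Tendsto (fun s : ℝ => (K : ℝ) * s) (𝓝[≥] 0) (𝓝 0) := by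
      have : Tendsto (fun s : ℝ => (K : ℝ) * s) (𝓝 0) (𝓝 (K * 0)) := tendsto_id.const_mul _
      rw [mul_zero] at this
      exact this.mono_left nhdsWithin_le_nhds
    rw [ContinuousWithinAt, tendsto_iff_norm_sub_tendsto_zero]
    simp only [lt_irrefl, if_false]
    refine squeeze_zero' (Eventually.of_forall fun s => norm_nonneg _) ?_ h1
    filter_upwards [self_mem_nhdsWithin] with s hs using hle s hs
  · have h1 : (fun t => if 0 < t then α t else y) =ᶠ[𝓝 t] α := by
      filter_upwards [Ioi_mem_nhds ht] with s hs
      exact if_pos hs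
    simp only [if_pos ht]
    exact (hder t ht).congr_of_eventuallyEq h1

/-- Two initial points whose trajectories are near `x` at time `t` are joined by a connected set of
initial points with the same property. -/
theorem exists_isPreconnected (h : SemiconcaveField K lam U v) {Z : ℝ → E → E}
    (hZ : ∀ y, IsTrajectory v y fun s => Z s y) {δ r : ℝ} (hδ : 0 < δ) (hδt : δ ≤ t)
    {p₁ p₂ : E} (h₁ : ‖Z t p₁ - x‖ ≤ r) (h₂ : ‖Z t p₂ - x‖ ≤ r) :
    ∃ C : Set E, IsPreconnected C ∧ p₁ ∈ C ∧ p₂ ∈ C ∧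
      ∀ q ∈ C, ‖Z t q - x‖ ≤ r + 2 * (Real.exp (lam * t) * (K * δ)) := by
  set κ := Real.exp (lam * t) * (K * δ) with hκ
  have hκ0 : 0 ≤ κ := by positivity
  have hr0 : 0 ≤ r := (norm_nonneg _).trans h₁
  -- Using `q` as position at time `δ` rather than at time `0` costs at most `Kδ`, amplified to `κ`
  -- by time `t`.
  have hnear : ∀ q : E, ∀ γ : ℝ → E, γ δ = q → IsIntegralCurveOn γ v (Icc δ t) →
      ‖Z t q - γ t‖ ≤ κ := by
    intro q γ hγ0 hγ
    have h3 := h.norm_sub_le_of_isIntegralCurveOn₂ hδ.le hδt ((hZ q).isIntegralCurveOn hδ t) hγ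
    refine h3.trans ?_
    rw [hγ0, hκ]
    gcongr
    exact h.norm_sub_le_of_isTrajectory (hZ q) hδ.le
  -- The equation is solved backwards from time `t` to `δ`, with data in the ball of radius `r + κ`.
  -- The connected set will be the image of this ball at time `δ`; the margin `κ` makes it contain
  -- `p₁` and `p₂`.
  obtain ⟨R, L, hPL⟩ := h.isPicardLindelof hδ ⟨t, right_mem_Icc.2 hδt⟩ x (r + κ).toNNReal
  obtain ⟨α, hα, L', hL'⟩ := hPL.exists_forall_mem_closedBall_eq_hasDerivWithinAt_lipschitzOnWith
  rw [Real.coe_toNNReal _ (by positivity)] at hα hL'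
  have hα1 : ∀ z ∈ Metric.closedBall x (r + κ), IsIntegralCurveOn (α z) v (Icc δ t) :=
    fun z hz => (hα z hz).2
  have hend : ∀ p, ‖Z t p - x‖ ≤ r → ∃ z ∈ Metric.closedBall x (r + κ), α z δ = p := by
    intro p hp
    obtain ⟨γ, hγ0, hγ⟩ := h.exists_isIntegralCurveOn hδ (left_mem_Icc.2 hδt) p
    have hz : γ t ∈ Metric.closedBall x (r + κ) := by
      rw [mem_closedBall_iff_norm]
      have h3 := hnear p γ hγ0 hγ
      rw [norm_sub_rev] at h3
      have h4 := norm_sub_le_norm_sub_add_norm_sub (γ t) (Z t p) x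
      linarith
    refine ⟨γ t, hz, ?_⟩
    -- The stability estimate only works forward in time. Uniqueness backwards from `t` uses the
    -- local Lipschitz bound instead.
    obtain ⟨L₂, hL₂⟩ := h.lipschitz δ t (‖γ t‖ + K * (t - δ)) hδ
    have hin : ∀ β : ℝ → E, β t = γ t → IsIntegralCurveOn β v (Icc δ t) → ∀ s ∈ Ioc δ t,
        β s ∈ Metric.closedBall (0 : E) (‖γ t‖ + K * (t - δ)) := by
      intro β hβ0 hβ s hs
      have h3 := h.norm_sub_le_of_isIntegralCurveOn hδ hβ (right_mem_Icc.2 hδt)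
        (Ioc_subset_Icc_self hs)
      rw [hβ0] at h3
      rw [mem_closedBall_zero_iff]
      have h4 : ‖β s‖ ≤ ‖γ t‖ + ‖β s - γ t‖ := by simpa using norm_add_le (γ t) (β s - γ t)
      have h5 : |s - t| ≤ t - δ := by
        rw [abs_sub_comm, abs_of_nonneg (sub_nonneg.2 hs.2)]
        linarith [hs.1]
      have h6 := mul_le_mul_of_nonneg_left h5 K.2
      have h7 : (K : ℝ) * |s - t| ≤ K * (t - δ) := h6
      linarith
    have hcurve : ∀ β : ℝ → E, IsIntegralCurveOn β v (Icc δ t) → ∀ s ∈ Ioc δ t,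
        HasDerivWithinAt β (v s (β s)) (Iic s) s := by
      intro β hβ s hs
      exact (hβ s (Ioc_subset_Icc_self hs)).mono_of_mem_nhdsWithin
        (Filter.mem_of_superset (Ioc_mem_nhdsLE hs.1)
          (fun r hr => ⟨hr.1.le, hr.2.trans hs.2⟩))
    have huniq := ODE_solution_unique_of_mem_Icc_left
      (fun s hs => hL₂ s (Ioc_subset_Icc_self hs))
      (fun s hs => (hα1 _ hz s hs).continuousWithinAt) (hcurve _ (hα1 _ hz))
      (hin _ (hα _ hz).1 (hα1 _ hz))
      (fun s hs => (hγ s hs).continuousWithinAt) (hcurve _ hγ) (hin γ rfl hγ) (hα _ hz).1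
    rw [huniq (left_mem_Icc.2 hδt), hγ0]
  obtain ⟨z₁, hz₁, e₁⟩ := hend p₁ h₁
  obtain ⟨z₂, hz₂, e₂⟩ := hend p₂ h₂
  refine ⟨(fun z => α z δ) '' Metric.closedBall x (r + κ), ?_, ⟨z₁, hz₁, e₁⟩, ⟨z₂, hz₂, e₂⟩, ?_⟩
  · exact (convex_closedBall x (r + κ)).isPreconnected.image _
      (hL' δ (left_mem_Icc.2 hδt)).continuousOn
  · rintro _ ⟨z, hz, rfl⟩
    have h3 := hnear _ (α z) rfl (hα1 z hz)
    rw [(hα z hz).1] at h3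
    rw [mem_closedBall_iff_norm] at hz
    have h4 := norm_sub_le_norm_sub_add_norm_sub (Z t (α z δ)) z x
    linarith

end SemiconcaveField

end Flow

/-! ### Gaussian integrals -/

section Gaussian

theorem integrable_exp_neg_mul_norm_sq {b : ℝ} (hb : 0 < b) :
    Integrable fun v : EuclideanSpace ℝ (Fin d) => Real.exp (-b * ‖v‖ ^ 2) := by
  refine Integrable.of_integral_ne_zero ?_
  rw [GaussianFourier.integral_rexp_neg_mul_sq_norm hb]
  positivity

theorem integrable_exp_mul_norm_sub {b : ℝ} (hb : 0 < b) (c : ℝ) :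
    Integrable fun y : EuclideanSpace ℝ (Fin d) => Real.exp (c * ‖y‖ - ‖y‖ ^ 2 / (4 * b)) := by
  have h := (integrable_exp_neg_mul_norm_sq (d := d) (b := 1 / (8 * b)) (by positivity)).const_mul
    (Real.exp (2 * b * c ^ 2))
  refine h.mono' (Continuous.aestronglyMeasurable (by fun_prop)) (Eventually.of_forall fun y => ?_)
  rw [Real.norm_of_nonneg (Real.exp_pos _).le, ← Real.exp_add]
  refine Real.exp_le_exp.2 ?_
  have h1 : 0 ≤ (‖y‖ - 8 * b * c / 2) ^ 2 / (8 * b) := by positivity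
  have h2 : (‖y‖ - 8 * b * c / 2) ^ 2 / (8 * b)
      = 2 * b * c ^ 2 + -(1 / (8 * b)) * ‖y‖ ^ 2 - (c * ‖y‖ - ‖y‖ ^ 2 / (4 * b)) := by
    field_simp; ring
  linarith

variable {F : Type*} [NormedAddCommGroup F] [NormedSpace ℝ F]
  {g : EuclideanSpace ℝ (Fin d) → F} {C c : ℝ}

/-- A majorant uniform in `‖x‖ ≤ R` and `τ ≤ b`: from `‖y‖² ≤ 2‖x - y‖² + 2R²`, at the price of
doubling the variance. -/
theorem exp_neg_norm_sub_sq_le {x y : EuclideanSpace ℝ (Fin d)} {τ b R : ℝ} (hτ : 0 < τ)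
    (hτb : τ ≤ b) (hx : ‖x‖ ≤ R) :
    Real.exp (-‖x - y‖ ^ 2 / (2 * τ)) ≤
      Real.exp (R ^ 2 / (2 * b)) * Real.exp (-(‖y‖ ^ 2 / (4 * b))) := by
  have hb : 0 < b := hτ.trans_le hτb
  rw [← Real.exp_add]
  refine Real.exp_le_exp.2 ?_
  have h1 : ‖y‖ ≤ ‖x‖ + ‖x - y‖ := by
    simpa using norm_sub_le x (x - y)
  have h2 : ‖y‖ ^ 2 ≤ 2 * ‖x - y‖ ^ 2 + 2 * R ^ 2 := by
    nlinarith [norm_nonneg x, norm_nonneg y, norm_nonneg (x - y), sq_nonneg (‖x‖ - ‖x - y‖)]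
  calc -‖x - y‖ ^ 2 / (2 * τ) ≤ -‖x - y‖ ^ 2 / (2 * b) := by
        rw [neg_div, neg_div, neg_le_neg_iff]
        gcongr
    _ ≤ R ^ 2 / (2 * b) + -(‖y‖ ^ 2 / (4 * b)) := by
        have : R ^ 2 / (2 * b) + -(‖y‖ ^ 2 / (4 * b)) - -‖x - y‖ ^ 2 / (2 * b)
            = (2 * ‖x - y‖ ^ 2 + 2 * R ^ 2 - ‖y‖ ^ 2) / (4 * b) := by
          field_simp; ring
        have h3 : 0 ≤ (2 * ‖x - y‖ ^ 2 + 2 * R ^ 2 - ‖y‖ ^ 2) / (4 * b) :=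
          div_nonneg (by linarith) (by positivity)
        linarith

theorem norm_gaussian_smul_le (hg : ∀ y, ‖g y‖ ≤ C * Real.exp (c * ‖y‖))
    {x y : EuclideanSpace ℝ (Fin d)} {τ b R : ℝ} (hτ : 0 < τ) (hτb : τ ≤ b) (hx : ‖x‖ ≤ R) :
    ‖Real.exp (-‖x - y‖ ^ 2 / (2 * τ)) • g y‖ ≤
      Real.exp (R ^ 2 / (2 * b)) * C * Real.exp (c * ‖y‖ - ‖y‖ ^ 2 / (4 * b)) := by
  rw [norm_smul, Real.norm_of_nonneg (Real.exp_pos _).le]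
  calc _ ≤ (Real.exp (R ^ 2 / (2 * b)) * Real.exp (-(‖y‖ ^ 2 / (4 * b))))
        * (C * Real.exp (c * ‖y‖)) := by
        gcongr
        · exact exp_neg_norm_sub_sq_le hτ hτb hx
        · exact hg y
    _ = _ := by
        rw [sub_eq_add_neg, Real.exp_add]; ring

theorem integrable_gaussian_smul (hgc : Continuous g) (hg : ∀ y, ‖g y‖ ≤ C * Real.exp (c * ‖y‖))
    (x : EuclideanSpace ℝ (Fin d)) {τ : ℝ} (hτ : 0 < τ) :
    Integrable fun y => Real.exp (-‖x - y‖ ^ 2 / (2 * τ)) • g y :=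
  ((integrable_exp_mul_norm_sub hτ c).const_mul _).mono'
    (Continuous.aestronglyMeasurable (by fun_prop))
    (Eventually.of_forall fun _ => norm_gaussian_smul_le hg hτ le_rfl le_rfl)

theorem hasFDerivAt_exp_neg_norm_sub_sq (x y : EuclideanSpace ℝ (Fin d)) (τ : ℝ) :
    HasFDerivAt (fun x => Real.exp (-‖x - y‖ ^ 2 / (2 * τ)))
      ((Real.exp (-‖x - y‖ ^ 2 / (2 * τ)) * -τ⁻¹) • innerSL ℝ (x - y)) x := by
  have h1 : HasFDerivAt (fun x => ‖x - y‖ ^ 2) ((2 : ℝ) • innerSL ℝ (x - y)) x := by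
    have := ((hasFDerivAt_id x).sub_const y).norm_sq
    rw [two_smul, ← two_nsmul]
    simpa using! this
  have h2 : HasFDerivAt (fun x => -‖x - y‖ ^ 2 / (2 * τ)) (-τ⁻¹ • innerSL ℝ (x - y)) x := by
    have h3 := h1.const_mul (-(2 * τ)⁻¹)
    have e1 : (fun x => -‖x - y‖ ^ 2 / (2 * τ)) = fun x => -(2 * τ)⁻¹ * ‖x - y‖ ^ 2 := by
      ext; ring
    have e2 : -τ⁻¹ • innerSL ℝ (x - y) = -(2 * τ)⁻¹ • (2 : ℝ) • innerSL ℝ (x - y) := by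
      rw [smul_smul]
      congr 1
      rw [mul_inv]; ring
    rw [e1, e2]
    exact h3
  have h4 := h2.exp
  rwa [smul_smul] at h4

theorem abs_gaussian_sub_le {x x' y : EuclideanSpace ℝ (Fin d)} {τ a b R : ℝ} (ha : 0 < a)
    (haτ : a ≤ τ) (hτb : τ ≤ b) (hx : ‖x‖ ≤ R) (hx' : ‖x'‖ ≤ R) :
    |Real.exp (-‖x - y‖ ^ 2 / (2 * τ)) - Real.exp (-‖x' - y‖ ^ 2 / (2 * τ))| ≤
      Real.exp (R ^ 2 / (2 * b)) * (R + 1) / a * Real.exp (‖y‖ - ‖y‖ ^ 2 / (4 * b)) *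
        ‖x - x'‖ := by
  have hτ : 0 < τ := ha.trans_le haτ
  have hR : 0 ≤ R := (norm_nonneg x).trans hx
  refine (convex_closedBall (0 : EuclideanSpace ℝ (Fin d)) R).norm_image_sub_le_of_norm_hasFDerivWithin_le
    (f := fun x => Real.exp (-‖x - y‖ ^ 2 / (2 * τ)))
    (fun z _ => (hasFDerivAt_exp_neg_norm_sub_sq z y τ).hasFDerivWithinAt) (fun z hz => ?_)
    (mem_closedBall_zero_iff.2 hx') (mem_closedBall_zero_iff.2 hx)
  rw [mem_closedBall_zero_iff] at hz
  rw [norm_smul, innerSL_apply_norm, norm_mul, Real.norm_of_nonneg (Real.exp_pos _).le, norm_neg,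
    Real.norm_of_nonneg (by positivity)]
  have h1 : ‖z - y‖ ≤ (R + 1) * Real.exp ‖y‖ := by
    have h2 := norm_sub_le z y
    have h3 := Real.add_one_le_exp ‖y‖
    have h4 := norm_nonneg y
    nlinarith
  calc Real.exp (-‖z - y‖ ^ 2 / (2 * τ)) * τ⁻¹ * ‖z - y‖
      ≤ (Real.exp (R ^ 2 / (2 * b)) * Real.exp (-(‖y‖ ^ 2 / (4 * b)))) * a⁻¹
        * ((R + 1) * Real.exp ‖y‖) := by
        gcongr
        exact exp_neg_norm_sub_sq_le hτ hτb hz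
    _ = _ := by
        rw [sub_eq_add_neg, Real.exp_add]; ring

theorem norm_gaussian_smul_sub_le (hg : ∀ y, ‖g y‖ ≤ C * Real.exp (c * ‖y‖))
    {x x' y : EuclideanSpace ℝ (Fin d)} {τ a b R : ℝ} (ha : 0 < a) (haτ : a ≤ τ) (hτb : τ ≤ b)
    (hx : ‖x‖ ≤ R) (hx' : ‖x'‖ ≤ R) :
    ‖Real.exp (-‖x - y‖ ^ 2 / (2 * τ)) • g y - Real.exp (-‖x' - y‖ ^ 2 / (2 * τ)) • g y‖ ≤
      Real.exp (R ^ 2 / (2 * b)) * (R + 1) / a * C *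
        Real.exp ((c + 1) * ‖y‖ - ‖y‖ ^ 2 / (4 * b)) * ‖x - x'‖ := by
  have hR : 0 ≤ R := (norm_nonneg x).trans hx
  rw [← sub_smul, norm_smul, Real.norm_eq_abs]
  calc _ ≤ (Real.exp (R ^ 2 / (2 * b)) * (R + 1) / a * Real.exp (‖y‖ - ‖y‖ ^ 2 / (4 * b)) *
        ‖x - x'‖) * (C * Real.exp (c * ‖y‖)) := by
        gcongr
        · exact abs_gaussian_sub_le ha haτ hτb hx hx'
        · exact hg y
    _ = _ := by
        rw [show (c + 1) * ‖y‖ - ‖y‖ ^ 2 / (4 * b) = (‖y‖ - ‖y‖ ^ 2 / (4 * b)) + c * ‖y‖ by ring,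
          Real.exp_add]
        ring

theorem exists_norm_integral_gaussian_smul_sub_le (hgc : Continuous g)
    (hg : ∀ y, ‖g y‖ ≤ C * Real.exp (c * ‖y‖)) {a : ℝ} (ha : 0 < a) (b R : ℝ) :
    ∃ L : ℝ, 0 ≤ L ∧ ∀ τ ∈ Icc a b, ∀ x x' : EuclideanSpace ℝ (Fin d), ‖x‖ ≤ R → ‖x'‖ ≤ R →
      ‖(∫ y, Real.exp (-‖x - y‖ ^ 2 / (2 * τ)) • g y)
        - ∫ y, Real.exp (-‖x' - y‖ ^ 2 / (2 * τ)) • g y‖ ≤ L * ‖x - x'‖ := by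
  obtain ⟨B, hB⟩ : ∃ B : EuclideanSpace ℝ (Fin d) → ℝ, B = fun y =>
      Real.exp (R ^ 2 / (2 * b)) * (R + 1) / a * C *
        Real.exp ((c + 1) * ‖y‖ - ‖y‖ ^ 2 / (4 * b)) := ⟨_, rfl⟩
  refine ⟨|∫ y, B y|, abs_nonneg _, fun τ hτ x x' hx hx' => ?_⟩
  have hτ0 := ha.trans_le hτ.1
  have hBint : Integrable B := by
    rw [hB]
    exact (integrable_exp_mul_norm_sub (hτ0.trans_le hτ.2) (c + 1)).const_mul _
  rw [← integral_sub (integrable_gaussian_smul hgc hg x hτ0)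
    (integrable_gaussian_smul hgc hg x' hτ0)]
  refine (norm_integral_le_of_norm_le (hBint.mul_const ‖x - x'‖)
    (Eventually.of_forall fun y => ?_)).trans ?_
  · rw [hB]
    exact norm_gaussian_smul_sub_le hg ha hτ.1 hτ.2 hx hx'
  · rw [integral_mul_const]
    gcongr
    exact le_abs_self _

theorem continuousOn_integral_gaussian_smul (hgc : Continuous g)
    (hg : ∀ y, ‖g y‖ ≤ C * Real.exp (c * ‖y‖)) (x : EuclideanSpace ℝ (Fin d)) :
    ContinuousOn (fun τ : ℝ => ∫ y, Real.exp (-‖x - y‖ ^ 2 / (2 * τ)) • g y) (Ioi 0) := by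
  intro τ₀ hτ₀
  have hτ₀' : (0 : ℝ) < τ₀ := hτ₀
  refine ContinuousAt.continuousWithinAt ?_
  refine continuousAt_of_dominated (bound := fun y =>
    Real.exp (‖x‖ ^ 2 / (2 * (2 * τ₀))) * C * Real.exp (c * ‖y‖ - ‖y‖ ^ 2 / (4 * (2 * τ₀)))) ?_ ?_
    ((integrable_exp_mul_norm_sub (by positivity) c).const_mul _) ?_
  · exact Eventually.of_forall fun τ => Continuous.aestronglyMeasurable (by fun_prop)
  · filter_upwards [Ioo_mem_nhds hτ₀' (show τ₀ < 2 * τ₀ by linarith)] with τ hτ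
    exact Eventually.of_forall fun y => norm_gaussian_smul_le hg hτ.1 hτ.2.le le_rfl
  · refine Eventually.of_forall fun y => ?_
    have : ContinuousAt (fun τ : ℝ => -‖x - y‖ ^ 2 / (2 * τ)) τ₀ :=
      continuousAt_const.div (continuousAt_const.mul continuousAt_id) (by simpa using hτ₀'.ne')
    exact (Real.continuous_exp.continuousAt.comp this).smul continuousAt_const

theorem hasFDerivAt_integral_gaussian {g : EuclideanSpace ℝ (Fin d) → ℝ} (hgc : Continuous g)
    (hg : ∀ y, ‖g y‖ ≤ C * Real.exp (c * ‖y‖)) (x : EuclideanSpace ℝ (Fin d)) {τ : ℝ}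
    (hτ : 0 < τ) (hint : Integrable fun y => Real.exp (-‖x - y‖ ^ 2 / (2 * τ)) • g y • y) :
    HasFDerivAt (fun x => ∫ y, Real.exp (-‖x - y‖ ^ 2 / (2 * τ)) • g y)
      (-τ⁻¹ • innerSL ℝ ((∫ y, Real.exp (-‖x - y‖ ^ 2 / (2 * τ)) • g y) • x
        - ∫ y, Real.exp (-‖x - y‖ ^ 2 / (2 * τ)) • g y • y)) x := by
  have hi := integrable_gaussian_smul hgc hg x hτ
  have h := hasFDerivAt_integral_of_dominated_loc_of_lip' (𝕜 := ℝ) (μ := volume)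
    (F := fun x y => Real.exp (-‖x - y‖ ^ 2 / (2 * τ)) • g y)
    (F' := fun y => (g y) • (Real.exp (-‖x - y‖ ^ 2 / (2 * τ)) * -τ⁻¹) • innerSL ℝ (x - y))
    (bound := fun y => Real.exp ((‖x‖ + 1) ^ 2 / (2 * τ)) * ((‖x‖ + 1) + 1) / τ * C *
        Real.exp ((c + 1) * ‖y‖ - ‖y‖ ^ 2 / (4 * τ)))
    (Metric.closedBall_mem_nhds x zero_lt_one)
    (fun z _ => Continuous.aestronglyMeasurable (by fun_prop)) hi
    (Continuous.aestronglyMeasurable (by fun_prop))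
    (Eventually.of_forall fun y z hz => ?_)
    ((integrable_exp_mul_norm_sub hτ (c + 1)).const_mul _)
    (Eventually.of_forall fun y => ?_)
  · have e : ∫ y, (g y) • (Real.exp (-‖x - y‖ ^ 2 / (2 * τ)) * -τ⁻¹) • innerSL ℝ (x - y)
        = -τ⁻¹ • innerSL ℝ ((∫ y, Real.exp (-‖x - y‖ ^ 2 / (2 * τ)) • g y) • x
        - ∫ y, Real.exp (-‖x - y‖ ^ 2 / (2 * τ)) • g y • y) := by
      have hs : Integrable fun y => (Real.exp (-‖x - y‖ ^ 2 / (2 * τ)) • g y) • x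
          - Real.exp (-‖x - y‖ ^ 2 / (2 * τ)) • g y • y := (hi.smul_const x).sub hint
      rw [← integral_smul_const, ← integral_sub (hi.smul_const x) hint]
      ext z
      rw [ContinuousLinearMap.integral_apply h.1, smul_apply,
        innerSL_apply_apply, real_inner_comm,
        ← integral_inner (𝕜 := ℝ) hs, ← integral_smul]
      refine integral_congr_ae (Eventually.of_forall fun y => ?_)
      simp only [smul_apply, innerSL_apply_apply, smul_eq_mul,
        inner_sub_right, inner_smul_right, real_inner_comm z]
      ring
    rw [← e]
    exact h.2
  · rw [mem_closedBall_iff_norm] at hz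
    have h1 : ‖z‖ ≤ ‖x‖ + 1 := by
      have : ‖z‖ ≤ ‖x‖ + ‖z - x‖ := by simpa using norm_add_le x (z - x)
      linarith
    exact norm_gaussian_smul_sub_le hg hτ le_rfl le_rfl h1 (by linarith)
  · exact (hasFDerivAt_exp_neg_norm_sub_sq x y τ).mul_const (g y)

end Gaussian

/-! ### The Cole–Hopf solution -/

section Viscous

variable {φ : EuclideanSpace ℝ (Fin d) → ℝ} {K : ℝ≥0} {lam ε t : ℝ}
  {x y z : EuclideanSpace ℝ (Fin d)}

/-- The integral in the Cole–Hopf formula. -/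
noncomputable def heatIntegral (φ : EuclideanSpace ℝ (Fin d) → ℝ) (ε t : ℝ)
    (x : EuclideanSpace ℝ (Fin d)) : ℝ :=
  ∫ y, Real.exp (-‖x - y‖ ^ 2 / (2 * (ε * t))) • Real.exp (-φ y / ε)

/-- The first moment of the integrand in the Cole–Hopf formula. -/
noncomputable def heatMoment (φ : EuclideanSpace ℝ (Fin d) → ℝ) (ε t : ℝ)
    (x : EuclideanSpace ℝ (Fin d)) : EuclideanSpace ℝ (Fin d) :=
  ∫ y, Real.exp (-‖x - y‖ ^ 2 / (2 * (ε * t))) • Real.exp (-φ y / ε) • y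

theorem viscousPotential_eq (φ : EuclideanSpace ℝ (Fin d) → ℝ) (ε t : ℝ) :
    viscousPotential φ ε t = fun x =>
      -ε * Real.log ((2 * Real.pi * ε * t) ^ (-(d : ℝ) / 2) * heatIntegral φ ε t x) := by
  ext x
  rw [viscousPotential, heatIntegral]
  congr 3
  refine integral_congr_ae (Eventually.of_forall fun y => ?_)
  simp only [smul_eq_mul]
  rw [← Real.exp_add]
  congr 1
  rw [mul_assoc]
  ring

theorem continuous_exp_neg_div (hK : LipschitzWith K φ) (ε : ℝ) :
    Continuous fun y => Real.exp (-φ y / ε) := by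
  have := hK.continuous
  fun_prop

theorem norm_exp_neg_div_le (hK : LipschitzWith K φ) (hε : 0 < ε)
    (y : EuclideanSpace ℝ (Fin d)) :
    ‖Real.exp (-φ y / ε)‖ ≤ Real.exp (-φ 0 / ε) * Real.exp (K / ε * ‖y‖) := by
  rw [Real.norm_of_nonneg (Real.exp_pos _).le, ← Real.exp_add]
  refine Real.exp_le_exp.2 ?_
  have h := apply_le_add_of_lipschitzWith hK 0 y
  rw [zero_sub, norm_neg] at h
  rw [div_mul_eq_mul_div, ← add_div]
  gcongr
  linarith

theorem norm_exp_neg_div_smul_le (hK : LipschitzWith K φ) (hε : 0 < ε)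
    (y : EuclideanSpace ℝ (Fin d)) :
    ‖Real.exp (-φ y / ε) • y‖ ≤ Real.exp (-φ 0 / ε) * Real.exp ((K / ε + 1) * ‖y‖) := by
  rw [norm_smul, add_mul, Real.exp_add, one_mul, ← mul_assoc]
  gcongr
  · exact norm_exp_neg_div_le hK hε y
  · linarith [Real.add_one_le_exp ‖y‖]

theorem integrable_heatIntegral (hK : LipschitzWith K φ) (hε : 0 < ε) (ht : 0 < t)
    (x : EuclideanSpace ℝ (Fin d)) :
    Integrable fun y => Real.exp (-‖x - y‖ ^ 2 / (2 * (ε * t))) • Real.exp (-φ y / ε) :=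
  integrable_gaussian_smul (continuous_exp_neg_div hK ε) (norm_exp_neg_div_le hK hε) x
    (mul_pos hε ht)

theorem heatIntegral_pos (hK : LipschitzWith K φ) (hε : 0 < ε) (ht : 0 < t)
    (x : EuclideanSpace ℝ (Fin d)) : 0 < heatIntegral φ ε t x := by
  refine (integral_pos_iff_support_of_nonneg (fun y => ?_) (integrable_heatIntegral hK hε ht x)).2 ?_
  · change (0 : ℝ) ≤ _ * _
    positivity
  · have : (Function.support fun y => Real.exp (-‖x - y‖ ^ 2 / (2 * (ε * t))) •
        Real.exp (-φ y / ε)) = univ := by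
      ext y
      simp [Real.exp_ne_zero]
    rw [this]
    exact isOpen_univ.measure_pos volume univ_nonempty

/-- The velocity is `(x - m)/t`, where `m` is the mean of `y` under the normalized Cole–Hopf weight.
-/
theorem hasGradientAt_viscousPotential (hK : LipschitzWith K φ) (hε : 0 < ε) (ht : 0 < t)
    (x : EuclideanSpace ℝ (Fin d)) :
    HasGradientAt (viscousPotential φ ε t)
      (t⁻¹ • (x - (heatIntegral φ ε t x)⁻¹ • heatMoment φ ε t x)) x := by
  have hτ := mul_pos hε ht
  have hM := heatIntegral_pos hK hε ht x
  have h1 : HasFDerivAt (heatIntegral φ ε t)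
      (-(ε * t)⁻¹ • innerSL ℝ (heatIntegral φ ε t x • x - heatMoment φ ε t x)) x :=
    hasFDerivAt_integral_gaussian (continuous_exp_neg_div hK ε)
      (norm_exp_neg_div_le hK hε) x hτ
      (integrable_gaussian_smul ((continuous_exp_neg_div hK ε).smul continuous_id)
        (norm_exp_neg_div_smul_le hK hε) x hτ)
  have hc : (2 * Real.pi * ε * t) ^ (-(d : ℝ) / 2) ≠ 0 := by positivity
  have h2 := ((h1.const_mul _).log (mul_ne_zero hc hM.ne')).const_mul (-ε)
  rw [hasGradientAt_iff_hasFDerivAt, viscousPotential_eq]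
  refine h2.congr_fderiv ?_
  ext z
  simp only [smul_apply, innerSL_apply_apply, smul_eq_mul,
    InnerProductSpace.toDual_apply_apply, inner_smul_left, inner_sub_left, conj_trivial]
  field_simp

theorem gradient_viscousPotential (hK : LipschitzWith K φ) (hε : 0 < ε) (ht : 0 < t)
    (x : EuclideanSpace ℝ (Fin d)) :
    ∇ (viscousPotential φ ε t) x
      = t⁻¹ • (x - (heatIntegral φ ε t x)⁻¹ • heatMoment φ ε t x) :=
  (hasGradientAt_viscousPotential hK hε ht x).gradient

/-- After the substitution `y = x - z` the Gaussian no longer depends on `x`, so the Lipschitz bound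
and `λ`-concavity of `φ` pass through the integral. -/
theorem heatIntegral_eq_shift (φ : EuclideanSpace ℝ (Fin d) → ℝ) (ε t : ℝ)
    (x : EuclideanSpace ℝ (Fin d)) :
    heatIntegral φ ε t x
      = ∫ z, Real.exp (-‖z‖ ^ 2 / (2 * (ε * t))) • Real.exp (-φ (x - z) / ε) := by
  rw [heatIntegral, ← integral_sub_left_eq_self _ volume x]
  simp only [sub_sub_cancel]

theorem integrable_heatIntegral_shift (hK : LipschitzWith K φ) (hε : 0 < ε) (ht : 0 < t)
    (x : EuclideanSpace ℝ (Fin d)) :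
    Integrable fun z => Real.exp (-‖z‖ ^ 2 / (2 * (ε * t))) • Real.exp (-φ (x - z) / ε) := by
  have := (integrable_heatIntegral hK hε ht x).comp_sub_left x
  simpa only [sub_sub_cancel] using this

theorem lipschitzWith_viscousPotential (hK : LipschitzWith K φ) (hε : 0 < ε) (ht : 0 < t) :
    LipschitzWith K (viscousPotential φ ε t) := by
  refine LipschitzWith.of_le_add_mul K fun x x' => ?_
  have hM := heatIntegral_pos hK hε ht x
  have hM' := heatIntegral_pos hK hε ht x'
  have hc : 0 < (2 * Real.pi * ε * t) ^ (-(d : ℝ) / 2) := by positivity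
  have h1 : heatIntegral φ ε t x' ≤ Real.exp (K * dist x x' / ε) * heatIntegral φ ε t x := by
    rw [heatIntegral_eq_shift, heatIntegral_eq_shift, ← integral_const_mul]
    refine integral_mono (integrable_heatIntegral_shift hK hε ht x')
      ((integrable_heatIntegral_shift hK hε ht x).const_mul _) fun z => ?_
    simp only [smul_eq_mul]
    rw [mul_left_comm (Real.exp (K * dist x x' / ε)), ← Real.exp_add (K * dist x x' / ε)]
    gcongr
    rw [← add_div]
    gcongr
    have := hK.le_add_mul (x - z) (x' - z)
    rw [dist_sub_right] at this
    linarith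
  have h2 := Real.log_le_log hM' h1
  rw [Real.log_mul (Real.exp_pos _).ne' hM.ne', Real.log_exp] at h2
  rw [viscousPotential_eq]
  simp only
  rw [Real.log_mul hc.ne' hM.ne', Real.log_mul hc.ne' hM'.ne']
  have h3 := mul_le_mul_of_nonneg_left h2 hε.le
  rw [mul_add, mul_div_cancel₀ _ hε.ne'] at h3
  linarith

theorem norm_gradient_viscousPotential_le (hK : LipschitzWith K φ) (hε : 0 < ε) (ht : 0 < t)
    (x : EuclideanSpace ℝ (Fin d)) : ‖∇ (viscousPotential φ ε t) x‖ ≤ K := by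
  rw [gradient, LinearIsometryEquiv.norm_map]
  exact norm_fderiv_le_of_lipschitz ℝ (lipschitzWith_viscousPotential hK hε ht)

theorem integral_rpow_mul_rpow_le {α : Type*} [MeasurableSpace α] {μ : Measure α} {f g : α → ℝ}
    (hf : Integrable f μ) (hg : Integrable g μ) (hf0 : ∀ x, 0 ≤ f x) (hg0 : ∀ x, 0 ≤ g x)
    {a b : ℝ} (ha : 0 ≤ a) (hb : 0 ≤ b) (hab : a + b = 1) :
    ∫ x, f x ^ a * g x ^ b ∂μ ≤ (∫ x, f x ∂μ) ^ a * (∫ x, g x ∂μ) ^ b := by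
  have h := ENNReal.lintegral_mul_norm_pow_le (μ := μ) hf.1.aemeasurable.ennreal_ofReal
    hg.1.aemeasurable.ennreal_ofReal ha hb hab
  rw [← ofReal_integral_eq_lintegral_ofReal hf (Eventually.of_forall hf0),
    ← ofReal_integral_eq_lintegral_ofReal hg (Eventually.of_forall hg0),
    ENNReal.ofReal_rpow_of_nonneg (integral_nonneg hf0) ha,
    ENNReal.ofReal_rpow_of_nonneg (integral_nonneg hg0) hb,
    ← ENNReal.ofReal_mul (Real.rpow_nonneg (integral_nonneg hf0) a)] at h
  have hnn : 0 ≤ (∫ x, f x ∂μ) ^ a * (∫ x, g x ∂μ) ^ b :=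
    mul_nonneg (Real.rpow_nonneg (integral_nonneg hf0) a) (Real.rpow_nonneg (integral_nonneg hg0) b)
  rw [integral_eq_lintegral_of_nonneg_ae
    (Eventually.of_forall fun x => mul_nonneg (Real.rpow_nonneg (hf0 x) a)
      (Real.rpow_nonneg (hg0 x) b))
    ((hf.1.aemeasurable.pow_const a).mul (hg.1.aemeasurable.pow_const b)).aestronglyMeasurable]
  refine ENNReal.toReal_le_of_le_ofReal hnn (le_trans (le_of_eq ?_) h)
  refine lintegral_congr fun x => ?_
  rw [ENNReal.ofReal_mul (Real.rpow_nonneg (hf0 x) a), ENNReal.ofReal_rpow_of_nonneg (hf0 x) ha,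
    ENNReal.ofReal_rpow_of_nonneg (hg0 x) hb]

/-- Insert the `λ`-concavity of `φ` for each fixed shift `z`; Hölder's inequality with exponents
`1/a` and `1/b` then separates the two end points. -/
theorem isLambdaConcave_viscousPotential (hK : LipschitzWith K φ)
    (hconc : IsLambdaConcave lam φ) (hε : 0 < ε) (ht : 0 < t) :
    IsLambdaConcave lam (viscousPotential φ ε t) := by
  rw [isLambdaConcave_iff] at hconc ⊢
  intro x₀ x₁ a b ha hb hab
  have hM := heatIntegral_pos hK hε ht (a • x₀ + b • x₁)
  have hM₀ := heatIntegral_pos hK hε ht x₀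
  have hM₁ := heatIntegral_pos hK hε ht x₁
  have hc : 0 < (2 * Real.pi * ε * t) ^ (-(d : ℝ) / 2) := by positivity
  obtain ⟨q, hq⟩ : ∃ q, q = lam / 2 * (a * b) * ‖x₀ - x₁‖ ^ 2 := ⟨_, rfl⟩
  have hi₀ := integrable_heatIntegral_shift hK hε ht x₀
  have hi₁ := integrable_heatIntegral_shift hK hε ht x₁
  have h1 : heatIntegral φ ε t (a • x₀ + b • x₁)
      ≤ Real.exp (q / ε) * (heatIntegral φ ε t x₀ ^ a * heatIntegral φ ε t x₁ ^ b) := by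
    have hold := integral_rpow_mul_rpow_le hi₀ hi₁ (fun z => by simp only [smul_eq_mul]; positivity)
      (fun z => by simp only [smul_eq_mul]; positivity) ha hb hab
    rw [← heatIntegral_eq_shift, ← heatIntegral_eq_shift] at hold
    refine le_trans ?_ (mul_le_mul_of_nonneg_left hold (Real.exp_pos _).le)
    have hpt : ∀ z, Real.exp (q / ε) *
        ((Real.exp (-‖z‖ ^ 2 / (2 * (ε * t))) • Real.exp (-φ (x₀ - z) / ε)) ^ a *
          (Real.exp (-‖z‖ ^ 2 / (2 * (ε * t))) • Real.exp (-φ (x₁ - z) / ε)) ^ b)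
        = Real.exp (-‖z‖ ^ 2 / (2 * (ε * t))) *
          Real.exp ((q - a * φ (x₀ - z) - b * φ (x₁ - z)) / ε) := by
      intro z
      simp only [smul_eq_mul]
      rw [← Real.exp_add, ← Real.exp_add, ← Real.exp_mul, ← Real.exp_mul, ← Real.exp_add,
        ← Real.exp_add, ← Real.exp_add]
      congr 1
      have hb' : b = 1 - a := by linarith
      subst hb'
      ring
    have hint : Integrable fun z => Real.exp (q / ε) *
        ((Real.exp (-‖z‖ ^ 2 / (2 * (ε * t))) • Real.exp (-φ (x₀ - z) / ε)) ^ a *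
          (Real.exp (-‖z‖ ^ 2 / (2 * (ε * t))) • Real.exp (-φ (x₁ - z) / ε)) ^ b) := by
      refine (((hi₀.const_mul a).add (hi₁.const_mul b)).mono' ?_
        (Eventually.of_forall fun z => ?_)).const_mul _
      · exact ((hi₀.1.aemeasurable.pow_const a).mul
          (hi₁.1.aemeasurable.pow_const b)).aestronglyMeasurable
      · have h0 : 0 ≤ Real.exp (-‖z‖ ^ 2 / (2 * (ε * t))) • Real.exp (-φ (x₀ - z) / ε) := by
          simp only [smul_eq_mul]; positivity
        have h1 : 0 ≤ Real.exp (-‖z‖ ^ 2 / (2 * (ε * t))) • Real.exp (-φ (x₁ - z) / ε) := by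
          simp only [smul_eq_mul]; positivity
        rw [Real.norm_of_nonneg (mul_nonneg (Real.rpow_nonneg h0 a) (Real.rpow_nonneg h1 b))]
        exact Real.geom_mean_le_arith_mean2_weighted ha hb h0 h1 hab
    rw [heatIntegral_eq_shift, ← integral_const_mul]
    refine integral_mono (integrable_heatIntegral_shift hK hε ht _) hint fun z => ?_
    simp only
    rw [hpt, smul_eq_mul]
    gcongr
    have h2 := hconc (x₀ - z) (x₁ - z) a b ha hb hab
    have e1 : a • (x₀ - z) + b • (x₁ - z) = a • x₀ + b • x₁ - z := by
      have : a • (x₀ - z) + b • (x₁ - z) = a • x₀ + b • x₁ - (a + b) • z := by module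
      rw [this, hab, one_smul]
    rw [e1, sub_sub_sub_cancel_right, ← hq] at h2
    linarith
  have h2 := Real.log_le_log hM h1
  rw [Real.log_mul (Real.exp_pos _).ne' (by positivity), Real.log_exp,
    Real.log_mul (by positivity) (by positivity), Real.log_rpow hM₀, Real.log_rpow hM₁] at h2
  rw [viscousPotential_eq]
  simp only
  rw [Real.log_mul hc.ne' hM.ne', Real.log_mul hc.ne' hM₀.ne', Real.log_mul hc.ne' hM₁.ne', ← hq]
  have h3 := mul_le_mul_of_nonneg_left h2 hε.le
  rw [mul_add, mul_div_cancel₀ _ hε.ne'] at h3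
  have hb' : b = 1 - a := by linarith
  subst hb'
  linarith

theorem viscousPotential_le (hK : LipschitzWith K φ) (hconc : IsLambdaConcave lam φ)
    (hε : 0 < ε) (ht : 0 < t) (x z : EuclideanSpace ℝ (Fin d)) :
    viscousPotential φ ε t z ≤ viscousPotential φ ε t x
      + ⟪∇ (viscousPotential φ ε t) x, z - x⟫ + lam / 2 * ‖z - x‖ ^ 2 := by
  have hd := (hasGradientAt_viscousPotential hK hε ht x).differentiableAt.hasGradientAt
  have h1 := hasGradientAt_iff_isLittleO_nhds_zero.1 hd
  refine (isLambdaConcave_viscousPotential hK hconc hε ht).le_of_isLittleO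
    (e := fun h => viscousPotential φ ε t (x + h) - viscousPotential φ ε t x
      - ⟪∇ (viscousPotential φ ε t) x, h⟫) (h1.norm_right) (fun h => by linarith) z

end Viscous

/-! ### Regularity of the viscous velocity field -/

section ViscousField

variable {φ : EuclideanSpace ℝ (Fin d) → ℝ} {K : ℝ≥0} {lam ε t : ℝ}
  {x y z : EuclideanSpace ℝ (Fin d)}

/-- A positive lower bound uniform in `t ≥ a` and `‖x‖ ≤ R`, needed to divide by the integral. The
time `a / 2` absorbs the factor in `‖x - y‖² ≤ 2R² + 2‖y‖²`. -/
theorem heatIntegral_ge (hK : LipschitzWith K φ) (hε : 0 < ε) {a R : ℝ} (ha : 0 < a)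
    (hat : a ≤ t) (hx : ‖x‖ ≤ R) :
    Real.exp (-(R ^ 2 / (ε * a))) * heatIntegral φ ε (a / 2) 0 ≤ heatIntegral φ ε t x := by
  have ht := ha.trans_le hat
  rw [heatIntegral, ← integral_const_mul]
  refine integral_mono ((integrable_heatIntegral hK hε (by positivity) 0).const_mul _)
    (integrable_heatIntegral hK hε ht x) fun y => ?_
  simp only [smul_eq_mul, zero_sub, norm_neg]
  rw [← mul_assoc, ← Real.exp_add]
  gcongr
  have h1 := norm_sub_le x y
  have h2 : ‖x - y‖ ^ 2 ≤ 2 * R ^ 2 + 2 * ‖y‖ ^ 2 := by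
    nlinarith [norm_nonneg x, norm_nonneg y, norm_nonneg (x - y), sq_nonneg (‖x‖ - ‖y‖)]
  calc -(R ^ 2 / (ε * a)) + -‖y‖ ^ 2 / (2 * (ε * (a / 2)))
      = -((2 * R ^ 2 + 2 * ‖y‖ ^ 2) / (2 * (ε * a))) := by field_simp; ring
    _ ≤ -(‖x - y‖ ^ 2 / (2 * (ε * t))) := by
        rw [neg_le_neg_iff]
        gcongr
    _ = _ := by rw [neg_div]

theorem exists_lipschitzOnWith_gradient_viscousPotential (hK : LipschitzWith K φ) (hε : 0 < ε)
    {a : ℝ} (b R : ℝ) (ha : 0 < a) : ∃ L : ℝ≥0, ∀ t ∈ Icc a b,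
      LipschitzOnWith L (∇ (viscousPotential φ ε t)) (Metric.closedBall 0 R) := by
  obtain ⟨L₁, hL₁, h₁⟩ := exists_norm_integral_gaussian_smul_sub_le (continuous_exp_neg_div hK ε)
    (norm_exp_neg_div_le hK hε) (mul_pos hε ha) (ε * b) R
  obtain ⟨L₂, hL₂, h₂⟩ := exists_norm_integral_gaussian_smul_sub_le
    ((continuous_exp_neg_div hK ε).smul continuous_id)
    (norm_exp_neg_div_smul_le hK hε) (mul_pos hε ha) (ε * b) R
  obtain ⟨m, hm⟩ : ∃ m, m = Real.exp (-(R ^ 2 / (ε * a))) * heatIntegral φ ε (a / 2) 0 := ⟨_, rfl⟩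
  have hm0 : 0 < m := by
    have := heatIntegral_pos hK hε (half_pos ha) 0
    rw [hm]
    positivity
  refine ⟨(a⁻¹ * (1 + m⁻¹ * (L₂ + L₁ * (R + b * K)))).toNNReal, fun t ht => ?_⟩
  have ht0 := ha.trans_le ht.1
  have hτ : ε * t ∈ Icc (ε * a) (ε * b) :=
    ⟨mul_le_mul_of_nonneg_left ht.1 hε.le, mul_le_mul_of_nonneg_left ht.2 hε.le⟩
  refine LipschitzOnWith.of_dist_le_mul fun x hx x' hx' => ?_
  rw [mem_closedBall_zero_iff] at hx hx'
  have hR : 0 ≤ R := (norm_nonneg x).trans hx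
  have hb : 0 ≤ b := ht0.le.trans ht.2
  rw [Real.coe_toNNReal _ (by positivity), dist_eq_norm, dist_eq_norm]
  have hM := heatIntegral_pos hK hε ht0 x
  have hM' := heatIntegral_pos hK hε ht0 x'
  have hMm : m ≤ heatIntegral φ ε t x := by
    rw [hm]; exact heatIntegral_ge hK hε ha ht.1 hx
  have e₁ : |heatIntegral φ ε t x - heatIntegral φ ε t x'| ≤ L₁ * ‖x - x'‖ :=
    h₁ (ε * t) hτ x x' hx hx'
  have e₂ : ‖heatMoment φ ε t x - heatMoment φ ε t x'‖ ≤ L₂ * ‖x - x'‖ :=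
    h₂ (ε * t) hτ x x' hx hx'
  have hv := norm_gradient_viscousPotential_le hK hε ht0 x'
  have hg' := gradient_viscousPotential hK hε ht0 x'
  -- The mean is `x' - t ∇u(x')`, so the gradient bound `K` controls it without further integrals.
  have hmean : ‖(heatIntegral φ ε t x')⁻¹ • heatMoment φ ε t x'‖ ≤ R + b * K := by
    have e : (heatIntegral φ ε t x')⁻¹ • heatMoment φ ε t x'
        = x' - t • ∇ (viscousPotential φ ε t) x' := by
      rw [hg', smul_smul, mul_inv_cancel₀ ht0.ne', one_smul, sub_sub_cancel]
    rw [e]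
    refine (norm_sub_le _ _).trans ?_
    rw [norm_smul, Real.norm_of_nonneg ht0.le]
    gcongr
    exact ht.2
  rw [gradient_viscousPotential hK hε ht0 x, hg']
  set M := heatIntegral φ ε t x
  set M' := heatIntegral φ ε t x'
  set N := heatMoment φ ε t x
  set N' := heatMoment φ ε t x'
  have e : t⁻¹ • (x - M⁻¹ • N) - t⁻¹ • (x' - M'⁻¹ • N')
      = t⁻¹ • ((x - x') - (M⁻¹ • (N - N') - (M⁻¹ * (M - M')) • (M'⁻¹ • N'))) := by
    have h3 : (M⁻¹ * (M - M')) • (M'⁻¹ • N') = M'⁻¹ • N' - M⁻¹ • N' := by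
      rw [smul_smul, ← sub_smul]
      congr 1
      field_simp
    rw [h3, ← smul_sub, smul_sub M⁻¹]
    congr 1
    abel
  have hti : t⁻¹ ≤ a⁻¹ := inv_anti₀ ha ht.1
  have hMi : M⁻¹ ≤ m⁻¹ := inv_anti₀ hm0 hMm
  rw [e, norm_smul, Real.norm_of_nonneg (by positivity)]
  calc t⁻¹ * ‖(x - x') - (M⁻¹ • (N - N') - (M⁻¹ * (M - M')) • (M'⁻¹ • N'))‖
      ≤ t⁻¹ * (‖x - x'‖ + (‖M⁻¹ • (N - N')‖ + ‖(M⁻¹ * (M - M')) • (M'⁻¹ • N')‖)) := by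
        gcongr
        exact (norm_sub_le _ _).trans (by gcongr; exact norm_sub_le _ _)
    _ ≤ a⁻¹ * (‖x - x'‖ + (m⁻¹ * (L₂ * ‖x - x'‖) + m⁻¹ * (L₁ * ‖x - x'‖) * (R + b * K))) := by
        rw [norm_smul, norm_smul (M⁻¹ * (M - M')), norm_mul, Real.norm_of_nonneg (inv_nonneg.2 hM.le),
          Real.norm_eq_abs]
        gcongr
    _ = _ := by ring

theorem continuousOn_gradient_viscousPotential (hK : LipschitzWith K φ) (hε : 0 < ε)
    (x : EuclideanSpace ℝ (Fin d)) :
    ContinuousOn (fun t => ∇ (viscousPotential φ ε t) x) (Ioi 0) := by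
  have hmaps : MapsTo (fun t : ℝ => ε * t) (Ioi 0) (Ioi 0) := fun t ht => mul_pos hε ht
  have h1 : ContinuousOn (fun t => heatIntegral φ ε t x) (Ioi 0) :=
    (continuousOn_integral_gaussian_smul (continuous_exp_neg_div hK ε)
      (norm_exp_neg_div_le hK hε) x).comp (by fun_prop) hmaps
  have h2 : ContinuousOn (fun t => heatMoment φ ε t x) (Ioi 0) :=
    (continuousOn_integral_gaussian_smul ((continuous_exp_neg_div hK ε).smul continuous_id)
      (norm_exp_neg_div_smul_le hK hε) x).comp (by fun_prop) hmaps
  refine ContinuousOn.congr (f := fun t => t⁻¹ • (x - (heatIntegral φ ε t x)⁻¹ •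
    heatMoment φ ε t x)) ?_ fun t ht => gradient_viscousPotential hK hε ht x
  refine ContinuousOn.smul (continuousOn_inv₀.mono fun t ht => (ne_of_gt ht)) ?_
  exact continuousOn_const.sub ((h1.inv₀ fun t ht => (heatIntegral_pos hK hε ht x).ne').smul h2)

theorem semiconcaveField_viscousPotential (hK : LipschitzWith K φ) (hlam : 0 ≤ lam)
    (hconc : IsLambdaConcave lam φ) (hε : 0 < ε) :
    SemiconcaveField K lam (viscousPotential φ ε) fun t => ∇ (viscousPotential φ ε t) where
  norm_le _ ht x := norm_gradient_viscousPotential_le hK hε ht x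
  lipschitz _ b R ha := exists_lipschitzOnWith_gradient_viscousPotential hK hε b R ha
  continuousOn x := continuousOn_gradient_viscousPotential hK hε x
  le _ ht x z := viscousPotential_le hK hconc hε ht x z
  lam_nonneg := hlam

/-! ### The zero viscosity limit of the potential -/

theorem integral_exp_neg_mul_norm_sub_sq {b : ℝ} (hb : 0 < b) (y : EuclideanSpace ℝ (Fin d)) :
    ∫ z, Real.exp (-b * ‖z - y‖ ^ 2) = (Real.pi / b) ^ ((d : ℝ) / 2) := by
  rw [integral_sub_right_eq_self (fun z : EuclideanSpace ℝ (Fin d) => Real.exp (-b * ‖z‖ ^ 2)) y,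
    GaussianFourier.integral_rexp_neg_mul_sq_norm hb, finrank_euclideanSpace_fin]

theorem log_heatKernel_mul (hK : LipschitzWith K φ) (hε : 0 < ε) (ht : 0 < t)
    (x : EuclideanSpace ℝ (Fin d)) :
    viscousPotential φ ε t x = ε * (d / 2 * Real.log (2 * Real.pi * ε * t))
      - ε * Real.log (heatIntegral φ ε t x) := by
  have hM := heatIntegral_pos hK hε ht x
  rw [viscousPotential_eq]
  simp only
  rw [Real.log_mul (by positivity) hM.ne', Real.log_rpow (by positivity)]
  ring

theorem heatIntegral_integrand_eq (hε : 0 < ε) (ht : 0 < t) (x y : EuclideanSpace ℝ (Fin d)) :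
    Real.exp (-‖x - y‖ ^ 2 / (2 * (ε * t))) • Real.exp (-φ y / ε)
      = Real.exp (-((‖x - y‖ ^ 2 / (2 * t) + φ y) / ε)) := by
  rw [smul_eq_mul, ← Real.exp_add]
  congr 1
  field_simp
  ring

/-- Laplace's method: semiconcavity bounds the exponent by a paraboloid of coefficient `(1 + tλ)/t`
around a minimizer `y`, and the ratio of the two Gaussian normalizations is a power of `2(1 + tλ)`.
-/
theorem viscousPotential_le_hopfLax_add (hK : LipschitzWith K φ) (hlam : 0 ≤ lam)
    (hconc : IsLambdaConcave lam φ) (hε : 0 < ε) (ht : 0 < t) (x : EuclideanSpace ℝ (Fin d)) :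
    viscousPotential φ ε t x ≤
      hopfLax φ t x + ε * (d / 2 * Real.log (2 * (1 + t * lam))) := by
  have hc := one_add_mul_pos ht.le hlam
  obtain ⟨y, hy⟩ := exists_hopfLax_eq ht hK x
  have hw := (hopfLax_eq_iff ht).1 hy
  have h1 : ∀ z, psi φ t y + ⟪x, z - y⟫ ≤ psi φ t z := fun z => by
    have := inner_sub_psi_le_w ht.le hK x z
    rw [inner_sub_right]
    linarith
  have h2 := (isLambdaConcave_psi ht.le hconc).le_add_sq_of_le h1
  have h3 : ∀ z, ‖x - z‖ ^ 2 / (2 * t) + φ z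
      ≤ hopfLax φ t x + (1 + t * lam) / t * ‖z - y‖ ^ 2 := by
    intro z
    have h4 := h2 z
    rw [hy]
    have e : ∀ z, ‖x - z‖ ^ 2 / (2 * t) + φ z = (1 / 2 * ‖x‖ ^ 2 - (⟪x, z⟫ - psi φ t z)) / t := by
      intro z
      rw [half_norm_sq_sub]
      field_simp
    rw [e z, e y, div_mul_eq_mul_div (1 + t * lam), ← add_div]
    gcongr
    rw [inner_sub_right] at h4
    linarith
  have hb : 0 < (1 + t * lam) / (t * ε) := by positivity
  have h5 : Real.exp (-(hopfLax φ t x / ε)) * (Real.pi / ((1 + t * lam) / (t * ε))) ^ ((d : ℝ) / 2)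
      ≤ heatIntegral φ ε t x := by
    rw [← integral_exp_neg_mul_norm_sub_sq hb y, ← integral_const_mul]
    refine integral_mono (((integrable_exp_neg_mul_norm_sq hb).comp_sub_right y).const_mul _)
      (integrable_heatIntegral hK hε ht x) fun z => ?_
    simp only
    rw [heatIntegral_integrand_eq hε ht, ← Real.exp_add]
    refine Real.exp_le_exp.2 ?_
    have h6 := div_le_div_of_nonneg_right (h3 z) hε.le
    have e : (hopfLax φ t x + (1 + t * lam) / t * ‖z - y‖ ^ 2) / ε
        = hopfLax φ t x / ε + (1 + t * lam) / (t * ε) * ‖z - y‖ ^ 2 := by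
      field_simp
    rw [e] at h6
    linarith
  have h6 := Real.log_le_log (by positivity) h5
  rw [Real.log_mul (by positivity) (by positivity), Real.log_exp,
    Real.log_rpow (by positivity)] at h6
  rw [log_heatKernel_mul hK hε ht]
  have h7 := mul_le_mul_of_nonneg_left h6 hε.le
  have e1 : Real.log (2 * Real.pi * ε * t) - Real.log (Real.pi / ((1 + t * lam) / (t * ε)))
      = Real.log (2 * (1 + t * lam)) := by
    rw [← Real.log_div (by positivity) (by positivity)]
    congr 1
    field_simp
  have e2 : ε * (hopfLax φ t x / ε) = hopfLax φ t x := by field_simp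
  rw [← e1]
  linarith

theorem hopfLax_sub_le_viscousPotential (hK : LipschitzWith K φ) (hε : 0 < ε) (hε' : ε ≤ 1 / 2)
    (ht : 0 < t) (x : EuclideanSpace ℝ (Fin d)) :
    hopfLax φ t x - ε * (K ^ 2 * t - d / 2 * Real.log ε) ≤ viscousPotential φ ε t x := by
  -- A fraction `ε` of the quadratic is kept back for integrability, by testing the infimum at `z +
  -- ε(x - z)`. After division by `ε` the remaining Gaussian has variance `t`, independent of `ε`;
  -- this causes the error of order `ε log ε`.
  have h3 : ∀ z, hopfLax φ t x - ε * (K ^ 2 * t) + ε * (‖x - z‖ ^ 2 / (2 * t))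
      ≤ ‖x - z‖ ^ 2 / (2 * t) + φ z := by
    intro z
    have h4 := hopfLax_le ht hK x (z + ε • (x - z))
    have h5 := apply_le_add_of_lipschitzWith hK (z + ε • (x - z)) z
    rw [show x - (z + ε • (x - z)) = (1 - ε) • (x - z) by module, norm_smul,
      Real.norm_of_nonneg (by linarith)] at h4
    rw [add_sub_cancel_left, norm_smul, Real.norm_of_nonneg hε.le] at h5
    set D := ‖x - z‖
    have h6 : K * D ≤ D ^ 2 / (4 * t) + K ^ 2 * t := by
      have h7 : 0 ≤ (D - 2 * K * t) ^ 2 / (4 * t) := by positivity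
      have h8 : (D - 2 * K * t) ^ 2 / (4 * t) = D ^ 2 / (4 * t) + K ^ 2 * t - K * D := by
        field_simp; ring
      linarith
    have h7 := mul_le_mul_of_nonneg_left h6 hε.le
    have h8 : ((1 - ε) * D) ^ 2 / (2 * t) + ε * (D ^ 2 / (4 * t))
        ≤ (1 - ε) * (D ^ 2 / (2 * t)) := by
      have e : (1 - ε) * (D ^ 2 / (2 * t)) - (((1 - ε) * D) ^ 2 / (2 * t) + ε * (D ^ 2 / (4 * t)))
          = ε * (1 - 2 * ε) * D ^ 2 / (4 * t) := by
        field_simp; ring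
      have h9 : 0 ≤ ε * (1 - 2 * ε) * D ^ 2 / (4 * t) := by
        have : 0 ≤ 1 - 2 * ε := by linarith
        positivity
      linarith
    linarith
  have hb : 0 < 1 / (2 * t) := by positivity
  have h5 : heatIntegral φ ε t x ≤ Real.exp (-((hopfLax φ t x - ε * (K ^ 2 * t)) / ε)) *
      (Real.pi / (1 / (2 * t))) ^ ((d : ℝ) / 2) := by
    rw [← integral_exp_neg_mul_norm_sub_sq hb x, ← integral_const_mul]
    refine integral_mono (integrable_heatIntegral hK hε ht x)
      (((integrable_exp_neg_mul_norm_sq hb).comp_sub_right x).const_mul _) fun z => ?_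
    simp only
    rw [heatIntegral_integrand_eq hε ht, ← Real.exp_add, norm_sub_rev z x]
    refine Real.exp_le_exp.2 ?_
    have h6 := div_le_div_of_nonneg_right (h3 z) hε.le
    have e : (hopfLax φ t x - ε * (K ^ 2 * t) + ε * (‖x - z‖ ^ 2 / (2 * t))) / ε
        = (hopfLax φ t x - ε * (K ^ 2 * t)) / ε + 1 / (2 * t) * ‖x - z‖ ^ 2 := by
      field_simp
    rw [e] at h6
    linarith
  have h6 := Real.log_le_log (heatIntegral_pos hK hε ht x) h5
  rw [Real.log_mul (by positivity) (by positivity), Real.log_exp,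
    Real.log_rpow (by positivity)] at h6
  rw [log_heatKernel_mul hK hε ht]
  have h7 := mul_le_mul_of_nonneg_left h6 hε.le
  have e1 : Real.log (2 * Real.pi * ε * t) - Real.log (Real.pi / (1 / (2 * t))) = Real.log ε := by
    rw [← Real.log_div (by positivity) (by positivity)]
    congr 1
    field_simp
  have e2 : ε * ((hopfLax φ t x - ε * (K ^ 2 * t)) / ε) = hopfLax φ t x - ε * (K ^ 2 * t) := by
    field_simp
  rw [← e1]
  linarith

/-- The Cole–Hopf solutions converge to the Hopf–Lax solution, uniformly on `(0, τ] × ℝ^d`. -/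
theorem exists_abs_viscousPotential_sub_hopfLax_le (hK : LipschitzWith K φ) (hlam : 0 ≤ lam)
    (hconc : IsLambdaConcave lam φ) (τ : ℝ) :
    ∃ η : ℝ → ℝ, Tendsto η (𝓝[>] 0) (𝓝 0) ∧ ∀ ε, 0 < ε → ε ≤ 1 / 2 → ∀ t, 0 < t → t ≤ τ →
      ∀ x, |viscousPotential φ ε t x - hopfLax φ t x| ≤ η ε := by
  refine ⟨fun ε => ε * (K ^ 2 * τ + d / 2 * Real.log (2 * (1 + τ * lam)))
    - d / 2 * (Real.log ε * ε), ?_, fun ε hε hε' t ht htτ x => ?_⟩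
  · have h1 : Tendsto (fun ε : ℝ => ε * (K ^ 2 * τ + d / 2 * Real.log (2 * (1 + τ * lam))))
        (𝓝[>] 0) (𝓝 (0 * (K ^ 2 * τ + d / 2 * Real.log (2 * (1 + τ * lam))))) :=
      (tendsto_id.mul_const _).mono_left nhdsWithin_le_nhds
    have h2 := (tendsto_log_mul_rpow_nhdsGT_zero (zero_lt_one' ℝ)).const_mul ((d : ℝ) / 2)
    simp only [Real.rpow_one] at h2
    simpa using h1.sub h2
  · have h1 := viscousPotential_le_hopfLax_add hK hlam hconc hε ht x
    have h2 := hopfLax_sub_le_viscousPotential hK hε hε' ht x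
    have h3 : Real.log (2 * (1 + t * lam)) ≤ Real.log (2 * (1 + τ * lam)) := by
      refine Real.log_le_log (by have := one_add_mul_pos ht.le hlam; positivity) ?_
      gcongr
    have h3' : 0 ≤ Real.log (2 * (1 + t * lam)) := by
      refine Real.log_nonneg ?_
      have := mul_nonneg ht.le hlam
      linarith
    have h4 : (K : ℝ) ^ 2 * t ≤ K ^ 2 * τ := by gcongr
    have h4' : 0 ≤ (K : ℝ) ^ 2 * t := by positivity
    have h5 : Real.log ε ≤ 0 := Real.log_nonpos hε.le (by linarith)
    have hd : (0 : ℝ) ≤ d / 2 := by positivity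
    have h6 := mul_le_mul_of_nonneg_left h3 hd
    have h7 := mul_nonneg hd h3'
    have h8 := mul_nonneg hε.le (mul_nonneg hd (neg_nonneg.2 h5))
    have h9 := mul_le_mul_of_nonneg_left h4 hε.le
    have h10 := mul_le_mul_of_nonneg_left h6 hε.le
    have h11 := mul_nonneg hε.le h7
    have h12 := mul_nonneg hε.le h4'
    rw [abs_le]
    constructor <;> linarith

end ViscousField

/-! ### The zero viscosity limit of the flow -/

section AdhesionFlow

variable {φ : EuclideanSpace ℝ (Fin d) → ℝ} {K : ℝ≥0} {lam ε t : ℝ}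
  {x y z : EuclideanSpace ℝ (Fin d)}

theorem IsViscousFlow.isTrajectory {Z : ℝ → EuclideanSpace ℝ (Fin d) → EuclideanSpace ℝ (Fin d)}
    (h : IsViscousFlow φ ε Z) (y : EuclideanSpace ℝ (Fin d)) :
    IsTrajectory (fun t => ∇ (viscousPotential φ ε t)) y fun s => Z s y :=
  h y

theorem exists_isViscousFlow (hK : LipschitzWith K φ) (hlam : 0 ≤ lam)
    (hconc : IsLambdaConcave lam φ) (hε : 0 < ε) : ∃ Z, IsViscousFlow φ ε Z := by
  choose γ hγ using fun y =>
    (semiconcaveField_viscousPotential hK hlam hconc hε).exists_isTrajectory y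
  exact ⟨fun t y => γ y t, hγ⟩

theorem norm_viscousFlow_sub_sq_le (hK : LipschitzWith K φ) (hlam : 0 ≤ lam)
    (hconc : IsLambdaConcave lam φ) {η : ℝ → ℝ}
    (hη : ∀ ε, 0 < ε → ε ≤ 1 / 2 → ∀ s, 0 < s → s ≤ t →
      ∀ x, |viscousPotential φ ε s x - hopfLax φ s x| ≤ η ε)
    {ε₁ ε₂ : ℝ} (hε₁ : ε₁ ∈ Ioc 0 (1 / 2)) (hε₂ : ε₂ ∈ Ioc 0 (1 / 2))
    {Z₁ Z₂ : ℝ → EuclideanSpace ℝ (Fin d) → EuclideanSpace ℝ (Fin d)}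
    (h₁ : IsViscousFlow φ ε₁ Z₁) (h₂ : IsViscousFlow φ ε₂ Z₂) (ht : 0 ≤ t)
    (y : EuclideanSpace ℝ (Fin d)) :
    ‖Z₁ t y - Z₂ t y‖ ^ 2 ≤ Real.exp (2 * lam * t) * (4 * (η ε₁ + η ε₂) * t) := by
  rcases ht.eq_or_lt with rfl | ht
  · rw [(h₁ y).1, (h₂ y).1]; simp
  have hη0 : ∀ ε ∈ Ioc (0 : ℝ) (1 / 2), 0 ≤ η ε := fun ε hε =>
    (abs_nonneg _).trans (hη ε hε.1 hε.2 t ht le_rfl 0)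
  have h := norm_sub_sq_le_of_supergradient (U₁ := viscousPotential φ ε₁)
    (U₂ := viscousPotential φ ε₂) (lam := lam) (η := η ε₁ + η ε₂) ht.le
    ((h₁.isTrajectory y).continuousOn t) ((h₂.isTrajectory y).continuousOn t)
    (fun s hs => (h₁ y).2.2 s hs.1) (fun s hs => (h₂ y).2.2 s hs.1)
    (fun s hs => viscousPotential_le hK hconc hε₁.1 hs.1 _)
    (fun s hs => viscousPotential_le hK hconc hε₂.1 hs.1 _)
    (fun s hs z => ?_) hlam (add_nonneg (hη0 ε₁ hε₁) (hη0 ε₂ hε₂))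
  · simpa [(h₁ y).1, (h₂ y).1] using h
  · have e₁ := abs_le.1 (hη ε₁ hε₁.1 hε₁.2 s hs.1 hs.2.le z)
    have e₂ := abs_le.1 (hη ε₂ hε₂.1 hε₂.2 s hs.1 hs.2.le z)
    rw [abs_le]
    constructor <;> linarith

/-- The viscous trajectories are Cauchy as `ε → 0`, because the potentials are uniformly Cauchy and
the stability estimate applies to each pair. -/
theorem exists_isAdhesionFlow (hK : LipschitzWith K φ) (hlam : 0 ≤ lam)
    (hconc : IsLambdaConcave lam φ) : ∃ X, IsAdhesionFlow φ X := by
  choose! Xe hXe using fun ε (hε : 0 < ε) => exists_isViscousFlow hK hlam hconc hε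
  have hlim : ∀ t, 0 ≤ t → ∀ y, ∃ z, Tendsto (fun ε => Xe ε t y) (𝓝[>] 0) (𝓝 z) := by
    intro t ht y
    obtain ⟨η, hη0, hη⟩ := exists_abs_viscousPotential_sub_hopfLax_le hK hlam hconc t
    refine cauchy_map_iff_exists_tendsto.1 (Metric.cauchy_iff.2 ⟨inferInstance, fun κ hκ => ?_⟩)
    have h1 : Tendsto (fun ε => Real.exp (2 * lam * t) * (8 * η ε * t)) (𝓝[>] 0)
        (𝓝 (Real.exp (2 * lam * t) * (8 * 0 * t))) :=
      ((hη0.const_mul 8).mul_const t).const_mul _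
    simp only [mul_zero, zero_mul] at h1
    have h2 : ∀ᶠ ε in 𝓝[>] (0 : ℝ), ε ∈ Ioc 0 (1 / 2) ∧
        Real.exp (2 * lam * t) * (8 * η ε * t) < κ ^ 2 :=
      (Filter.Eventually.and (Ioc_mem_nhdsGT (by norm_num))
        (h1.eventually_lt_const (by positivity)))
    refine ⟨_, image_mem_map h2, ?_⟩
    rintro _ ⟨ε₁, ⟨hε₁, hb₁⟩, rfl⟩ _ ⟨ε₂, ⟨hε₂, hb₂⟩, rfl⟩
    have h3 := norm_viscousFlow_sub_sq_le hK hlam hconc hη hε₁ hε₂ (hXe ε₁ hε₁.1) (hXe ε₂ hε₂.1)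
      ht y
    rw [dist_eq_norm]
    refine lt_of_pow_lt_pow_left₀ 2 hκ.le (lt_of_le_of_lt h3 ?_)
    linarith
  choose! X hX using hlim
  exact ⟨X, Xe, hXe, hX⟩

variable {X : ℝ → EuclideanSpace ℝ (Fin d) → EuclideanSpace ℝ (Fin d)}

theorem IsAdhesionFlow.lipschitzWith (hX : IsAdhesionFlow φ X) (hK : LipschitzWith K φ)
    (hlam : 0 ≤ lam) (hconc : IsLambdaConcave lam φ) (ht : 0 ≤ t) :
    LipschitzWith (Real.exp (lam * t)).toNNReal (X t) := by
  obtain ⟨Xe, hXe, hlim⟩ := hX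
  refine LipschitzWith.of_dist_le_mul fun y z => ?_
  rw [Real.coe_toNNReal _ (Real.exp_pos _).le, dist_eq_norm, dist_eq_norm]
  refine le_of_tendsto ((hlim t ht y).sub (hlim t ht z)).norm ?_
  refine eventually_nhdsWithin_of_forall fun ε hε => ?_
  have h := (semiconcaveField_viscousPotential hK hlam hconc hε).norm_sub_le_of_isTrajectory₂
    ((hXe ε hε).isTrajectory y) ((hXe ε hε).isTrajectory z) ht
  exact h

theorem IsAdhesionFlow.norm_sub_le (hX : IsAdhesionFlow φ X) (hK : LipschitzWith K φ)
    (hlam : 0 ≤ lam) (hconc : IsLambdaConcave lam φ) (ht : 0 ≤ t)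
    (y : EuclideanSpace ℝ (Fin d)) : ‖X t y - y‖ ≤ K * t := by
  obtain ⟨Xe, hXe, hlim⟩ := hX
  refine le_of_tendsto ((hlim t ht y).sub_const y).norm ?_
  refine eventually_nhdsWithin_of_forall fun ε hε => ?_
  have h := (semiconcaveField_viscousPotential hK hlam hconc hε).norm_sub_le_of_isTrajectory
    ((hXe ε hε).isTrajectory y) ht
  exact h

/-- The Hopf–Lax solution has supergradient `p` along the ray `y + s p` of a maximizer. -/
theorem hopfLax_le_of_w_eq (hK : LipschitzWith K φ) (hconc : IsLambdaConcave lam φ) (ht : 0 < t)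
    (h : w φ t x = ⟪x, y⟫ - psi φ t y) {s : ℝ} (hs : 0 < s) (hst : s ≤ t)
    (z : EuclideanSpace ℝ (Fin d)) :
    hopfLax φ s z ≤ hopfLax φ s (y + s • t⁻¹ • (x - y))
      + ⟪t⁻¹ • (x - y), z - (y + s • t⁻¹ • (x - y))⟫
      + lam / 2 * ‖z - (y + s • t⁻¹ • (x - y))‖ ^ 2 := by
  have h1 := (hopfLax_eq_iff hs).2 (w_eq_of_le ht hK h hs.le hst)
  obtain ⟨p, hp⟩ : ∃ p, p = t⁻¹ • (x - y) := ⟨_, rfl⟩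
  rw [← hp] at h1 ⊢
  -- Freezing the competitor `y` gives a touching paraboloid of curvature `1/s`, which blows up as
  -- `s → 0`. Semiconcavity keeps its linear part and replaces the curvature by `λ`.
  refine (isLambdaConcave_hopfLax hs hK hconc).le_of_isLittleO
    (e := fun h => (2 * s)⁻¹ * ‖h‖ ^ 2) ?_ (fun h => ?_) z
  · have h2 : (fun h : EuclideanSpace ℝ (Fin d) => ‖h‖ ^ 2) =o[𝓝 0] fun h => ‖h‖ :=
      (Asymptotics.isLittleO_pow_id (𝕜 := ℝ) (n := 2) (by norm_num)).comp_tendsto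
        (show Tendsto (fun h : EuclideanSpace ℝ (Fin d) => ‖h‖) (𝓝 0) (𝓝 0) from tendsto_norm_zero)
    exact h2.const_mul_left _
  · have h2 := hopfLax_le hs hK (y + s • p + h) y
    refine h2.trans (le_of_eq ?_)
    rw [h1, show y + s • p + h - y = s • p + h by abel, add_sub_cancel_left, norm_add_sq_real,
      inner_smul_left]
    simp only [conj_trivial]
    field_simp
    ring

/-- The stability estimate compares the viscous trajectory with the straight ray, which follows
supergradients of the Hopf–Lax solution up to time `t`. -/
theorem IsAdhesionFlow.eq_of_w_eq (hX : IsAdhesionFlow φ X) (hK : LipschitzWith K φ)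
    (hlam : 0 ≤ lam) (hconc : IsLambdaConcave lam φ) (ht : 0 < t)
    (h : w φ t x = ⟪x, y⟫ - psi φ t y) {s : ℝ} (hs : 0 ≤ s) (hst : s ≤ t) :
    X s y = y + s • t⁻¹ • (x - y) := by
  obtain ⟨Xe, hXe, hlim⟩ := hX
  obtain ⟨η, hη0, hη⟩ := exists_abs_viscousPotential_sub_hopfLax_le hK hlam hconc t
  refine tendsto_nhds_unique (hlim s hs y) ?_
  have h1 : Tendsto (fun ε => Real.exp (2 * lam * s) * (4 * η ε * s)) (𝓝[>] 0)
      (𝓝 (Real.exp (2 * lam * s) * (4 * 0 * s))) :=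
    ((hη0.const_mul 4).mul_const s).const_mul _
  simp only [mul_zero, zero_mul] at h1
  have h2 : Tendsto (fun ε => ‖Xe ε s y - (y + s • t⁻¹ • (x - y))‖ ^ 2) (𝓝[>] 0) (𝓝 0) := by
    refine squeeze_zero' (Eventually.of_forall fun _ => by positivity) ?_ h1
    filter_upwards [Ioc_mem_nhdsGT (show (0 : ℝ) < 1 / 2 by norm_num)] with ε hε
    have h3 := norm_sub_sq_le_of_supergradient (U₁ := viscousPotential φ ε)
      (U₂ := hopfLax φ) (lam := lam) (η := η ε) (γ₂ := fun s => y + s • t⁻¹ • (x - y))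
      (p₂ := fun _ => t⁻¹ • (x - y)) hs
      (((hXe ε hε.1).isTrajectory y).continuousOn s) (Continuous.continuousOn (by fun_prop))
      (fun r hr => (hXe ε hε.1 y).2.2 r hr.1)
      (fun r _ => by simpa using ((hasDerivAt_id' r).smul_const (t⁻¹ • (x - y))).const_add y)
      (fun r hr => viscousPotential_le hK hconc hε.1 hr.1 _)
      (fun r hr => hopfLax_le_of_w_eq hK hconc ht h hr.1 (hr.2.le.trans hst))
      (fun r hr => hη ε hε.1 hε.2 r hr.1 (hr.2.le.trans hst)) hlam
      ((abs_nonneg _).trans (hη ε hε.1 hε.2 t ht le_rfl 0))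
    simpa [(hXe ε hε.1 y).1] using h3
  rw [tendsto_iff_norm_sub_tendsto_zero]
  have h3 := h2.sqrt
  simpa [Real.sqrt_sq (norm_nonneg _)] using h3

/-! ### Fibers of the limit flow -/

theorem IsAdhesionFlow.exists_isPreconnected (hX : IsAdhesionFlow φ X) (hK : LipschitzWith K φ)
    (hlam : 0 ≤ lam) (hconc : IsLambdaConcave lam φ) (ht : 0 < t)
    {p₁ p₂ : EuclideanSpace ℝ (Fin d)} (h₁ : X t p₁ = x) (h₂ : X t p₂ = x) {κ : ℝ} (hκ : 0 < κ) :
    ∃ C : Set (EuclideanSpace ℝ (Fin d)), IsPreconnected C ∧ p₁ ∈ C ∧ p₂ ∈ C ∧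
      ∀ q ∈ C, ‖X t q - x‖ ≤ κ := by
  obtain ⟨Xe, hXe, hlim⟩ := hX
  obtain ⟨η, hη0, hη⟩ := exists_abs_viscousPotential_sub_hopfLax_le hK hlam hconc t
  have hsmall : ∀ᶠ ε in 𝓝[>] (0 : ℝ), ε ∈ Ioc 0 (1 / 2) ∧
      Real.exp (2 * lam * t) * (4 * η ε * t) < (κ / 4) ^ 2 := by
    have h1 : Tendsto (fun ε => Real.exp (2 * lam * t) * (4 * η ε * t)) (𝓝[>] 0)
        (𝓝 (Real.exp (2 * lam * t) * (4 * 0 * t))) :=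
      ((hη0.const_mul 4).mul_const t).const_mul _
    simp only [mul_zero, zero_mul] at h1
    exact Filter.Eventually.and (Ioc_mem_nhdsGT (by norm_num))
        (h1.eventually_lt_const (by positivity))
  obtain ⟨ε, hε, hηε⟩ := hsmall.exists
  -- Sending the second viscosity to `0` in the comparison of two viscous flows gives a bound
  -- uniform in `q`.
  have hclose : ∀ q, ‖Xe ε t q - X t q‖ ≤ κ / 4 := by
    intro q
    have h3 : ‖Xe ε t q - X t q‖ ^ 2 ≤ Real.exp (2 * lam * t) * (4 * (η ε + 0) * t) := by
      refine le_of_tendsto_of_tendsto ((tendsto_const_nhds.sub (hlim t ht.le q)).norm.pow 2)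
        ((((tendsto_const_nhds (x := η ε)).add hη0).const_mul 4).mul_const t |>.const_mul
          (Real.exp (2 * lam * t))) ?_
      filter_upwards [Ioc_mem_nhdsGT (show (0 : ℝ) < 1 / 2 by norm_num)] with ε₂ hε₂
      exact norm_viscousFlow_sub_sq_le hK hlam hconc hη hε hε₂ (hXe ε hε.1) (hXe ε₂ hε₂.1) ht.le q
    rw [add_zero] at h3
    exact le_of_sq_le_sq (h3.trans hηε.le) (by positivity)
  have hδ : ∀ᶠ δ in 𝓝[>] (0 : ℝ), δ ∈ Ioc 0 t ∧
      2 * (Real.exp (lam * t) * (K * δ)) < κ / 2 := by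
    have h1 : Tendsto (fun δ : ℝ => 2 * (Real.exp (lam * t) * (K * δ))) (𝓝[>] 0)
        (𝓝 (2 * (Real.exp (lam * t) * (K * 0)))) :=
      (((tendsto_id.const_mul _).const_mul _).const_mul _).mono_left nhdsWithin_le_nhds
    simp only [mul_zero] at h1
    exact Filter.Eventually.and (Ioc_mem_nhdsGT ht) (h1.eventually_lt_const (by positivity))
  obtain ⟨δ, hδ, hδκ⟩ := hδ.exists
  obtain ⟨C, hC, hp₁, hp₂, hq⟩ :=
    (semiconcaveField_viscousPotential hK hlam hconc hε.1).exists_isPreconnected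
      (hXe ε hε.1).isTrajectory hδ.1 hδ.2 (x := x) (r := κ / 4) (p₁ := p₁) (p₂ := p₂)
      (by have := hclose p₁; rwa [h₁] at this) (by have := hclose p₂; rwa [h₂] at this)
  refine ⟨C, hC, hp₁, hp₂, fun q hqC => ?_⟩
  have h3 := hq q hqC
  have h4 := hclose q
  have h5 := norm_sub_le_norm_sub_add_norm_sub (X t q) (Xe ε t q) x
  rw [norm_sub_rev] at h4
  linarith

/-- The fibers of `X_t` project onto intervals. -/
theorem IsAdhesionFlow.exists_apply_eq (hX : IsAdhesionFlow φ X) (hK : LipschitzWith K φ)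
    (hlam : 0 ≤ lam) (hconc : IsLambdaConcave lam φ) (ht : 0 < t)
    {p₁ p₂ : EuclideanSpace ℝ (Fin d)} (h₁ : X t p₁ = x) (h₂ : X t p₂ = x) {i : Fin d} {c : ℝ}
    (hc₁ : p₁ i ≤ c) (hc₂ : c ≤ p₂ i) : ∃ q, X t q = x ∧ q i = c := by
  have hcont : Continuous fun q : EuclideanSpace ℝ (Fin d) => q i := by fun_prop
  -- A connected set containing `p₁` and `p₂` meets the hyperplane `{q_i = c}`. This gives only
  -- approximate solutions; the bound on `X_t q - q` and compactness then give an exact one.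
  have hq : ∀ κ : ℝ, 0 < κ → ∃ q : EuclideanSpace ℝ (Fin d), q i = c ∧ ‖X t q - x‖ ≤ κ := by
    intro κ hκ
    obtain ⟨C, hC, hp₁, hp₂, hq⟩ := hX.exists_isPreconnected hK hlam hconc ht h₁ h₂ hκ
    obtain ⟨q, hqC, hqc⟩ := hC.intermediate_value hp₁ hp₂ hcont.continuousOn ⟨hc₁, hc₂⟩
    exact ⟨q, hqc, hq q hqC⟩
  have hbd : ∀ q, ‖X t q - x‖ ≤ 1 → q ∈ Metric.closedBall x (1 + K * t) := by
    intro q hq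
    rw [mem_closedBall_iff_norm]
    have h3 := hX.norm_sub_le hK hlam hconc ht.le q
    have h4 := norm_sub_le_norm_sub_add_norm_sub q (X t q) x
    rw [norm_sub_rev] at h3
    linarith
  have hS : IsCompact (Metric.closedBall x (1 + K * t) ∩ {q | q i = c}) :=
    (isCompact_closedBall _ _).inter_right (isClosed_eq hcont continuous_const)
  obtain ⟨q₁, hq₁, hq₁'⟩ := hq 1 one_pos
  obtain ⟨q, hqS, hmin⟩ := hS.exists_isMinOn (f := fun q => ‖X t q - x‖) ⟨q₁, hbd q₁ hq₁', hq₁⟩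
    (((hX.lipschitzWith hK hlam hconc ht.le).continuous.sub continuous_const).norm.continuousOn)
  refine ⟨q, ?_, hqS.2⟩
  rw [← sub_eq_zero, ← norm_le_zero_iff]
  refine le_of_forall_pos_le_add fun κ hκ => ?_
  obtain ⟨q', hq', hq''⟩ := hq (min κ 1) (by positivity)
  have h3 : ‖X t q - x‖ ≤ ‖X t q' - x‖ := hmin ⟨hbd q' (hq''.trans (min_le_right _ _)), hq'⟩
  rw [zero_add]
  exact h3.trans (hq''.trans (min_le_left _ _))

theorem volume_image_eq_zero_of_lipschitzWith {L : ℝ≥0}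
    {f : EuclideanSpace ℝ (Fin d) → EuclideanSpace ℝ (Fin d)} (hf : LipschitzWith L f)
    {s : Set (EuclideanSpace ℝ (Fin d))} (hs : volume s = 0) : volume (f '' s) = 0 := by
  have h1 : Measure.hausdorffMeasure (d : ℝ) ≪ (volume : Measure (EuclideanSpace ℝ (Fin d))) :=
    Measure.absolutelyContinuous_isAddHaarMeasure _ _
  have h2 : (volume : Measure (EuclideanSpace ℝ (Fin d))) ≪ Measure.hausdorffMeasure (d : ℝ) :=
    Measure.absolutelyContinuous_isAddHaarMeasure _ _
  refine h2 (le_antisymm ?_ zero_le)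
  refine (hf.hausdorffMeasure_image_le (Nat.cast_nonneg d) s).trans ?_
  rw [h1 hs, mul_zero]

theorem volume_setOf_apply_eq (i : Fin d) (c : ℝ) :
    volume {q : EuclideanSpace ℝ (Fin d) | q i = c} = 0 := by
  have h := (EuclideanSpace.volume_preserving_symm_measurableEquiv_toLp (Fin d)).measure_preimage
    (s := {q : Fin d → ℝ | q i = c})
    (measurableSet_eq_fun (by fun_prop) measurable_const).nullMeasurableSet
  change volume {q : EuclideanSpace ℝ (Fin d) | q i = c} = _ at h
  rw [h]
  exact Measure.pi_hyperplane (fun _ : Fin d => (volume : Measure ℝ)) i c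

/-- Almost every fiber of the limit flow has at most one point. -/
theorem IsAdhesionFlow.ae_fiber_subsingleton (hX : IsAdhesionFlow φ X) (hK : LipschitzWith K φ)
    (hlam : 0 ≤ lam) (hconc : IsLambdaConcave lam φ) (ht : 0 < t) :
    ∀ᵐ x : EuclideanSpace ℝ (Fin d), ∀ p₁ p₂, X t p₁ = x → X t p₂ = x → p₁ = p₂ := by
  -- Rational levels suffice: two distinct points differ in some coordinate, and a rational lies
  -- strictly between the two values.
  have hnull : ∀ (i : Fin d) (c : ℚ),
      ∀ᵐ x : EuclideanSpace ℝ (Fin d), x ∉ X t '' {q | q i = (c : ℝ)} := fun i c =>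
    measure_eq_zero_iff_ae_notMem.1
      (volume_image_eq_zero_of_lipschitzWith (hX.lipschitzWith hK hlam hconc ht.le)
        (volume_setOf_apply_eq i c))
  filter_upwards [ae_all_iff.2 fun i => ae_all_iff.2 (hnull i)] with x hx
  have hle : ∀ p₁ p₂, X t p₁ = x → X t p₂ = x → ∀ i, p₂ i ≤ p₁ i := by
    intro p₁ p₂ h₁ h₂ i
    by_contra! hlt
    obtain ⟨c, hc₁, hc₂⟩ := exists_rat_btwn hlt
    obtain ⟨q, hq, hqc⟩ := hX.exists_apply_eq hK hlam hconc ht h₁ h₂ hc₁.le hc₂.le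
    exact hx i c ⟨q, hqc, hq⟩
  intro p₁ p₂ h₁ h₂
  ext i
  exact le_antisymm (hle p₂ p₁ h₂ h₁ i) (hle p₁ p₂ h₁ h₂ i)

/-- Almost every point is reached by exactly one particle, which has been streaming freely. -/
theorem IsAdhesionFlow.ae_free_streaming (hX : IsAdhesionFlow φ X) (hK : LipschitzWith K φ)
    (hlam : 0 ≤ lam) (hconc : IsLambdaConcave lam φ) (ht : 0 < t) :
    ∀ᵐ x : EuclideanSpace ℝ (Fin d), ∃ y ∈ Sigma φ t,
      X t ⁻¹' {x} = {y} ∧ T φ t ⁻¹' {x} = {y} ∧ DifferentiableAt ℝ φ y ∧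
      ∀ s : ℝ, 0 ≤ s → s ≤ t → X s y = T φ s y ∧ T φ s y = y + s • ∇ φ y := by
  filter_upwards [hX.ae_fiber_subsingleton hK hlam hconc ht, ae_differentiableAt_w ht hK]
    with x hfib hx
  have hy := w_eq_of_differentiableAt ht.le hK hx
  have hg := hasGradientAt_of_w_eq ht hK hconc hy
  refine ⟨∇ (w φ t) x, gradient_w_mem_Sigma ht.le hK hx, ?_,
    T_preimage_of_differentiableAt ht.le hK hlam hconc hx, hg.differentiableAt, ?_⟩
  · have h1 : X t (∇ (w φ t) x) = x := by
      rw [hX.eq_of_w_eq hK hlam hconc ht hy ht.le le_rfl, smul_smul, mul_inv_cancel₀ ht.ne',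
        one_smul, add_sub_cancel]
    ext p
    rw [mem_preimage, mem_singleton_iff, mem_singleton_iff]
    exact ⟨fun hp => hfib _ _ hp h1, fun hp => by rw [hp, h1]⟩
  · intro s hs hst
    have h1 : T φ s (∇ (w φ t) x) = ∇ (w φ t) x + s • ∇ φ (∇ (w φ t) x) := by
      rw [hg.gradient, T_eq_iff hs hK hlam hconc]
      exact mem_subgradient_w_of_eq hs hK (w_eq_of_le ht hK hy hs hst)
    refine ⟨?_, h1⟩
    rw [h1, hX.eq_of_w_eq hK hlam hconc ht hy hs hst, hg.gradient]

end AdhesionFlow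

/-! ### Push-forwards of Lebesgue measure -/

theorem isProperMap_of_norm_sub_le {E : Type*} [NormedAddCommGroup E] [ProperSpace E] {f : E → E}
    {C : ℝ} (hf : Continuous f) (hC : ∀ y, ‖f y - y‖ ≤ C) : IsProperMap f := by
  refine isProperMap_iff_tendsto_cocompact.2 ⟨hf, ?_⟩
  rw [← Metric.cobounded_eq_cocompact, ← tendsto_norm_atTop_iff_cobounded]
  refine tendsto_atTop_mono (fun y => ?_)
    (tendsto_atTop_add_const_right _ (-C) tendsto_norm_cobounded_atTop)
  have h := norm_sub_norm_le y (f y)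
  rw [norm_sub_rev] at h
  linarith [hC y]

/-- A proper map pushes Lebesgue measure to a measure finite on compact sets. The resulting
σ-finiteness supplies the Lebesgue decompositions. -/
theorem sigmaFinite_map_of_isProperMap {f : EuclideanSpace ℝ (Fin d) → EuclideanSpace ℝ (Fin d)}
    (hf : IsProperMap f) : SigmaFinite (Measure.map f volume) := by
  have : IsFiniteMeasureOnCompacts (Measure.map f volume) := by
    refine ⟨fun C hC => ?_⟩
    rw [Measure.map_apply hf.continuous.measurable hC.measurableSet]
    exact (hf.isCompact_preimage hC).measure_lt_top
  infer_instance

theorem rnDeriv_restrict_of_ae {α : Type*} [MeasurableSpace α] {μ ν : Measure α}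
    [μ.HaveLebesgueDecomposition ν] [SigmaFinite ν] {s : Set α} (hs : MeasurableSet s)
    (h : ∀ᵐ x ∂ν, x ∈ s) : (μ.restrict s).rnDeriv ν =ᵐ[ν] μ.rnDeriv ν := by
  filter_upwards [Measure.rnDeriv_restrict μ ν hs, h] with x hx hxs
  rw [hx, indicator_of_mem hxs]

/-- The absolutely continuous part of a push-forward only depends on almost every fiber. -/
theorem rnDeriv_map_congr {α β : Type*} [MeasurableSpace α] [MeasurableSpace β] {μ : Measure α}
    {ν : Measure β} [SigmaFinite ν] {f g : α → β} (hf : Measurable f) (hg : Measurable g)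
    [(μ.map f).HaveLebesgueDecomposition ν] [(μ.map g).HaveLebesgueDecomposition ν]
    (h : ∀ᵐ x ∂ν, f ⁻¹' {x} = g ⁻¹' {x}) : (μ.map f).rnDeriv ν =ᵐ[ν] (μ.map g).rnDeriv ν := by
  obtain ⟨s, hs, hsm, hsν⟩ := exists_measurable_superset_of_null (mem_ae_iff.1 h)
  have hs' : ∀ᵐ x ∂ν, x ∈ sᶜ := by
    rw [ae_iff]; simpa using hsν
  have e : (μ.map f).restrict sᶜ = (μ.map g).restrict sᶜ := by
    ext B hB
    rw [Measure.restrict_apply hB, Measure.restrict_apply hB,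
      Measure.map_apply hf (hB.inter hsm.compl), Measure.map_apply hg (hB.inter hsm.compl)]
    congr 1
    have hfib : ∀ x ∈ B ∩ sᶜ, f ⁻¹' {x} = g ⁻¹' {x} := fun x hx => by
      by_contra hne
      exact hx.2 (hs hne)
    rw [← biUnion_preimage_singleton f, ← biUnion_preimage_singleton g]
    exact iUnion₂_congr hfib
  have h1 := rnDeriv_restrict_of_ae (μ := μ.map f) hsm.compl hs'
  have h2 := rnDeriv_restrict_of_ae (μ := μ.map g) hsm.compl hs'
  rw [e] at h1
  exact h1.symm.trans h2

/-! ### The Monge–Ampère measure as a push-forward, and its density -/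

section MongeAmpere

variable {φ : EuclideanSpace ℝ (Fin d) → ℝ} {K : ℝ≥0} {lam t : ℝ}
  {x y : EuclideanSpace ℝ (Fin d)}

theorem isProperMap_T (ht : 0 ≤ t) (hK : LipschitzWith K φ) (hlam : 0 ≤ lam)
    (hconc : IsLambdaConcave lam φ) : IsProperMap (T φ t) :=
  isProperMap_of_norm_sub_le (lipschitzWith_T ht hK hlam hconc).continuous
    (norm_T_sub_le ht hK hlam hconc)

theorem isMongeAmpereMeasure_map_T (ht : 0 ≤ t) (hK : LipschitzWith K φ) (hlam : 0 ≤ lam)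
    (hconc : IsLambdaConcave lam φ) :
    IsMongeAmpereMeasure (w φ t) (Measure.map (T φ t) volume) := by
  intro B hB
  rw [Measure.map_apply (lipschitzWith_T ht hK hlam hconc).continuous.measurable hB]
  congr 1
  ext y
  simp only [mem_preimage, mem_iUnion, exists_prop, ← T_eq_iff ht hK hlam hconc]
  simp

/-- The points `y` where `T_t` is differentiable and nondegenerate, and `w_t` is differentiable
at `T_t y`. -/
def regularSet (φ : EuclideanSpace ℝ (Fin d) → ℝ) (t : ℝ) : Set (EuclideanSpace ℝ (Fin d)) :=
  {y | DifferentiableAt ℝ (w φ t) (T φ t y) ∧ DifferentiableAt ℝ (T φ t) y ∧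
    (fderiv ℝ (T φ t) y).det ≠ 0}

theorem measurableSet_regularSet (ht : 0 ≤ t) (hK : LipschitzWith K φ) (hlam : 0 ≤ lam)
    (hconc : IsLambdaConcave lam φ) : MeasurableSet (regularSet φ t) := by
  have hT := (lipschitzWith_T ht hK hlam hconc).continuous
  refine (hT.measurable (measurableSet_of_differentiableAt ℝ (w φ t))).inter
    ((measurableSet_of_differentiableAt ℝ (T φ t)).inter ?_)
  have h : Measurable fun y => (fderiv ℝ (T φ t) y).det :=
    ContinuousLinearMap.continuous_det.measurable.comp (measurable_fderiv ℝ (T φ t))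
  exact h (measurableSet_singleton 0).compl

theorem gradient_w_T (ht : 0 ≤ t) (hK : LipschitzWith K φ) (hlam : 0 ≤ lam)
    (hconc : IsLambdaConcave lam φ) (hy : DifferentiableAt ℝ (w φ t) (T φ t y)) :
    ∇ (w φ t) (T φ t y) = y :=
  (subgradient_eq_singleton hy (mem_subgradient_T ht hK hlam hconc y)).symm

theorem T_gradient_w (ht : 0 ≤ t) (hK : LipschitzWith K φ) (hlam : 0 ≤ lam)
    (hconc : IsLambdaConcave lam φ) (hx : DifferentiableAt ℝ (w φ t) x) :
    T φ t (∇ (w φ t) x) = x := by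
  have h : ∇ (w φ t) x ∈ T φ t ⁻¹' {x} := by
    rw [T_preimage_of_differentiableAt ht hK hlam hconc hx]
    rfl
  exact h

theorem injOn_T_regularSet (ht : 0 ≤ t) (hK : LipschitzWith K φ) (hlam : 0 ≤ lam)
    (hconc : IsLambdaConcave lam φ) : InjOn (T φ t) (regularSet φ t) := by
  intro y hy z hz h
  rw [← gradient_w_T ht hK hlam hconc hy.1, h, gradient_w_T ht hK hlam hconc hz.1]

/-- The bad points `y` need not be negligible, but their images under `T_t` are: by Rademacher and
the Lipschitz bound where `T_t` is not differentiable, by Sard where the determinant vanishes. -/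
theorem ae_gradient_w_mem_regularSet (ht : 0 < t) (hK : LipschitzWith K φ) (hlam : 0 ≤ lam)
    (hconc : IsLambdaConcave lam φ) :
    ∀ᵐ x : EuclideanSpace ℝ (Fin d), DifferentiableAt ℝ (w φ t) x ∧
      ∇ (w φ t) x ∈ regularSet φ t := by
  have hT := lipschitzWith_T ht.le hK hlam hconc
  have h1 : volume (T φ t '' {y | ¬ DifferentiableAt ℝ (T φ t) y}) = 0 :=
    volume_image_eq_zero_of_lipschitzWith hT (ae_iff.1 hT.ae_differentiableAt)
  have h2 : volume (T φ t '' {y | DifferentiableAt ℝ (T φ t) y ∧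
      (fderiv ℝ (T φ t) y).det = 0}) = 0 :=
    addHaar_image_eq_zero_of_det_fderivWithin_eq_zero volume
      (fun y hy => hy.1.hasFDerivAt.hasFDerivWithinAt) fun y hy => hy.2
  filter_upwards [ae_differentiableAt_w ht hK, measure_eq_zero_iff_ae_notMem.1 h1,
    measure_eq_zero_iff_ae_notMem.1 h2] with x hx hx1 hx2
  have hTx := T_gradient_w ht.le hK hlam hconc hx
  have h3 : DifferentiableAt ℝ (T φ t) (∇ (w φ t) x) := by
    by_contra h
    exact hx1 ⟨_, h, hTx⟩
  refine ⟨hx, ?_, h3, fun h => hx2 ⟨_, ⟨h3, h⟩, hTx⟩⟩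
  rwa [hTx]

theorem rnDeriv_map_T (ht : 0 < t) (hK : LipschitzWith K φ) (hlam : 0 ≤ lam)
    (hconc : IsLambdaConcave lam φ) [(Measure.map (T φ t) volume).HaveLebesgueDecomposition volume] :
    (Measure.map (T φ t) volume).rnDeriv volume =ᵐ[volume]
      fun x => (ENNReal.ofReal |(fderiv ℝ (T φ t) (∇ (w φ t) x)).det|)⁻¹ := by
  have hT := (lipschitzWith_T ht.le hK hlam hconc).continuous
  have hD := measurableSet_regularSet ht.le hK hlam hconc
  have hinj := injOn_T_regularSet ht.le hK hlam hconc
  have hderiv : ∀ y ∈ regularSet φ t,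
      HasFDerivWithinAt (T φ t) (fderiv ℝ (T φ t) y) (regularSet φ t) y := fun y hy =>
    hy.2.1.hasFDerivAt.hasFDerivWithinAt
  have hTD := measurable_image_of_fderivWithin hD hderiv hinj
  have hae : ∀ᵐ x, x ∈ T φ t '' regularSet φ t := by
    filter_upwards [ae_gradient_w_mem_regularSet ht hK hlam hconc] with x hx
    exact ⟨_, hx.2, T_gradient_w ht.le hK hlam hconc hx.1⟩
  obtain ⟨f, hf⟩ : ∃ f : EuclideanSpace ℝ (Fin d) → ℝ≥0∞,
      f = fun x => (ENNReal.ofReal |(fderiv ℝ (T φ t) (∇ (w φ t) x)).det|)⁻¹ := ⟨_, rfl⟩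
  have hfm : Measurable f := by
    have h1 : Measurable (∇ (w φ t)) :=
      (InnerProductSpace.toDual ℝ (EuclideanSpace ℝ (Fin d))).symm.continuous.measurable.comp
        (measurable_fderiv ℝ (w φ t))
    have h2 : Measurable fun y => (fderiv ℝ (T φ t) y).det :=
      ContinuousLinearMap.continuous_det.measurable.comp (measurable_fderiv ℝ (T φ t))
    have h3 := h2.comp h1
    rw [hf]
    exact (measurable_norm.comp h3).ennreal_ofReal.inv
  -- The regular set is saturated: `w_t` is differentiable at the image of a regular point, so the
  -- fiber there is a single point and no other mass arrives.
  have hpre : ∀ B, T φ t ⁻¹' (B ∩ T φ t '' regularSet φ t) = regularSet φ t ∩ T φ t ⁻¹' B := by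
    intro B
    ext y
    constructor
    · rintro ⟨hyB, z, hz, hzy⟩
      have h1 := gradient_w_T ht.le hK hlam hconc hz.1
      have h2 := gradient_w_T (y := y) ht.le hK hlam hconc (hzy ▸ hz.1)
      rw [hzy] at h1
      rw [h1] at h2
      exact ⟨h2 ▸ hz, hyB⟩
    · rintro ⟨hy, hyB⟩
      exact ⟨hyB, y, hy, rfl⟩
  have key : (Measure.map (T φ t) volume).restrict (T φ t '' regularSet φ t)
      = volume.withDensity f := by
    ext B hB
    rw [Measure.restrict_apply hB, Measure.map_apply hT.measurable (hB.inter hTD), hpre,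
      withDensity_apply _ hB]
    have hDB : MeasurableSet (regularSet φ t ∩ T φ t ⁻¹' B) := hD.inter (hT.measurable hB)
    have e1 : ∫⁻ x in B, f x = ∫⁻ x in T φ t '' (regularSet φ t ∩ T φ t ⁻¹' B), f x := by
      rw [image_inter_preimage]
      refine setLIntegral_congr ?_
      filter_upwards [hae] with x hx
      exact propext ⟨fun h => ⟨hx, h⟩, fun h => h.2⟩
    rw [e1, lintegral_image_eq_lintegral_abs_det_fderiv_mul volume hDB
      (fun y hy => (hderiv y hy.1).mono inter_subset_left) (hinj.mono inter_subset_left)]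
    rw [← setLIntegral_one]
    refine setLIntegral_congr_fun hDB fun y hy => ?_
    have hdet := hy.1.2.2
    simp only [hf, gradient_w_T ht.le hK hlam hconc hy.1.1]
    rw [ENNReal.mul_inv_cancel _ ENNReal.ofReal_ne_top]
    simpa using hdet
  have h1 := rnDeriv_restrict_of_ae (μ := Measure.map (T φ t) volume) hTD hae
  rw [key] at h1
  rw [← hf]
  exact h1.symm.trans (Measure.rnDeriv_withDensity volume hfm)

end MongeAmpere

/-! ### Second order expansions of conjugate functions -/

section SecondOrder

variable {E : Type*} [NormedAddCommGroup E] [InnerProductSpace ℝ E]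
  {g : E → ℝ} {S : E → E} {A : E →L[ℝ] E} {y : E}

theorem inner_apply_nonneg_of_monotone (hS : ∀ u v, 0 ≤ ⟪u - v, S u - S v⟫)
    (hA : HasFDerivAt S A y) (u : E) : 0 ≤ ⟪u, A u⟫ := by
  have h1 : HasDerivAt (fun s : ℝ => S (y + s • u)) (A u) 0 := hA.hasLineDerivAt u
  have h2 : HasDerivAt (fun s : ℝ => ⟪u, S (y + s • u)⟫) ⟪u, A u⟫ 0 := by
    simpa using (hasDerivAt_const (0 : ℝ) u).inner ℝ h1
  refine h2.nonneg_of_monotone fun a b hab => ?_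
  rcases hab.eq_or_lt with rfl | hab
  · exact le_rfl
  have h3 := hS (y + b • u) (y + a • u)
  rw [add_sub_add_left_eq_sub, ← sub_smul, inner_smul_left, inner_sub_right] at h3
  have h4 := nonneg_of_mul_nonneg_right h3 (by simpa using hab)
  exact sub_nonneg.1 h4

variable [CompleteSpace E]

theorem isSymmetric_of_hasGradientAt (hg : ∀ z, HasGradientAt g (S z) z) (hA : HasFDerivAt S A y)
    (u v : E) : ⟪A u, v⟫ = ⟪u, A v⟫ := by
  have h1 : HasFDerivAt (fun z => innerSL ℝ (S z)) ((innerSL ℝ).comp A) y :=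
    (innerSL ℝ : E →L[ℝ] E →L[ℝ] ℝ).hasFDerivAt.comp y hA
  have h2 := second_derivative_symmetric (f := g) (fun z => (hg z).hasFDerivAt) h1 u v
  have h3 : ⟪A u, v⟫ = ⟪A v, u⟫ := h2
  rw [h3, real_inner_comm]

/-- A function whose gradient is differentiable at `y` has a second order expansion there. -/
theorem isLittleO_second_order (hg : ∀ z, HasGradientAt g (S z) z) (hA : HasFDerivAt S A y) :
    (fun k => g (y + k) - g y - ⟪S y, k⟫ - 1 / 2 * ⟪A k, k⟫) =o[𝓝 0] fun k => ‖k‖ ^ 2 := by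
  have hsymm := isSymmetric_of_hasGradientAt hg hA
  have hr : (fun k => S (y + k) - S y - A k) =o[𝓝 0] fun k => k :=
    hasFDerivAt_iff_isLittleO_nhds_zero.1 hA
  have hd : ∀ k, HasFDerivAt (fun k => g (y + k) - ⟪S y, k⟫ - 1 / 2 * ⟪A k, k⟫)
      (innerSL ℝ (S (y + k) - S y - A k)) k := by
    intro k
    have h1 : HasFDerivAt (fun k => g (y + k)) (innerSL ℝ (S (y + k))) k := by
      have := (hg (y + k)).hasFDerivAt.comp k ((hasFDerivAt_id k).const_add y)
      exact this
    have h2 : HasFDerivAt (fun k => ⟪S y, k⟫) (innerSL ℝ (S y)) k := (innerSL ℝ (S y)).hasFDerivAt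
    have h3 := (A.hasFDerivAt (x := k)).inner ℝ (hasFDerivAt_id k)
    refine ((h1.sub h2).sub (h3.const_mul (1 / 2))).congr_fderiv ?_
    ext v
    simp [fderivInnerCLM_apply]
    rw [hsymm v k, real_inner_comm (A k) v]
    ring
  rw [Asymptotics.isLittleO_iff]
  intro c hc
  obtain ⟨δ, hδ, hball⟩ := Metric.eventually_nhds_iff_ball.1 (Asymptotics.isLittleO_iff.1 hr hc)
  filter_upwards [Metric.ball_mem_nhds (0 : E) hδ] with k hk
  have h := (convex_closedBall (0 : E) ‖k‖).norm_image_sub_le_of_norm_hasFDerivWithin_le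
    (f := fun k => g (y + k) - ⟪S y, k⟫ - 1 / 2 * ⟪A k, k⟫)
    (f' := fun k => innerSL ℝ (S (y + k) - S y - A k)) (C := c * ‖k‖)
    (fun z _ => (hd z).hasFDerivWithinAt) (fun z hz => ?_)
    (show (0 : E) ∈ _ by simp) (show k ∈ _ by simp)
  · simp only [add_zero, inner_zero_right, map_zero, mul_zero, sub_zero] at h
    rw [norm_pow, norm_norm]
    calc _ = ‖g (y + k) - ⟪S y, k⟫ - 1 / 2 * ⟪A k, k⟫ - g y‖ := by congr 1; ring
      _ ≤ _ := h
      _ = _ := by ring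
  · rw [innerSL_apply_norm]
    have hz' : ‖z‖ ≤ ‖k‖ := by simpa using hz
    have hk' : ‖k‖ < δ := by simpa using hk
    exact (hball z (by simpa using hz'.trans_lt hk')).trans (by gcongr)

/-- If `f` is conjugate to `g`, the gradient `S` of `g` is differentiable at `y` with invertible
derivative, and `y` is the limit of the points conjugate to `x + h`, then `f` has a second order
expansion at `x`, whose Hessian is the inverse of the derivative of `S`. -/
theorem isLittleO_second_order_conjugate {f : E → ℝ} {e : E ≃L[ℝ] E} {κ : E → E}
    (hg : ∀ z, HasGradientAt g (S z) z) (he : HasFDerivAt S (e : E →L[ℝ] E) y)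
    (hf : ∀ z, f (S z) = ⟪z, S z⟫ - g z) (hκ : ∀ h, S (y + κ h) = S y + h)
    (hlim : Tendsto κ (𝓝 0) (𝓝 0)) :
    (fun h => f (S y + h) - f (S y) - ⟪y, h⟫ - 1 / 2 * ⟪h, e.symm h⟫)
      =o[𝓝 0] fun h => ‖h‖ ^ 2 := by
  have hsymm : ∀ u v, ⟪e u, v⟫ = ⟪u, e v⟫ := isSymmetric_of_hasGradientAt hg he
  have hr : (fun h => h - e (κ h)) =o[𝓝 0] κ := by
    have h1 := (hasFDerivAt_iff_isLittleO_nhds_zero.1 he).comp_tendsto hlim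
    refine h1.congr_left fun h => ?_
    simp [hκ]
  have hO : κ =O[𝓝 0] fun h : E => h := by
    have h1 : (fun h => e (κ h)) =O[𝓝 0] κ := (e : E →L[ℝ] E).isBigO_comp κ (𝓝 0)
    have h2 : κ =O[𝓝 0] fun h => e (κ h) := by
      simpa using (e.symm : E →L[ℝ] E).isBigO_comp (fun h => e (κ h)) (𝓝 0)
    -- The remainder is small relative to `e (κ h)`, so `h`, the sum of the two, dominates `e (κ h)`
    -- and with it `κ h`.
    have h3 : (fun h => h - e (κ h)) =o[𝓝 0] fun h => e (κ h) := hr.trans_isBigO h2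
    have h4 := h3.right_isBigO_add
    exact h2.trans (by simpa using h4)
  have hr' : (fun h => h - e (κ h)) =o[𝓝 0] fun h : E => h := hr.trans_isBigO hO
  have h1 : (fun h => g (y + κ h) - g y - ⟪S y, κ h⟫ - 1 / 2 * ⟪e (κ h), κ h⟫)
      =o[𝓝 0] fun h => ‖h‖ ^ 2 :=
    ((isLittleO_second_order hg he).comp_tendsto hlim).trans_isBigO (hO.norm_norm.pow 2)
  have h2 : (fun h => ⟪h - e (κ h), e.symm (h - e (κ h))⟫) =o[𝓝 0] fun h => ‖h‖ ^ 2 := by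
    have h3 : (fun h => e.symm (h - e (κ h))) =o[𝓝 0] fun h : E => h :=
      ((e.symm : E →L[ℝ] E).isBigO_comp (fun h => h - e (κ h)) (𝓝 0)).trans_isLittleO hr'
    have h4 := hr'.norm_norm.mul h3.norm_norm
    refine Asymptotics.IsBigO.trans_isLittleO (g := fun h => ‖h - e (κ h)‖ * ‖e.symm (h - e (κ h))‖)
      (Asymptotics.IsBigO.of_bound 1 (Eventually.of_forall fun h => ?_)) ?_
    · rw [one_mul, norm_mul, norm_norm, norm_norm]
      exact abs_real_inner_le_norm _ _
    · simpa [sq] using h4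
  -- An exact identity: with `r = h - e (κ h)`, the error for `f` at `h` is `-⟪r, e⁻¹ r⟫/2` minus
  -- the error for `g` at `κ h`.
  refine ((h2.const_mul_left (-1 / 2)).sub h1).congr_left fun h => ?_
  have e1 := hf y
  have e2 := hf (y + κ h)
  rw [hκ] at e2
  rw [e2, e1]
  obtain ⟨r, hr⟩ : ∃ r, r = h - e (κ h) := ⟨_, rfl⟩
  have hh : h = e (κ h) + r := by rw [hr]; abel
  obtain ⟨k, hk⟩ : ∃ k, k = κ h := ⟨_, rfl⟩
  rw [← hr, ← hk]
  rw [← hk] at hh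
  rw [hh, map_add, e.symm_apply_apply]
  have e3 : ⟪e k, e.symm r⟫ = ⟪k, r⟫ := by rw [hsymm, e.apply_symm_apply]
  have e4 := hsymm k k
  simp only [inner_add_left, inner_add_right, e3]
  rw [real_inner_comm k r, e4, real_inner_comm k (S y)]
  ring

end SecondOrder

/-! ### The Alexandrov Hessian of `w_t` as the inverse of the derivative of `T_t` -/

section Alexandrov

variable {φ : EuclideanSpace ℝ (Fin d) → ℝ} {K : ℝ≥0} {lam t : ℝ}
  {x y : EuclideanSpace ℝ (Fin d)}

/-- `T_t` is proper, hence closed, and its fiber over `T_t y` is `{y}`; so nearby fibers lie near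
`y`. -/
theorem tendsto_nhds_of_T_eq (ht : 0 ≤ t) (hK : LipschitzWith K φ) (hlam : 0 ≤ lam)
    (hconc : IsLambdaConcave lam φ) (hy : DifferentiableAt ℝ (w φ t) (T φ t y))
    {κ : EuclideanSpace ℝ (Fin d) → EuclideanSpace ℝ (Fin d)}
    (hκ : ∀ h, T φ t (y + κ h) = T φ t y + h) : Tendsto κ (𝓝 0) (𝓝 0) := by
  rw [Metric.tendsto_nhds]
  intro δ hδ
  have h1 := (isProperMap_T ht hK hlam hconc).isClosedMap.eventually_nhds_fiber
    (p := fun z => dist z y < δ) (T φ t y) (fun z hz => by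
      rw [T_preimage_of_differentiableAt ht hK hlam hconc hy, gradient_w_T ht hK hlam hconc hy] at hz
      rw [mem_singleton_iff.1 hz]
      exact Metric.ball_mem_nhds y hδ)
  have h2 : Tendsto (fun h => T φ t y + h) (𝓝 0) (𝓝 (T φ t y)) := by
    simpa using (tendsto_id (x := 𝓝 (0 : EuclideanSpace ℝ (Fin d)))).const_add (T φ t y)
  filter_upwards [h2.eventually h1] with h hh
  simpa [dist_eq_norm] using hh (y + κ h) (hκ h)

theorem exists_hasAlexandrovHessianAt (ht : 0 ≤ t) (hK : LipschitzWith K φ) (hlam : 0 ≤ lam)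
    (hconc : IsLambdaConcave lam φ) (hy : y ∈ regularSet φ t) :
    ∃ H : Matrix (Fin d) (Fin d) ℝ, HasAlexandrovHessianAt (w φ t) H (T φ t y) ∧
      ENNReal.ofReal H.det = (ENNReal.ofReal |(fderiv ℝ (T φ t) y).det|)⁻¹ := by
  obtain ⟨hw, hT, hdet⟩ := hy
  obtain ⟨e, he⟩ : ∃ e : EuclideanSpace ℝ (Fin d) ≃L[ℝ] EuclideanSpace ℝ (Fin d),
      (e : EuclideanSpace ℝ (Fin d) →L[ℝ] EuclideanSpace ℝ (Fin d)) = fderiv ℝ (T φ t) y :=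
    ⟨_, ContinuousLinearMap.coe_toContinuousLinearEquivOfDetNeZero _ hdet⟩
  have hTe := hT.hasFDerivAt
  rw [← he] at hTe
  have hg := hasGradientAt_psiConv_T ht hK hlam hconc
  have hsymm : ∀ u v, ⟪e u, v⟫ = ⟪u, e v⟫ := isSymmetric_of_hasGradientAt hg hTe
  have hpos : ∀ u, 0 ≤ ⟪u, e u⟫ := inner_apply_nonneg_of_monotone
    (fun u v => nonneg_of_mul_nonneg_right ((sq_nonneg _).trans
      (norm_sub_sq_le_inner_T ht hK hlam hconc u v)) (one_add_mul_pos ht hlam)) hTe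
  obtain ⟨H, hH⟩ : ∃ H : Matrix (Fin d) (Fin d) ℝ, Matrix.toEuclideanLin H =
      (e.symm : EuclideanSpace ℝ (Fin d) →L[ℝ] EuclideanSpace ℝ (Fin d)).toLinearMap :=
    Matrix.toEuclideanLin.surjective _
  have hHapp : ∀ h, Matrix.toEuclideanLin H h = e.symm h := fun h => by rw [hH]; rfl
  have hHpos : H.PosSemidef := by
    rw [← Matrix.isPositive_toEuclideanLin_iff]
    refine ⟨fun u v => ?_, fun u => ?_⟩
    · rw [hHapp, hHapp]
      have h1 := hsymm (e.symm u) (e.symm v)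
      rw [e.apply_symm_apply, e.apply_symm_apply] at h1
      exact h1.symm
    · rw [hHapp]
      have h1 := hpos (e.symm u)
      rw [e.apply_symm_apply] at h1
      exact h1
  have hHdet : H.det = (fderiv ℝ (T φ t) y).det⁻¹ := by
    have h1 : LinearMap.det (Matrix.toEuclideanLin H) = H.det := by
      rw [Matrix.toEuclideanLin_eq_toLin_orthonormal, LinearMap.det_toLin]
    rw [← h1, hH, ← he]
    exact ContinuousLinearEquiv.det_coe_symm e
  refine ⟨H, ⟨?_, hw, ?_⟩, ?_⟩
  · have h1 := hHpos.isHermitian.eq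
    rwa [Matrix.conjTranspose_eq_transpose_of_trivial] at h1
  · have hsurj : ∀ x, ∃ z, T φ t z = x := fun x => by
      obtain ⟨z, hz⟩ := exists_w_eq ht hK x
      exact ⟨z, (T_eq_iff ht hK hlam hconc).2 (mem_subgradient_w_of_eq ht hK hz)⟩
    -- Any selection of preimages will do; its continuity at `T_t y` is automatic from the singleton
    -- fiber.
    choose Y hY using hsurj
    have hκ : ∀ h, T φ t (y + (Y (T φ t y + h) - y)) = T φ t y + h := fun h => by
      rw [add_sub_cancel, hY]
    have h1 := isLittleO_second_order_conjugate (f := w φ t) hg hTe (fun z => by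
      rw [psiConv_eq_of_mem ht hK (mem_subgradient_T ht hK hlam hconc z)]; ring) hκ
      (tendsto_nhds_of_T_eq ht hK hlam hconc hw hκ)
    refine h1.congr_left fun h => ?_
    rw [gradient_w_T ht hK hlam hconc hw, hHapp]
  · have h0 := hHpos.det_nonneg
    rw [← abs_of_nonneg h0, hHdet, abs_inv, ENNReal.ofReal_inv_of_pos (abs_pos.2 hdet)]

end Alexandrov

end Adhesion

/-! ### The main theorem -/

open Adhesion

theorem theorem5 (d : ℕ) (φ : EuclideanSpace ℝ (Fin d) → ℝ) (K : ℝ≥0) (lam : ℝ)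
    (hK : LipschitzWith K φ) (hlam : 0 ≤ lam) (hconc : Adhesion.IsLambdaConcave lam φ) :
    -- the Lagrangian flow `X` is well defined
    (∃ X, Adhesion.IsAdhesionFlow φ X) ∧
    ∀ X, Adhesion.IsAdhesionFlow φ X → ∀ t : ℝ, 0 < t →
      -- `T_t` and `ρ_t` are well defined, and `w_t` is strictly convex
      Differentiable ℝ (Adhesion.psiConv φ t) ∧
      Measurable (X t) ∧
      StrictConvexOn ℝ univ (Adhesion.w φ t) ∧
      -- single-valued inverses and free streaming
      (∀ᵐ x : EuclideanSpace ℝ (Fin d), ∃ y ∈ Adhesion.Sigma φ t,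
        X t ⁻¹' {x} = {y} ∧ Adhesion.T φ t ⁻¹' {x} = {y} ∧
        DifferentiableAt ℝ φ y ∧
        ∀ s : ℝ, 0 ≤ s → s ≤ t →
          X s y = Adhesion.T φ s y ∧ Adhesion.T φ s y = y + s • ∇ φ y) ∧
      -- absolutely continuous parts and the Monge–Ampère equation
      ∃ μ : Measure (EuclideanSpace ℝ (Fin d)),
        Adhesion.IsMongeAmpereMeasure (Adhesion.w φ t) μ ∧
        (Adhesion.massMeasure X t).HaveLebesgueDecomposition volume ∧
        μ.HaveLebesgueDecomposition volume ∧
        Adhesion.acPart (Adhesion.massMeasure X t) = Adhesion.acPart μ ∧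
        ∀ᵐ x : EuclideanSpace ℝ (Fin d), ∃ H : Matrix (Fin d) (Fin d) ℝ,
          Adhesion.HasAlexandrovHessianAt (Adhesion.w φ t) H x ∧
          (Adhesion.massMeasure X t).rnDeriv volume x = ENNReal.ofReal H.det := by
  refine ⟨exists_isAdhesionFlow hK hlam hconc, fun X hX t ht => ?_⟩
  have hXc := (hX.lipschitzWith hK hlam hconc ht.le).continuous
  have hTc := (lipschitzWith_T ht.le hK hlam hconc).continuous
  have hfree := hX.ae_free_streaming hK hlam hconc ht
  have hXσ : SigmaFinite (Measure.map (X t) volume) := sigmaFinite_map_of_isProperMap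
    (isProperMap_of_norm_sub_le hXc (hX.norm_sub_le hK hlam hconc ht.le))
  have hTσ : SigmaFinite (Measure.map (T φ t) volume) :=
    sigmaFinite_map_of_isProperMap (isProperMap_T ht.le hK hlam hconc)
  -- The fibers of `X_t` and `T_t` over a.e. `x` are the same singleton, which is all that the
  -- absolutely continuous parts see.
  have hac : (Measure.map (X t) volume).rnDeriv volume =ᵐ[volume]
      (Measure.map (T φ t) volume).rnDeriv volume := by
    refine rnDeriv_map_congr hXc.measurable hTc.measurable ?_
    filter_upwards [hfree] with x ⟨y, _, hXy, hTy, _⟩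
    rw [hXy, hTy]
  refine ⟨differentiable_psiConv ht.le hK hlam hconc, hXc.measurable,
    strictConvexOn_w ht.le hK hlam hconc, hfree, Measure.map (T φ t) volume,
    isMongeAmpereMeasure_map_T ht.le hK hlam hconc, ?_, ?_, withDensity_congr_ae hac, ?_⟩
  · rw [massMeasure]
    infer_instance
  · infer_instance
  · filter_upwards [hac, rnDeriv_map_T ht hK hlam hconc,
      ae_gradient_w_mem_regularSet ht hK hlam hconc] with x hx hTx hreg
    obtain ⟨H, hH, hdet⟩ := exists_hasAlexandrovHessianAt ht.le hK hlam hconc hreg.2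
    rw [T_gradient_w ht.le hK hlam hconc hreg.1] at hH
    exact ⟨H, hH, by rw [massMeasure, hx, hTx, hdet]⟩
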